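/- Let $\mathbb{F}_q$ be a finite field with $q$ elements, let $S$ be a locally noetherian scheme over $\mathbb{F}_q$, and let $\mathcal{L}$ be an invertible sheaf on $S$. For an invertible sheaf $\mathcal{M}$ on $S$, the contravariant functor $(f:T\to S)\mapsto H^0(T,f^*\mathcal{M})$ from $S$-schemes to $\mathbb{F}_q$-vector spaces is representable; denote by $\mathbb{G}_{a,\mathcal{M}}$ the $S$-scheme that represents it, with its structure of $\mathbb{F}_q$-vector space object (the line bundle of $\mathcal{M}$). An $\mathbb{F}_q$-morphism $\mathbb{G}_{a,\mathcal{L}}\to\mathbb{G}_{a,\mathcal{M}}$ is a homomorphism of group schemes over $S$ that commutes with the actions of $\mathbb{F}_q$. A sequence $0\to X\to Y\to Z\to 0$ of group schemes over $S$ is exact if for every group scheme $T$ over $S$ the sequences $0\to\operatorname{Hom}(T,X)\to\operatorname{Hom}(T,Y)\to\operatorname{Hom}(T,Z)$ and $0\to\operatorname{Hom}(Z,T)\to\operatorname{Hom}(Y,T)\to\operatorname{Hom}(X,T)$ of homomorphisms over $S$ are exact (exactness means that the first map is injective and that its image is the set of those homomorphisms which become trivial under the second map). Let $G\subset\mathbb{G}_{a,\mathcal{L}}$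 be a finite flat $\mathbb{F}_q$-subgroup scheme, that is, a subgroup scheme, finite and flat over $S$, which is stable under the action of $\mathbb{F}_q$, and whose rank at every point of $S$ is a power $q^n$ of $q$ (with $n\ge 0$ depending on the point). Then: (1) There are an invertible sheaf $\mathcal{M}$ on $S$ and an $\mathbb{F}_q$-morphism $\xi:\mathbb{G}_{a,\mathcal{L}}\to\mathbb{G}_{a,\mathcal{M}}$ such that $0\to G\to\mathbb{G}_{a,\mathcal{L}}\xrightarrow{\ \xi\ }\mathbb{G}_{a,\mathcal{M}}\to 0$ is an exact sequence of group schemes over $S$. (2) The pair $(\mathcal{M},\xi)$ is unique up to a unique isomorphism: if $(\mathcal{M}',\xi')$ is another such pair, there is exactly one isomorphism $\theta:\mathbb{G}_{a,\mathcal{M}}\to\mathbb{G}_{a,\mathcal{M}'}$ of $S$-schemes that is an $\mathbb{F}_q$-morphism and satisfies $\theta\circ\xi=\xi'$. (3) If $S$ is connected, then $G$ has a constant rank $r$ over $S$, and for every pair $(\mathcal{M},\xi)$ as in (1) one has $\mathcal{M}\cong\mathcal{L}^{\otimes r}$, and $\xi$ is finite and flat of constant rank $r$. -/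

import Mathlib

universe u

open CategoryTheory Limits AlgebraicGeometry MonoidalCategory

noncomputable section

namespace FqBundle

variable {S : Scheme.{u}}

/-- The structure sheaf of a scheme, as a sheaf of modules over itself. -/
abbrev structureModule (X : Scheme.{u}) : X.Modules :=
  SheafOfModules.unit.{u} X.ringCatSheaf

/-- Invertible sheaves: sheaves of modules that are locally isomorphic to the structure sheaf. -/
def IsInvertible (L : S.Modules) : Prop :=
  ∀ x : S, ∃ U : S.Opens, x ∈ U ∧ Nonempty (L.restrict U.ι ≅ structureModule U)

/-- The `n`-fold tensor power in the category of presheaves of modules. -/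
def presheafTensorPow (P : PresheafOfModules.{u} (S.presheaf ⋙ forget₂ CommRingCat RingCat)) :
    ℕ → PresheafOfModules.{u} (S.presheaf ⋙ forget₂ CommRingCat RingCat)
  | 0 => 𝟙_ _
  | n + 1 => presheafTensorPow P n ⊗ P

/-- The tensor power `L^{⊗ n}` of a sheaf of modules: the sheaf of modules associated with the
presheaf `U ↦ Γ(L, U)^{⊗ n}` (tensor products over `Γ(S, U)`). -/
def tensorPow (L : S.Modules) (n : ℕ) : S.Modules :=
  (PresheafOfModules.sheafification (𝟙 S.ringCatSheaf.obj)).obj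
    (presheafTensorPow (S := S) ((Scheme.Modules.toPresheafOfModules S).obj L) n)

/-- For a morphism `g : T' ⟶ T` of `S`-schemes, with structure morphisms `f : T ⟶ S` and
`f' : T' ⟶ S`, the canonical morphism `f^* L ⟶ g_* (f'^* L)`. It is the adjoint of
the unit `L ⟶ f'_* f'^* L = f_* g_* f'^* L`. -/
def baseChangeHom (L : S.Modules) {T T' : Scheme.{u}} (f : T ⟶ S) (f' : T' ⟶ S) (g : T' ⟶ T)
    (w : g ≫ f = f') :
    (Scheme.Modules.pullback f).obj L ⟶
      (Scheme.Modules.pushforward g).obj ((Scheme.Modules.pullback f').obj L) :=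
  ((Scheme.Modules.pullbackPushforwardAdjunction f).homEquiv _ _).symm
    ((Scheme.Modules.pullbackPushforwardAdjunction f').unit.app L ≫
      (Scheme.Modules.pushforwardCongr w.symm).hom.app _ ≫
      (Scheme.Modules.pushforwardComp g f).inv.app _)

lemma baseChangeHom_id (L : S.Modules) {T : Scheme.{u}} (f : T ⟶ S) (w : 𝟙 T ≫ f = f) :
    baseChangeHom L f f (𝟙 T) w = (Scheme.Modules.pushforwardId _).inv.app _ := by
  unfold baseChangeHom
  rw [Equiv.symm_apply_eq, Adjunction.homEquiv_unit]
  congr 1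
  ext U x
  exact congr($(((Scheme.Modules.pullback f).obj L).presheaf.map_id (.op (f ⁻¹ᵁ U))) x)

lemma baseChangeHom_unit (L : S.Modules) {T T' : Scheme.{u}} (f : T ⟶ S) (f' : T' ⟶ S)
    (g : T' ⟶ T) (w : g ≫ f = f') :
    (Scheme.Modules.pullbackPushforwardAdjunction f).unit.app L ≫
      (Scheme.Modules.pushforward f).map (baseChangeHom L f f' g w) =
    (Scheme.Modules.pullbackPushforwardAdjunction f').unit.app L ≫
      (Scheme.Modules.pushforwardCongr w.symm).hom.app _ ≫
      (Scheme.Modules.pushforwardComp g f).inv.app _ := by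
  have := (Scheme.Modules.pullbackPushforwardAdjunction f).homEquiv_unit
    (f := baseChangeHom L f f' g w)
  rw [baseChangeHom, Equiv.apply_symm_apply] at this
  exact this.symm

lemma baseChangeHom_comp (L : S.Modules) {T T' T'' : Scheme.{u}} (f : T ⟶ S) (f' : T' ⟶ S)
    (f'' : T'' ⟶ S) (g : T' ⟶ T) (h : T'' ⟶ T') (w : g ≫ f = f') (w' : h ≫ f' = f'')
    (w'' : (h ≫ g) ≫ f = f'') :
    baseChangeHom L f f'' (h ≫ g) w'' = baseChangeHom L f f' g w ≫
      (Scheme.Modules.pushforward g).map (baseChangeHom L f' f'' h w') ≫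
      (Scheme.Modules.pushforwardComp h g).hom.app _ := by
  subst w w'
  conv_lhs => unfold baseChangeHom
  rw [Equiv.symm_apply_eq, Adjunction.homEquiv_unit]
  have k1 := baseChangeHom_unit L (g ≫ f) _ h rfl
  have k2 := baseChangeHom_unit L f _ g rfl
  ext U : 1
  have h1 := congr(Scheme.Modules.Hom.app $k1 U)
  have h2 := congr(Scheme.Modules.Hom.app $k2 U)
  simp only [Scheme.Modules.Hom.comp_app, Scheme.Modules.pushforward_map_app,
    Scheme.Modules.pushforwardCongr_hom_app_app, Scheme.Modules.pushforwardComp_inv_app_app,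
    Scheme.Modules.pushforwardComp_hom_app_app, Functor.map_comp] at h1 h2 ⊢
  have i1 := ((Scheme.Modules.pullback (g ≫ f)).obj L).presheaf.map_id
    (.op ((g ≫ f) ⁻¹ᵁ U))
  have i2 := ((Scheme.Modules.pullback (h ≫ g ≫ f)).obj L).presheaf.map_id
    (.op ((h ≫ g ≫ f) ⁻¹ᵁ U))
  refine (congrArg (fun a => Scheme.Modules.Hom.app
    ((Scheme.Modules.pullbackPushforwardAdjunction (h ≫ g ≫ f)).unit.app L) U ≫ a) i2).trans ?_
  replace h1 := h1.trans (congrArg (fun a => Scheme.Modules.Hom.app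
    ((Scheme.Modules.pullbackPushforwardAdjunction (h ≫ g ≫ f)).unit.app L) U ≫ a) i2)
  replace h2 := h2.trans (congrArg (fun a => Scheme.Modules.Hom.app
    ((Scheme.Modules.pullbackPushforwardAdjunction (g ≫ f)).unit.app L) U ≫ a) i1)
  ext x
  have h1' := congr($h1 x)
  have h2' := congr($h2 x)
  exact h1'.symm.trans (congrArg (fun y => Scheme.Modules.Hom.app
    (baseChangeHom L (g ≫ f) (h ≫ g ≫ f) h rfl) (g ⁻¹ᵁ f ⁻¹ᵁ U) y) h2').symm

/-- The ring homomorphism `k → Γ(T, 𝒪_T)` for an `S`-scheme `T`, where `S` is a scheme over `k`. -/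
def scalars {k : Type u} [Field k] (s : S ⟶ Spec (.of k)) (T : Over S) : k →+* Γ(T.left, ⊤) :=
  ((Scheme.ΓSpecIso (.of k)).inv ≫ (T.hom ≫ s).appTop).hom

/-- The global sections `H⁰(T, f^* L)` for an `S`-scheme `f : T ⟶ S`. -/
def Sections {k : Type u} [Field k] (_s : S ⟶ Spec (.of k)) (L : S.Modules) (T : Over S) :
    Type u :=
  Γ((Scheme.Modules.pullback T.hom).obj L, ⊤)

section

variable {k : Type u} [Field k] (s : S ⟶ Spec (.of k)) (L : S.Modules)

instance (T : Over S) : AddCommGroup (Sections s L T) :=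
  inferInstanceAs (AddCommGroup Γ((Scheme.Modules.pullback T.hom).obj L, ⊤))

/-- `k` acts on `H⁰(T, f^* L)` through `k → Γ(T, 𝒪_T)`. -/
instance (T : Over S) : Module k (Sections s L T) :=
  Module.compHom Γ((Scheme.Modules.pullback T.hom).obj L, ⊤) (scalars s T)

lemma scalars_comp {T T' : Over S} (g : T' ⟶ T) (c : k) :
    g.left.appTop (scalars s T c) = scalars s T' c := by
  have : (T'.hom ≫ s).appTop = (T.hom ≫ s).appTop ≫ g.left.appTop := by
    rw [← Scheme.Hom.comp_appTop, ← Category.assoc, Over.w]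
  simp [scalars, this]

/-- The pullback of sections along a morphism `g : T' ⟶ T` of `S`-schemes. -/
def Sections.map {T T' : Over S} (g : T' ⟶ T) : Sections s L T →ₗ[k] Sections s L T' where
  toFun := (baseChangeHom L T.hom T'.hom g.left (Over.w g)).app ⊤
  map_add' x y := map_add ((baseChangeHom L T.hom T'.hom g.left (Over.w g)).app ⊤).hom x y
  map_smul' c x := by
    refine (Scheme.Modules.Hom.app_smul (baseChangeHom L T.hom T'.hom g.left (Over.w g)) (scalars s T c) x).trans ?_
    rw [RingHom.id_apply]
    let y : Γ((Scheme.Modules.pullback T'.hom).obj L, ⊤) :=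
      (baseChangeHom L T.hom T'.hom g.left (Over.w g)).app ⊤ x
    exact congrArg (fun a : Γ(T'.left, ⊤) => a • y) (scalars_comp s g c)

/-- The contravariant functor `(f : T ⟶ S) ↦ H⁰(T, f^* L)` from `S`-schemes to
`k`-vector spaces. -/
def sectionsFunctor : (Over S)ᵒᵖ ⥤ ModuleCat.{u} k where
  obj T := ModuleCat.of k (Sections s L T.unop)
  map g := ModuleCat.ofHom (Sections.map s L g.unop)
  map_id T := by
    ext x
    exact congr($(congr(Scheme.Modules.Hom.app
      $(baseChangeHom_id L T.unop.hom (Over.w (𝟙 T.unop))) ⊤)) x)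
  map_comp g h := by
    ext x
    exact congr($(congr(Scheme.Modules.Hom.app
      $(baseChangeHom_comp L _ _ _ g.unop.left h.unop.left (Over.w g.unop) (Over.w h.unop)
        (Over.w (h.unop ≫ g.unop))) ⊤)) x)

/-- A line bundle `𝔾_{a,L}`: an `S`-scheme that represents the functor
`(f : T ⟶ S) ↦ H⁰(T, f^* L)`. It is determined by `L` up to a unique isomorphism. -/
structure LineBundle where
  /-- The underlying `S`-scheme. -/
  X : Over S
  /-- The natural bijections `Hom_S(T, X) ≃ H⁰(T, f^* L)`. -/
  rep : (sectionsFunctor s L ⋙ forget (ModuleCat.{u} k)).RepresentableBy X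

end

namespace LineBundle

variable {k : Type u} [Field k] {s : S ⟶ Spec (.of k)} {L M : S.Modules}

/-- The group scheme structure of `𝔾_{a,L}`, which on `T`-valued points is the addition of
`H⁰(T, f^* L)`. -/
instance (V : LineBundle s L) : AddGrpObj V.X :=
  AddGrpObj.ofRepresentableBy V.X
    (sectionsFunctor s L ⋙ forget₂ (ModuleCat.{u} k) AddCommGrpCat.{u} ⋙
      forget₂ AddCommGrpCat.{u} AddGrpCat.{u}) V.rep

/-- The action of `c : k` on `𝔾_{a,L}`, which on `T`-valued points is the multiplication by `c`
on `H⁰(T, f^* L)`. -/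
def smul (V : LineBundle s L) (c : k) : V.X ⟶ V.X :=
  V.rep.homEquiv.symm (c • (V.rep.homEquiv (𝟙 V.X) : Sections s L V.X) : Sections s L V.X)

/-- `k`-linear homomorphisms of group schemes between line bundles. -/
structure IsFqHom (V : LineBundle s L) (W : LineBundle s M) (ξ : V.X ⟶ W.X) : Prop where
  isHom : IsAddMonHom ξ
  smul_comp : ∀ c : k, V.smul c ≫ ξ = ξ ≫ W.smul c

/-- Finite flat subgroup schemes `i : G ⟶ 𝔾_{a,L}` that are stable under the action of `k`. -/
structure IsFiniteFlatFqSubgroup (V : LineBundle s L) {G : Over S} [AddGrpObj G]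
    (i : G ⟶ V.X) : Prop where
  mono : Mono i
  isHom : IsAddMonHom i
  finite : IsFinite G.hom
  flat : Flat G.hom
  stable : ∀ c : k, ∃ a : G ⟶ G, a ≫ i = i ≫ V.smul c

end LineBundle

open scoped AddMonObj in
/-- Short exact sequences `0 ⟶ X ⟶ Y ⟶ Z ⟶ 0` of group schemes over `S`: for every group scheme
`T` over `S` the sequences of groups of homomorphisms `0 ⟶ Hom(T, X) ⟶ Hom(T, Y) ⟶ Hom(T, Z)` and
`0 ⟶ Hom(Z, T) ⟶ Hom(Y, T) ⟶ Hom(X, T)` are exact. Here `0` is the trivial homomorphism. -/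
structure IsShortExact {X Y Z : Over S} [AddGrpObj X] [AddGrpObj Y] [AddGrpObj Z]
    (i : X ⟶ Y) (p : Y ⟶ Z) : Prop where
  left_inj : ∀ (T : Over S) [AddGrpObj T] (a b : T ⟶ X), IsAddMonHom a → IsAddMonHom b →
    a ≫ i = b ≫ i → a = b
  left_exact : ∀ (T : Over S) [AddGrpObj T] (f : T ⟶ Y), IsAddMonHom f →
    (f ≫ p = 0 ↔ ∃ a : T ⟶ X, IsAddMonHom a ∧ a ≫ i = f)
  right_inj : ∀ (T : Over S) [AddGrpObj T] (a b : Z ⟶ T), IsAddMonHom a → IsAddMonHom b →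
    p ≫ a = p ≫ b → a = b
  right_exact : ∀ (T : Over S) [AddGrpObj T] (f : Y ⟶ T), IsAddMonHom f →
    (i ≫ f = 0 ↔ ∃ a : Z ⟶ T, IsAddMonHom a ∧ p ≫ a = f)

end FqBundle

end

/-!
Locally on `S` a generator of `L` identifies `𝔾_{a,L}` with the affine line, and a finite flat
subgroup scheme `G` of rank `r = qⁿ` becomes the zero locus of a unique monic polynomial `P` of
degree `r`. Since `G` is stable under addition and under the scalars in `𝔽_q`, the polynomial
`P (X + Y) - P X - P Y` vanishes on `G × G` and `P (a X) - a ^ r P X` vanishes on `G`; both have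
degree less than `r` in each variable, so they are zero, and `a ^ r = a` because `r` is a power of
`q`. By the same argument, multiplying the generator of `L` by a unit `u` multiplies the equation
by `u ^ r`; hence the local equations glue to an `𝔽_q`-morphism `ξ : 𝔾_{a,L} ⟶ 𝔾_{a,M}`, where `M`
is locally the `r`-th tensor power of `L`. Because `P` is monic, `ξ` is finite flat of rank `r`,
hence an epimorphism by descent, and its kernel is `G`. Exactness determines the quotient up to
unique isomorphism, and the linear part of an isomorphism `𝔾_{a,M} ≅ 𝔾_{a,M'}` is an isomorphism
`M ≅ M'`.
-/

noncomputable section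

namespace FqBundle

variable {S : Scheme.{u}}

/-! ### Sections of sheaves of modules -/

section Sections

variable {X : Scheme.{u}}

/-- Restriction of sections of a sheaf of modules, indexed by the inclusion of open subsets. -/
def restrictSection (M : X.Modules) {U V : X.Opens} (h : V ≤ U) : Γ(M, U) →+ Γ(M, V) :=
  (M.presheaf.map (homOfLE h).op).hom

/-- Restriction of functions, indexed by the inclusion of open subsets. -/
def restrictFunction (X : Scheme.{u}) {U V : X.Opens} (h : V ≤ U) : Γ(X, U) →+* Γ(X, V) :=
  (X.presheaf.map (homOfLE h).op).hom

lemma restrictSection_self (M : X.Modules) {U : X.Opens} (h : U ≤ U) (x : Γ(M, U)) :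
    restrictSection M h x = x :=
  congr($(M.presheaf.map_id (.op U)) x)

lemma restrictSection_restrictSection (M : X.Modules) {U V W : X.Opens} (h : V ≤ U) (h' : W ≤ V)
    (x : Γ(M, U)) :
    restrictSection M h' (restrictSection M h x) = restrictSection M (h'.trans h) x :=
  congr($(M.presheaf.map_comp (homOfLE h).op (homOfLE h').op) x).symm

lemma restrictSection_smul (M : X.Modules) {U V : X.Opens} (h : V ≤ U) (a : Γ(X, U))
    (x : Γ(M, U)) :
    restrictSection M h (a • x) = restrictFunction X h a • restrictSection M h x :=
  Scheme.Modules.map_smul M (homOfLE h) a x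

lemma app_restrictSection {M N : X.Modules} (φ : M ⟶ N) {U V : X.Opens} (h : V ≤ U)
    (x : Γ(M, U)) : φ.app V (restrictSection M h x) = restrictSection N h (φ.app U x) :=
  congr($(φ.mapPresheaf.naturality (homOfLE h).op) x)

lemma app_bijective {M N : X.Modules} (φ : M ⟶ N) [IsIso φ] (U : X.Opens) :
    Function.Bijective (φ.app U) :=
  (ConcreteCategory.isIso_iff_bijective (φ.app U)).mp inferInstance

lemma restrictSection_bijective (M : X.Modules) {U V : X.Opens} (h : V ≤ U) (h' : U ≤ V) :
    Function.Bijective (restrictSection M h) := by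
  obtain rfl := le_antisymm h h'
  convert Function.bijective_id using 1
  ext x
  exact restrictSection_self M _ x

lemma section_ext (M : X.Modules) {ι : Type*} (V : X.Opens) (U : ι → X.Opens) (hU : ∀ i, U i ≤ V)
    (hV : ∀ x ∈ V, ∃ i, x ∈ U i) {s t : Γ(M, V)}
    (h : ∀ i, restrictSection M (hU i) s = restrictSection M (hU i) t) : s = t :=
  TopCat.Sheaf.eq_of_locally_eq' ⟨M.presheaf, M.isSheaf⟩ U V (fun i => homOfLE (hU i))
    (fun x hx => by simpa using hV x hx) s t h

lemma exists_section_glue (M : X.Modules) {ι : Type*} (V : X.Opens) (U : ι → X.Opens)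
    (hU : ∀ i, U i ≤ V) (hV : ∀ x ∈ V, ∃ i, x ∈ U i) (s : ∀ i, Γ(M, U i))
    (h : ∀ i j (W : X.Opens) (hi : W ≤ U i) (hj : W ≤ U j),
      restrictSection M hi (s i) = restrictSection M hj (s j)) :
    ∃ t : Γ(M, V), ∀ i, restrictSection M (hU i) t = s i :=
  (TopCat.Sheaf.existsUnique_gluing' ⟨M.presheaf, M.isSheaf⟩ U V (fun i => homOfLE (hU i))
    (fun x hx => by simpa using hV x hx) s
    (fun i j => h i j (U i ⊓ U j) inf_le_left inf_le_right)).exists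

lemma function_ext {ι : Type*} (V : X.Opens) (U : ι → X.Opens) (hU : ∀ i, U i ≤ V)
    (hV : ∀ x ∈ V, ∃ i, x ∈ U i) {s t : Γ(X, V)}
    (h : ∀ i, restrictFunction X (hU i) s = restrictFunction X (hU i) t) : s = t :=
  TopCat.Sheaf.eq_of_locally_eq' X.sheaf U V (fun i => homOfLE (hU i))
    (fun x hx => by simpa using hV x hx) s t h

lemma exists_function_glue {ι : Type*} (V : X.Opens) (U : ι → X.Opens) (hU : ∀ i, U i ≤ V)
    (hV : ∀ x ∈ V, ∃ i, x ∈ U i) (s : ∀ i, Γ(X, U i))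
    (h : ∀ i j (W : X.Opens) (hi : W ≤ U i) (hj : W ≤ U j),
      restrictFunction X hi (s i) = restrictFunction X hj (s j)) :
    ∃ t : Γ(X, V), ∀ i, restrictFunction X (hU i) t = s i :=
  (TopCat.Sheaf.existsUnique_gluing' X.sheaf U V (fun i => homOfLE (hU i))
    (fun x hx => by simpa using hV x hx) s
    (fun i j => h i j (U i ⊓ U j) inf_le_left inf_le_right)).exists

/-- The homomorphism `𝒪 ⟶ M` that corresponds to a global section of `M`. -/
def homOfSection (M : X.Modules) (m : Γ(M, ⊤)) : structureModule X ⟶ M :=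
  (SheafOfModules.unitHomEquiv (R := X.ringCatSheaf) M).symm
    (PresheafOfModules.sectionsMk (M := M.val)
      (fun U => restrictSection M (U := ⊤) (V := U.unop) le_top m)
      (fun U V f => restrictSection_restrictSection M (U := ⊤) (V := U.unop) (W := V.unop) le_top
        (leOfHom f.unop) m))

/-- A function, viewed as a section of the structure sheaf. It is the identity map, and keeps the
ring `Γ(X, U)` apart from the module `Γ(structureModule X, U)`. -/
def toStructureModule {U : X.Opens} (a : Γ(X, U)) : Γ(structureModule X, U) := a

lemma toStructureModule_bijective (U : X.Opens) :
    Function.Bijective (toStructureModule (X := X) (U := U)) :=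
  Function.bijective_id

lemma homOfSection_app (M : X.Modules) (m : Γ(M, ⊤)) (U : X.Opens) (a : Γ(X, U)) :
    (homOfSection M m).app U (toStructureModule a) = a • restrictSection M le_top m :=
  rfl

lemma homOfSection_app_one (M : X.Modules) (m : Γ(M, ⊤)) :
    (homOfSection M m).app ⊤ (toStructureModule 1) = m := by
  refine (homOfSection_app M m ⊤ 1).trans ?_
  rw [one_smul, restrictSection_self]

lemma toStructureModule_eq_smul {U : X.Opens} (a : Γ(X, U)) :
    toStructureModule a =
      a • restrictSection (structureModule X) (le_top (a := U)) (toStructureModule 1) := by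
  have restrict_one : restrictSection (structureModule X) (le_top (a := U)) (toStructureModule 1) =
      toStructureModule 1 :=
    (restrictFunction X (le_top (a := U))).map_one
  rw [restrict_one]
  exact (mul_one a).symm

lemma structureModule_hom_app {M : X.Modules} (φ : structureModule X ⟶ M) (U : X.Opens)
    (a : Γ(X, U)) : φ.app U (toStructureModule a) =
      a • restrictSection M (le_top (a := U)) (φ.app ⊤ (toStructureModule 1)) := by
  rw [← app_restrictSection, ← Scheme.Modules.Hom.app_smul, ← toStructureModule_eq_smul]

lemma structureModule_hom_ext {M : X.Modules} {φ ψ : structureModule X ⟶ M}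
    (h : φ.app ⊤ (toStructureModule 1) = ψ.app ⊤ (toStructureModule 1)) : φ = ψ := by
  ext U a
  obtain ⟨a, rfl⟩ := (toStructureModule_bijective U).2 a
  exact (structureModule_hom_app φ U a).trans (h ▸ (structureModule_hom_app ψ U a).symm)

lemma structureModule_hom_bijective (M : X.Modules) :
    Function.Bijective fun φ : structureModule X ⟶ M => φ.app ⊤ (toStructureModule 1) :=
  ⟨fun _ _ h => structureModule_hom_ext h, fun m => ⟨homOfSection M m, homOfSection_app_one M m⟩⟩

/-- The section `g` of `M` over `U` is a basis of the restriction of `M` to `U`. -/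
def IsGeneratorOn (M : X.Modules) (U : X.Opens) (g : Γ(M, U)) : Prop :=
  ∀ (V : X.Opens) (h : V ≤ U), Function.Bijective fun a : Γ(X, V) => a • restrictSection M h g

lemma IsGeneratorOn.mono {M : X.Modules} {U V : X.Opens} {g : Γ(M, U)} (hg : IsGeneratorOn M U g)
    (h : V ≤ U) : IsGeneratorOn M V (restrictSection M h g) := by
  intro W hW
  rw [restrictSection_restrictSection]
  exact hg W _

lemma IsGeneratorOn.smul_bijective {M : X.Modules} {m : Γ(M, ⊤)} (hm : IsGeneratorOn M ⊤ m) :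
    Function.Bijective fun a : Γ(X, ⊤) => a • m := by
  simpa only [restrictSection_self] using hm ⊤ le_rfl

lemma IsGeneratorOn.isIso {M : X.Modules} {m : Γ(M, ⊤)} (hm : IsGeneratorOn M ⊤ m) :
    IsIso (homOfSection M m) := by
  rw [Scheme.Modules.Hom.isIso_iff_isIso_app]
  intro U
  exact (ConcreteCategory.isIso_iff_bijective ((homOfSection M m).app U)).mpr (hm U le_top)

lemma isGeneratorOn_of_isIso {M : X.Modules} (φ : structureModule X ⟶ M) [IsIso φ] :
    IsGeneratorOn M ⊤ (φ.app ⊤ (toStructureModule 1)) := by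
  intro U h
  convert (app_bijective φ U).comp (toStructureModule_bijective U) using 1
  funext a
  exact (structureModule_hom_app φ U a).symm

lemma IsGeneratorOn.map_iso {M N : X.Modules} (φ : M ⟶ N) [IsIso φ] {U : X.Opens} {g : Γ(M, U)}
    (hg : IsGeneratorOn M U g) : IsGeneratorOn N U (φ.app U g) := by
  intro V h
  convert (app_bijective φ V).comp (hg V h) using 1
  funext a
  rw [← app_restrictSection, ← Scheme.Modules.Hom.app_smul]
  rfl

lemma IsGeneratorOn.restrict {Y : Scheme.{u}} {M : X.Modules} (f : Y ⟶ X) [IsOpenImmersion f]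
    {U : X.Opens} {g : Γ(M, U)} (hg : IsGeneratorOn M U g) (hU : f ''ᵁ ⊤ ≤ U) :
    IsGeneratorOn (M.restrict f) ⊤ (restrictSection M hU g : Γ(M, f ''ᵁ ⊤)) := by
  intro V h
  have bijective_on_image := hg (f ''ᵁ V) ((f.image_mono h).trans hU)
  rw [← restrictSection_restrictSection M hU (f.image_mono h)] at bijective_on_image
  exact bijective_on_image.comp (ConcreteCategory.bijective_of_isIso (f.appIso V).inv)

lemma IsGeneratorOn.of_restrict {Y : Scheme.{u}} {M : X.Modules} (f : Y ⟶ X) [IsOpenImmersion f]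
    {g : Γ(M, f ''ᵁ ⊤)} (hg : IsGeneratorOn (M.restrict f) ⊤ (g : Γ(M.restrict f, ⊤))) :
    IsGeneratorOn M (f ''ᵁ ⊤) g := by
  intro V h
  obtain ⟨W, rfl⟩ : ∃ W, f ''ᵁ W = V := by
    refine ⟨f ⁻¹ᵁ V, ?_⟩
    rw [f.image_preimage_eq_opensRange_inf]
    exact inf_eq_right.mpr (h.trans (f.image_le_opensRange ⊤))
  exact (Function.Bijective.of_comp_iff _ (ConcreteCategory.bijective_of_isIso
    (f.appIso W).inv)).mp (hg W le_top)

end Sections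

/-! ### Pullback of modules -/

section Pullback

open Scheme.Modules (pullbackPushforwardAdjunction pushforward restrictAdjunction)

lemma pullback_unit_app_bijective {T T' : Scheme.{u}} (g : T' ⟶ T) (N : T.Modules)
    [IsOpenImmersion g] (U : T.Opens) (hU : U ≤ g.opensRange) :
    Function.Bijective (((pullbackPushforwardAdjunction g).unit.app N).app U) := by
  have restrict_bijective :
      Function.Bijective (N.presheaf.map (homOfLE (g.image_preimage_le U)).op) := by
    refine restrictSection_bijective N (g.image_preimage_le U) ?_
    rw [g.image_preimage_eq_opensRange_inf]
    exact le_inf hU le_rfl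
  rw [← (restrictAdjunction g).unit_leftAdjointUniq_hom_app (pullbackPushforwardAdjunction g) N,
    Scheme.Modules.Hom.comp_app, Scheme.Modules.pushforward_map_app,
    Scheme.Modules.restrictAdjunction_unit_app_app]
  exact (app_bijective (((restrictAdjunction g).leftAdjointUniq
    (pullbackPushforwardAdjunction g)).hom.app N) (g ⁻¹ᵁ U)).comp restrict_bijective

lemma restrictSection_restrict_unit {X Y : Scheme.{u}} (M : X.Modules) (f : Y ⟶ X)
    [IsOpenImmersion f] {U : X.Opens} (h : f ''ᵁ ⊤ ≤ U) (h' : ⊤ ≤ f ⁻¹ᵁ U) (g : Γ(M, U)) :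
    restrictSection (M.restrict f) h' (((restrictAdjunction f).unit.app M).app U g) =
      restrictSection M h g :=
  restrictSection_restrictSection M (U := U) (V := f ''ᵁ f ⁻¹ᵁ U) (W := f ''ᵁ ⊤)
    (f.image_preimage_le U) (f.image_mono h') g

lemma restrictSection_pullback_unit {X Y : Scheme.{u}} (M : X.Modules) (f : Y ⟶ X)
    [IsOpenImmersion f] {U : X.Opens} (h : f ''ᵁ ⊤ ≤ U) (h' : ⊤ ≤ f ⁻¹ᵁ U) (g : Γ(M, U)) :
    restrictSection ((Scheme.Modules.pullback f).obj M) h'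
      (((pullbackPushforwardAdjunction f).unit.app M).app U g) =
      ((Scheme.Modules.restrictFunctorIsoPullback f).hom.app M).app ⊤ (restrictSection M h g) := by
  let e := (Scheme.Modules.restrictFunctorIsoPullback f).hom.app M
  have unit_comp : (restrictAdjunction f).unit.app M ≫ (pushforward f).map e =
      (pullbackPushforwardAdjunction f).unit.app M :=
    (restrictAdjunction f).unit_leftAdjointUniq_hom_app (pullbackPushforwardAdjunction f) M
  have unit_comp_app := congr($(congr(Scheme.Modules.Hom.app $unit_comp U)) g)
  have e_app_restrict :=
    app_restrictSection e h' (((restrictAdjunction f).unit.app M).app U g)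
  rw [← unit_comp_app]
  exact e_app_restrict.symm.trans (congrArg _ (restrictSection_restrict_unit M f h h' g))

variable (L : S.Modules) {T T' : Scheme.{u}} (f : T ⟶ S) (f' : T' ⟶ S) (g : T' ⟶ T)
  (w : g ≫ f = f')

lemma baseChangeHom_comp_bijective (N : T'.Modules) :
    Function.Bijective fun ψ : (Scheme.Modules.pullback f').obj L ⟶ N =>
      baseChangeHom L f f' g w ≫ (pushforward g).map ψ := by
  let e : (pushforward f').obj N ≅ (pushforward f).obj ((pushforward g).obj N) :=
    (Scheme.Modules.pushforwardCongr w.symm).app N ≪≫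
      (Scheme.Modules.pushforwardComp g f).symm.app N
  have transpose_comp : (pullbackPushforwardAdjunction f).homEquiv _ _ ∘
      (fun ψ : (Scheme.Modules.pullback f').obj L ⟶ N =>
        baseChangeHom L f f' g w ≫ (pushforward g).map ψ) =
      e.homToEquiv ∘ (pullbackPushforwardAdjunction f').homEquiv _ _ := by
    funext ψ
    have := baseChangeHom_unit L f f' g w
    simp only [Function.comp, Adjunction.homEquiv_unit, Functor.map_comp, reassoc_of% this,
      Iso.homToEquiv_apply, Category.assoc]
    congr 1
    subst w
    ext U x
    exact congr($(ψ.mapPresheaf.naturality (homOfLE (le_refl ((g ≫ f) ⁻¹ᵁ U))).op) x)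
  have composite_bijective := e.homToEquiv.bijective.comp
    ((pullbackPushforwardAdjunction f').homEquiv L N).bijective
  rw [← transpose_comp] at composite_bijective
  exact (Function.Bijective.of_comp_iff' (Equiv.bijective _) _).mp composite_bijective

/-- The comparison `g^* f^* L ⟶ f'^* L` that corresponds to `baseChangeHom` by adjunction. -/
def pullbackComparison :
    (Scheme.Modules.pullback g).obj ((Scheme.Modules.pullback f).obj L) ⟶
      (Scheme.Modules.pullback f').obj L :=
  ((pullbackPushforwardAdjunction g).homEquiv _ _).symm (baseChangeHom L f f' g w)

lemma unit_pullbackComparison : (pullbackPushforwardAdjunction g).unit.app _ ≫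
    (pushforward g).map (pullbackComparison L f f' g w) = baseChangeHom L f f' g w :=
  ((pullbackPushforwardAdjunction g).homEquiv_unit _ _ _).symm.trans (Equiv.apply_symm_apply _ _)

instance : IsIso (pullbackComparison L f f' g w) := by
  apply isIso_of_coyoneda_map_bijective
  intro N
  have transpose_comp : (fun ψ : (Scheme.Modules.pullback f').obj L ⟶ N =>
      baseChangeHom L f f' g w ≫ (pushforward g).map ψ) =
      (pullbackPushforwardAdjunction g).homEquiv _ _ ∘
        (fun ψ => pullbackComparison L f f' g w ≫ ψ) := by
    funext ψ
    rw [Function.comp, Adjunction.homEquiv_unit, Functor.map_comp, ← Category.assoc,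
      unit_pullbackComparison]
  exact (Function.Bijective.of_comp_iff' (Equiv.bijective _) _).mp
    (transpose_comp ▸ baseChangeHom_comp_bijective L f f' g w N)

lemma baseChangeHom_app_bijective [IsOpenImmersion g] (U : T.Opens) (hU : U ≤ g.opensRange) :
    Function.Bijective ((baseChangeHom L f f' g w).app U) := by
  rw [← unit_pullbackComparison, Scheme.Modules.Hom.comp_app, Scheme.Modules.pushforward_map_app]
  exact (app_bijective (pullbackComparison L f f' g w) (g ⁻¹ᵁ U)).comp
    (pullback_unit_app_bijective g _ U hU)

-- A morphism out of `f'^* L` is determined by its adjoint out of `f^* L ≅ 𝒪_T`, that is, by the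
-- image of the pulled back generator; so that section represents the same functor as `𝒪_{T'}`.
lemma IsGeneratorOn.baseChange {m : Γ((Scheme.Modules.pullback f).obj L, ⊤)}
    (hm : IsGeneratorOn ((Scheme.Modules.pullback f).obj L) ⊤ m) :
    IsGeneratorOn ((Scheme.Modules.pullback f').obj L) ⊤
      ((baseChangeHom L f f' g w).app ⊤ m : Γ((Scheme.Modules.pullback f').obj L, ⊤)) := by
  let m' : Γ((Scheme.Modules.pullback f').obj L, ⊤) := (baseChangeHom L f f' g w).app ⊤ m
  let φ := homOfSection _ m
  let φ' := homOfSection ((Scheme.Modules.pullback f').obj L) m'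
  have : IsIso φ := hm.isIso
  have hφ : φ.app ⊤ (toStructureModule 1) = m := homOfSection_app_one _ m
  have hφ' : φ'.app ⊤ (toStructureModule 1) = m' := homOfSection_app_one _ m'
  have : IsIso φ' := by
    apply isIso_of_coyoneda_map_bijective
    intro N
    refine (Function.Bijective.of_comp_iff' (structureModule_hom_bijective N) _).mp ?_
    have precomp_bijective :
        Function.Bijective fun ψ : (Scheme.Modules.pullback f).obj L ⟶ (pushforward g).obj N =>
          φ ≫ ψ :=
      ⟨fun _ _ h => (cancel_epi φ).mp h, fun b => ⟨inv φ ≫ b, by simp⟩⟩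
    have adjoint_bijective := ((structureModule_hom_bijective ((pushforward g).obj N)).comp
      precomp_bijective).comp (baseChangeHom_comp_bijective L f f' g w N)
    have value_eq (ψ : (Scheme.Modules.pullback f').obj L ⟶ N) :
        (φ' ≫ ψ).app ⊤ (toStructureModule 1) = (φ ≫ baseChangeHom L f f' g w ≫
          (pushforward g).map ψ).app ⊤ (toStructureModule 1) :=
      (congrArg (fun y => ψ.app ⊤ y) hφ').trans
        (congrArg (fun y => (baseChangeHom L f f' g w ≫ (pushforward g).map ψ).app ⊤ y) hφ).symm
    exact ⟨fun a b h => adjoint_bijective.1 ((value_eq a).symm.trans (h.trans (value_eq b))),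
      fun y => (adjoint_bijective.2 y).imp fun a h => (value_eq a).trans h⟩
  change IsGeneratorOn _ ⊤ m'
  rw [← hφ']
  exact isGeneratorOn_of_isIso φ'

end Pullback

/-! ### Sections over `S`-schemes -/

section SectionsBasics

variable {k : Type u} [Field k] {s : S ⟶ Spec (.of k)} {L : S.Modules}

instance (T : Over S) : Module Γ(T.left, ⊤) (Sections s L T) :=
  inferInstanceAs (Module Γ(T.left, ⊤) Γ((Scheme.Modules.pullback T.hom).obj L, ⊤))

lemma scalars_smul {T : Over S} (c : k) (x : Sections s L T) : c • x = scalars s T c • x := rfl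

/-- Pullback of functions along a morphism of `S`-schemes. -/
def pullFunction {T T' : Over S} (g : T' ⟶ T) : Γ(T.left, ⊤) →+* Γ(T'.left, ⊤) :=
  g.left.appTop.hom

/-- Pullback of sections along a morphism of `S`-schemes. -/
def pullSection {T T' : Over S} (g : T' ⟶ T) : Sections s L T →+ Sections s L T' :=
  (Sections.map s L g).toAddMonoidHom

lemma pullFunction_id (T : Over S) (a : Γ(T.left, ⊤)) : pullFunction (𝟙 T) a = a := by
  simp [pullFunction]

lemma pullFunction_comp {T T' T'' : Over S} (g : T' ⟶ T) (h : T'' ⟶ T') (a : Γ(T.left, ⊤)) :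
    pullFunction (h ≫ g) a = pullFunction h (pullFunction g a) :=
  congr($(Scheme.Hom.comp_appTop h.left g.left) a)

lemma pullFunction_scalars {T T' : Over S} (g : T' ⟶ T) (c : k) :
    pullFunction g (scalars s T c) = scalars s T' c :=
  scalars_comp s g c

lemma pullSection_smul {T T' : Over S} (g : T' ⟶ T) (a : Γ(T.left, ⊤)) (x : Sections s L T) :
    pullSection g (a • x) = pullFunction g a • pullSection g x :=
  Scheme.Modules.Hom.app_smul (baseChangeHom L T.hom T'.hom g.left (Over.w g)) a x

lemma pullSection_id {T : Over S} (x : Sections s L T) : pullSection (𝟙 T) x = x :=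
  congr($((sectionsFunctor s L).map_id (.op T)) x)

lemma pullSection_comp {T T' T'' : Over S} (g : T' ⟶ T) (h : T'' ⟶ T') (x : Sections s L T) :
    pullSection (h ≫ g) x = pullSection h (pullSection g x) :=
  congr($((sectionsFunctor s L).map_comp g.op h.op) x)

lemma pullSection_scalar_smul {T T' : Over S} (g : T' ⟶ T) (c : k) (x : Sections s L T) :
    pullSection g (c • x) = c • pullSection g x :=
  (Sections.map s L g).map_smul c x

/-- Evaluation at `g : T' ⟶ T` of a section of `f^* L` over an open subset through which `g`
factors. -/
def evalSection {T T' : Over S} (g : T' ⟶ T) (U : T.left.Opens) (h : ⊤ ≤ g.left ⁻¹ᵁ U)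
    (t : Γ((Scheme.Modules.pullback T.hom).obj L, U)) : Sections s L T' :=
  restrictSection ((Scheme.Modules.pullback T'.hom).obj L) h
    ((baseChangeHom L T.hom T'.hom g.left (Over.w g)).app U t)

lemma evalSection_restrictSection {T T' : Over S} (g : T' ⟶ T) {U U' : T.left.Opens}
    (h : ⊤ ≤ g.left ⁻¹ᵁ U) (hU : U ≤ U') (t : Γ((Scheme.Modules.pullback T.hom).obj L, U')) :
    evalSection (s := s) g U h (restrictSection _ hU t) =
      evalSection g U' (h.trans (fun _ hx => hU hx)) t := by
  unfold evalSection
  rw [app_restrictSection]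
  exact restrictSection_restrictSection _ _ _ _

lemma evalSection_top {T T' : Over S} (g : T' ⟶ T) (t : Sections s L T) :
    evalSection g ⊤ le_rfl t = pullSection g t :=
  restrictSection_self _ _ _

lemma pullSection_evalSection {T T' T'' : Over S} (g : T' ⟶ T) (a : T'' ⟶ T') (U : T.left.Opens)
    (h : ⊤ ≤ g.left ⁻¹ᵁ U) (h' : ⊤ ≤ (a ≫ g).left ⁻¹ᵁ U)
    (t : Γ((Scheme.Modules.pullback T.hom).obj L, U)) :
    pullSection a (evalSection (s := s) g U h t) = evalSection (a ≫ g) U h' t := by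
  have baseChangeHom_comp_app := congr($(congr(Scheme.Modules.Hom.app
    $(baseChangeHom_comp L T.hom T'.hom T''.hom g.left a.left (Over.w g) (Over.w a)
      (Over.w (a ≫ g))) U)) t)
  unfold evalSection
  refine Eq.trans ?_ (congrArg (restrictSection ((Scheme.Modules.pullback T''.hom).obj L) h')
    baseChangeHom_comp_app.symm)
  exact app_restrictSection (baseChangeHom L T'.hom T''.hom a.left (Over.w a)) h _

lemma pullSection_evalSection_eq {X T T' : Over S} {g : T' ⟶ T} {a : X ⟶ T'} {w : X ⟶ T}
    (ha : a ≫ g = w) {U W : T.left.Opens} (hU : ⊤ ≤ g.left ⁻¹ᵁ U) (hW : ⊤ ≤ w.left ⁻¹ᵁ W)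
    (h : W ≤ U) (t : Γ((Scheme.Modules.pullback T.hom).obj L, U)) :
    pullSection a (evalSection (s := s) g U hU t) =
      evalSection w W hW (restrictSection _ h t) := by
  subst ha
  rw [evalSection_restrictSection, pullSection_evalSection]

lemma evalSection_bijective {T T' : Over S} (g : T' ⟶ T) [IsOpenImmersion g.left]
    (U : T.left.Opens) (h : ⊤ ≤ g.left ⁻¹ᵁ U) (hU : U ≤ g.left.opensRange) :
    Function.Bijective (evalSection (s := s) (L := L) g U h) :=
  (restrictSection_bijective _ h le_top).comp
    (baseChangeHom_app_bijective L T.hom T'.hom g.left (Over.w g) U hU)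

lemma top_le_preimage_opensRange {X Y : Scheme.{u}} (g : X ⟶ Y) [IsOpenImmersion g] :
    ⊤ ≤ g ⁻¹ᵁ g.opensRange := by simp

lemma sections_ext {T : Over S} {ι : Type*} {T' : ι → Over S} (j : ∀ i, T' i ⟶ T)
    [∀ i, IsOpenImmersion (j i).left] (hj : ∀ x : T.left, ∃ i, x ∈ (j i).left.opensRange)
    {x y : Sections s L T} (h : ∀ i, pullSection (j i) x = pullSection (j i) y) : x = y := by
  refine section_ext _ ⊤ (fun i => (j i).left.opensRange) (fun i => le_top) (fun x _ => hj x)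
    fun i => ?_
  apply (evalSection_bijective (s := s) (L := L) (j i) _ (top_le_preimage_opensRange _) le_rfl).1
  have eval_top_eq := h i
  rw [← evalSection_top, ← evalSection_top] at eval_top_eq
  exact (evalSection_restrictSection (s := s) (L := L) (j i) _ _ _).trans (eval_top_eq.trans
    (evalSection_restrictSection (s := s) (L := L) (j i) _ _ _).symm)

lemma exists_comp_eq_of_range_subset {X T T' : Over S} (j : T' ⟶ T) [IsOpenImmersion j.left]
    (w : X ⟶ T) (h : Set.range w.left ⊆ Set.range j.left) : ∃ a : X ⟶ T', a ≫ j = w := by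
  refine ⟨Over.homMk (IsOpenImmersion.lift j.left w.left h) ?_, ?_⟩
  · rw [← Over.w j, IsOpenImmersion.lift_fac_assoc, Over.w]
  · ext : 1
    exact IsOpenImmersion.lift_fac _ _ _

lemma restrictSection_eq_of_pullSection_eq {T T₁ T₂ : Over S} (j₁ : T₁ ⟶ T) (j₂ : T₂ ⟶ T)
    [IsOpenImmersion j₁.left] [IsOpenImmersion j₂.left] {U₁ U₂ W : T.left.Opens}
    (h₁ : ⊤ ≤ j₁.left ⁻¹ᵁ U₁) (h₂ : ⊤ ≤ j₂.left ⁻¹ᵁ U₂) (hW₁ : W ≤ j₁.left.opensRange)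
    (hW₂ : W ≤ j₂.left.opensRange) (hWU₁ : W ≤ U₁) (hWU₂ : W ≤ U₂)
    (t₁ : Γ((Scheme.Modules.pullback T.hom).obj L, U₁))
    (t₂ : Γ((Scheme.Modules.pullback T.hom).obj L, U₂))
    (h : ∀ (X : Over S) (a₁ : X ⟶ T₁) (a₂ : X ⟶ T₂), a₁ ≫ j₁ = a₂ ≫ j₂ →
      pullSection a₁ (evalSection (s := s) j₁ U₁ h₁ t₁) =
        pullSection a₂ (evalSection j₂ U₂ h₂ t₂)) :
    restrictSection _ hWU₁ t₁ = restrictSection _ hWU₂ t₂ := by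
  let w : Over.mk (W.ι ≫ T.hom) ⟶ T := Over.homMk W.ι
  have : IsOpenImmersion w.left := inferInstanceAs (IsOpenImmersion W.ι)
  have top_le_preimage : ⊤ ≤ w.left ⁻¹ᵁ W := by
    change ⊤ ≤ W.ι ⁻¹ᵁ W
    simp
  have le_range : W ≤ w.left.opensRange := by
    change W ≤ W.ι.opensRange
    simp
  have range_subset {Y : Over S} (j : Y ⟶ T) [IsOpenImmersion j.left]
      (hW : W ≤ j.left.opensRange) : Set.range w.left ⊆ Set.range j.left := by
    rintro _ ⟨y, rfl⟩
    exact hW y.2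
  obtain ⟨a₁, ha₁⟩ := exists_comp_eq_of_range_subset j₁ w (range_subset j₁ hW₁)
  obtain ⟨a₂, ha₂⟩ := exists_comp_eq_of_range_subset j₂ w (range_subset j₂ hW₂)
  apply (evalSection_bijective (s := s) (L := L) w W top_le_preimage le_range).1
  rw [← pullSection_evalSection_eq ha₁ h₁, ← pullSection_evalSection_eq ha₂ h₂]
  exact h _ a₁ a₂ (ha₁.trans ha₂.symm)

lemma exists_sections_glue {T : Over S} {ι : Type*} {T' : ι → Over S} (j : ∀ i, T' i ⟶ T)
    [∀ i, IsOpenImmersion (j i).left] (hj : ∀ x : T.left, ∃ i, x ∈ (j i).left.opensRange)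
    (x : ∀ i, Sections s L (T' i))
    (hx : ∀ (i i' : ι) (T'' : Over S) (a : T'' ⟶ T' i) (b : T'' ⟶ T' i'),
      a ≫ j i = b ≫ j i' → pullSection a (x i) = pullSection b (x i')) :
    ∃ y : Sections s L T, ∀ i, pullSection (j i) y = x i := by
  choose t ht using fun i => (evalSection_bijective (s := s) (L := L) (j i) _
    (top_le_preimage_opensRange _) le_rfl).2 (x i)
  obtain ⟨y, hy⟩ := exists_section_glue ((Scheme.Modules.pullback T.hom).obj L) ⊤
    (fun i => (j i).left.opensRange) (fun i => le_top) (fun x _ => hj x) t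
    fun i i' W hi hi' => restrictSection_eq_of_pullSection_eq (s := s) (j i) (j i')
      (top_le_preimage_opensRange _) (top_le_preimage_opensRange _) hi hi' hi hi' _ _
      fun T'' a b hab => by
        rw [ht, ht]
        exact hx i i' T'' a b hab
  refine ⟨y, fun i => ?_⟩
  have eval_restrict := evalSection_restrictSection (s := s) (L := L) (j i)
    (top_le_preimage_opensRange _) le_top y
  rw [hy, ht] at eval_restrict
  exact (evalSection_top (s := s) (L := L) (j i) y).symm.trans eval_restrict.symm

/-- The section of `f^* L` defined by a section of `L` over an open subset that contains the image
of `f`. -/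
def sectionOfOpen (s : S ⟶ Spec (.of k)) (T : Over S) (U : S.Opens) (h : ⊤ ≤ T.hom ⁻¹ᵁ U)
    (t : Γ(L, U)) : Sections s L T :=
  restrictSection ((Scheme.Modules.pullback T.hom).obj L) h
    (((Scheme.Modules.pullbackPushforwardAdjunction T.hom).unit.app L).app U t)

lemma sectionOfOpen_restrictSection {T : Over S} {U U' : S.Opens} (h : ⊤ ≤ T.hom ⁻¹ᵁ U)
    (hU : U ≤ U') (t : Γ(L, U')) :
    sectionOfOpen s T U h (restrictSection _ hU t) =
      sectionOfOpen s T U' (h.trans (fun _ hx => hU hx)) t := by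
  refine (congrArg (restrictSection ((Scheme.Modules.pullback T.hom).obj L) h) (app_restrictSection
    ((Scheme.Modules.pullbackPushforwardAdjunction T.hom).unit.app L) hU t)).trans ?_
  exact restrictSection_restrictSection ((Scheme.Modules.pullback T.hom).obj L) (U := T.hom ⁻¹ᵁ U')
    (V := T.hom ⁻¹ᵁ U) (W := ⊤) _ h _

lemma pullSection_sectionOfOpen {T T' : Over S} (a : T' ⟶ T) (U : S.Opens)
    (h : ⊤ ≤ T.hom ⁻¹ᵁ U) (h' : ⊤ ≤ T'.hom ⁻¹ᵁ U) (t : Γ(L, U)) :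
    pullSection a (sectionOfOpen s T U h t) = sectionOfOpen s T' U h' t := by
  have preimage_eq : a.left ⁻¹ᵁ T.hom ⁻¹ᵁ U = T'.hom ⁻¹ᵁ U := by
    rw [← Scheme.Hom.comp_preimage, Over.w]
  have baseChange_unit_app := congr($(congr(Scheme.Modules.Hom.app
    $(baseChangeHom_unit L T.hom T'.hom a.left (Over.w a)) U)) t)
  refine (app_restrictSection (baseChangeHom L T.hom T'.hom a.left (Over.w a)) h
    (((Scheme.Modules.pullbackPushforwardAdjunction T.hom).unit.app L).app U t)).trans
      ((congrArg (restrictSection ((Scheme.Modules.pullback T'.hom).obj L)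
        (U := a.left ⁻¹ᵁ T.hom ⁻¹ᵁ U) (h'.trans preimage_eq.ge)) baseChange_unit_app).trans ?_)
  exact restrictSection_restrictSection ((Scheme.Modules.pullback T'.hom).obj L)
    (U := T'.hom ⁻¹ᵁ U) (V := a.left ⁻¹ᵁ T.hom ⁻¹ᵁ U) (W := ⊤) preimage_eq.le
    (h'.trans preimage_eq.ge) _

lemma sectionOfOpen_bijective {T : Over S} [IsOpenImmersion T.hom] (U : S.Opens)
    (h : ⊤ ≤ T.hom ⁻¹ᵁ U) (hU : U ≤ T.hom.opensRange) :
    Function.Bijective (sectionOfOpen (L := L) s T U h) :=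
  (restrictSection_bijective _ h le_top).comp (pullback_unit_app_bijective T.hom L U hU)

lemma sectionOfOpen_smul {T : Over S} (U : S.Opens) (h : ⊤ ≤ T.hom ⁻¹ᵁ U) (a : Γ(S, U))
    (t : Γ(L, U)) :
    sectionOfOpen s T U h (a • t) =
      restrictFunction T.left h (T.hom.app U a) • sectionOfOpen s T U h t := by
  refine (congrArg (restrictSection ((Scheme.Modules.pullback T.hom).obj L) h)
    (Scheme.Modules.Hom.app_smul ((Scheme.Modules.pullbackPushforwardAdjunction T.hom).unit.app L)
      a t)).trans ?_
  exact restrictSection_smul ((Scheme.Modules.pullback T.hom).obj L) h (T.hom.app U a) _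

lemma sectionOfOpen_add {T : Over S} (U : S.Opens) (h : ⊤ ≤ T.hom ⁻¹ᵁ U) (t t' : Γ(L, U)) :
    sectionOfOpen s T U h (t + t') = sectionOfOpen s T U h t + sectionOfOpen s T U h t' := by
  unfold sectionOfOpen
  rw [map_add]
  exact map_add _ _ _

/-- The section `g` of `f^* L` is a basis, and remains one after every base change. -/
def IsGenerator {T : Over S} (g : Sections s L T) : Prop :=
  ∀ (T' : Over S) (h : T' ⟶ T), Function.Bijective fun a : Γ(T'.left, ⊤) => a • pullSection h g

lemma IsGenerator.map {T T' : Over S} {g : Sections s L T} (hg : IsGenerator g) (h : T' ⟶ T) :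
    IsGenerator (pullSection h g) := by
  intro T'' h'
  rw [← pullSection_comp]
  exact hg T'' (h' ≫ h)

lemma IsGenerator.bijective {T : Over S} {g : Sections s L T} (hg : IsGenerator g) :
    Function.Bijective fun a : Γ(T.left, ⊤) => a • g := by
  simpa only [pullSection_id] using hg T (𝟙 T)

lemma IsGeneratorOn.isGenerator {T : Over S} {g : Sections s L T}
    (hg : IsGeneratorOn ((Scheme.Modules.pullback T.hom).obj L) ⊤ g) : IsGenerator g :=
  fun _ h => (hg.baseChange L _ _ h.left (Over.w h)).smul_bijective

lemma nonempty_over_hom_of_range_subset {T U : Over S} [IsOpenImmersion U.hom]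
    (h : Set.range T.hom ⊆ Set.range U.hom) : Nonempty (T ⟶ U) :=
  ⟨Over.homMk (IsOpenImmersion.lift U.hom T.hom h) (IsOpenImmersion.lift_fac _ _ _)⟩

lemma IsGeneratorOn.isGenerator_sectionOfOpen {U : S.Opens} {g : Γ(L, U)}
    (hg : IsGeneratorOn L U g) (T : Over S) (h : ⊤ ≤ T.hom ⁻¹ᵁ U) :
    IsGenerator (sectionOfOpen s T U h g) := by
  have image_le : U.ι ''ᵁ ⊤ ≤ U := by simp
  have generator_over_U : IsGenerator (sectionOfOpen s (Over.mk U.ι) U (by simp) g) := by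
    apply IsGeneratorOn.isGenerator
    exact (congrArg (IsGeneratorOn ((Scheme.Modules.pullback U.ι).obj L) ⊤)
      (restrictSection_pullback_unit L U.ι image_le (by simp) g)).mpr
      ((hg.restrict U.ι image_le).map_iso
        ((Scheme.Modules.restrictFunctorIsoPullback U.ι).hom.app L))
  have : IsOpenImmersion (Over.mk U.ι).hom := inferInstanceAs (IsOpenImmersion U.ι)
  obtain ⟨p⟩ : Nonempty (T ⟶ Over.mk U.ι) := by
    refine nonempty_over_hom_of_range_subset ?_
    rintro _ ⟨x, rfl⟩
    simpa using h (show x ∈ ⊤ from trivial)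
  rw [← pullSection_sectionOfOpen p U (by simp) h g]
  exact generator_over_U.map p

end SectionsBasics

/-! ### Invertible sheaves -/

section Invertible

variable {L : S.Modules}

lemma IsInvertible.exists_isGeneratorOn (hL : IsInvertible L) (x : S) :
    ∃ (U : S.Opens) (_ : x ∈ U) (g : Γ(L, U)), IsGeneratorOn L U g := by
  obtain ⟨U, hx, ⟨e⟩⟩ := hL x
  exact ⟨U.ι ''ᵁ ⊤, by simpa using hx, _, (isGeneratorOn_of_isIso e.inv).of_restrict U.ι⟩

lemma isInvertible_of_isGeneratorOn
    (h : ∀ x : S, ∃ (U : S.Opens) (_ : x ∈ U) (g : Γ(L, U)), IsGeneratorOn L U g) :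
    IsInvertible L := by
  intro x
  obtain ⟨U, hx, g, hg⟩ := h x
  let φ := homOfSection (L.restrict U.ι) (restrictSection L (by simp : U.ι ''ᵁ ⊤ ≤ U) g)
  have : IsIso φ := (hg.restrict U.ι (by simp)).isIso
  exact ⟨U, hx, ⟨(asIso φ).symm⟩⟩

lemma IsInvertible.exists_affine_isGeneratorOn_le (hL : IsInvertible L) {V : S.Opens} {x : S}
    (hx : x ∈ V) :
    ∃ (U : S.Opens) (_ : U ≤ V) (_ : IsAffineOpen U) (_ : x ∈ U) (g : Γ(L, U)),
      IsGeneratorOn L U g := by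
  obtain ⟨V', hx', g, hg⟩ := hL.exists_isGeneratorOn x
  obtain ⟨_, ⟨U, hU, rfl⟩, hxU, hUV⟩ := S.isBasis_affineOpens.exists_subset_of_mem_open
    (show x ∈ V ⊓ V' from ⟨hx, hx'⟩) (V ⊓ V').isOpen
  exact ⟨U, fun y hy => (hUV hy).1, hU, hxU, _, hg.mono fun y hy => (hUV hy).2⟩

lemma IsInvertible.exists_affine_isGeneratorOn (hL : IsInvertible L) (x : S) :
    ∃ (U : S.Opens) (_ : IsAffineOpen U) (_ : x ∈ U) (g : Γ(L, U)), IsGeneratorOn L U g := by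
  obtain ⟨U, -, hU⟩ := hL.exists_affine_isGeneratorOn_le (V := ⊤) (x := x) trivial
  exact ⟨U, hU⟩

end Invertible

/-! ### Points of affine schemes and of line bundles -/

section AffineTests

/-- The ring homomorphism `A → Γ(T, 𝒪)` defined by an `S`-morphism `T ⟶ Spec A`. -/
def pointRingHom {A : CommRingCat.{u}} {j : Spec A ⟶ S} {T : Over S} (t : T ⟶ Over.mk j) :
    A →+* Γ(T.left, ⊤) :=
  (pullFunction t).comp (Scheme.ΓSpecIso A).inv.hom

lemma pointRingHom_comp {A : CommRingCat.{u}} {j : Spec A ⟶ S} {T T' : Over S} (t : T ⟶ Over.mk j)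
    (h : T' ⟶ T) : pointRingHom (h ≫ t) = (pullFunction h).comp (pointRingHom t) := by
  ext a
  exact pullFunction_comp t h _

lemma pointRingHom_comp_apply {A : CommRingCat.{u}} {j : Spec A ⟶ S} {T T' : Over S}
    (t : T ⟶ Over.mk j) (h : T' ⟶ T) (a : A) :
    pointRingHom (h ≫ t) a = pullFunction h (pointRingHom t a) :=
  pullFunction_comp t h _

lemma pointRingHom_id {A : CommRingCat.{u}} {j : Spec A ⟶ S} (a : A) :
    pointRingHom (𝟙 (Over.mk j)) a = (Scheme.ΓSpecIso A).inv.hom a :=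
  pullFunction_id _ _

lemma pointRingHom_id_bijective {A : CommRingCat.{u}} (j : Spec A ⟶ S) :
    Function.Bijective (pointRingHom (𝟙 (Over.mk j))) :=
  (congrArg Function.Bijective (funext pointRingHom_id)).mpr
    (ConcreteCategory.bijective_of_isIso (Scheme.ΓSpecIso A).inv)

lemma pointRingHom_injective {A : CommRingCat.{u}} {j : Spec A ⟶ S} {T : Over S}
    {t t' : T ⟶ Over.mk j} (h : pointRingHom t = pointRingHom t') : t = t' := by
  ext : 1
  refine ext_of_isAffine (Y := Spec A) ?_
  rw [← cancel_epi (Scheme.ΓSpecIso A).inv]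
  ext a
  exact congr($h a)

/-- The morphism of `S`-schemes `Spec C ⟶ Spec A` defined by a ring homomorphism. -/
def specMapOver {A C : CommRingCat.{u}} (j : Spec A ⟶ S) (φ : A ⟶ C) :
    Over.mk (Spec.map φ ≫ j) ⟶ Over.mk j :=
  Over.homMk (Spec.map φ)

lemma pointRingHom_specMapOver {A C : CommRingCat.{u}} (j : Spec A ⟶ S) (φ : A ⟶ C) (a : A) :
    pointRingHom (specMapOver j φ) a = pointRingHom (𝟙 (Over.mk (Spec.map φ ≫ j))) (φ.hom a) := by
  rw [pointRingHom_id]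
  exact congr($((Scheme.ΓSpecIso_inv_naturality φ).symm) a)

lemma pointRingHom_comp_specMapOver {A C : CommRingCat.{u}} {j : Spec A ⟶ S} {φ : A ⟶ C}
    {T : Over S} (t : T ⟶ Over.mk (Spec.map φ ≫ j)) (a : A) :
    pointRingHom (t ≫ specMapOver j φ) a = pointRingHom t (φ.hom a) := by
  rw [pointRingHom_comp_apply, pointRingHom_specMapOver, ← pointRingHom_comp_apply,
    Category.comp_id]

lemma exists_specMapOver_lift {A C : CommRingCat.{u}} {j : Spec A ⟶ S} (φ : A ⟶ C) {T : Over S}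
    (t : T ⟶ Over.mk j) (ψ : C →+* Γ(T.left, ⊤)) (h : ∀ a, ψ (φ.hom a) = pointRingHom t a) :
    ∃ t' : T ⟶ Over.mk (Spec.map φ ≫ j), t' ≫ specMapOver j φ = t ∧ pointRingHom t' = ψ := by
  let ψ' : C ⟶ Γ(T.left, ⊤) := CommRingCat.ofHom ψ
  let p : T.left ⟶ Spec C := T.left.toSpecΓ ≫ Spec.map ψ'
  have p_appTop : (Scheme.ΓSpecIso C).inv ≫ p.appTop = ψ' := by
    simp only [p, Scheme.Hom.comp_appTop]
    rw [← reassoc_of% (Scheme.ΓSpecIso_inv_naturality ψ'), Scheme.toSpecΓ_appTop]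
    simp
  have p_comp : p ≫ Spec.map φ = t.left := by
    apply ext_of_isAffine
    rw [← cancel_epi (Scheme.ΓSpecIso A).inv, Scheme.Hom.comp_appTop,
      ← reassoc_of% (Scheme.ΓSpecIso_inv_naturality φ), p_appTop]
    ext a
    exact h a
  refine ⟨Over.homMk p ?_, ?_, ?_⟩
  · exact (Category.assoc _ _ _).symm.trans ((congrArg (· ≫ j) p_comp).trans (Over.w t))
  · ext : 1
    exact p_comp
  · ext a
    exact congr($p_appTop a)

end AffineTests

section Points

open scoped AddMonObj

variable {k : Type u} [Field k] {s : S ⟶ Spec (.of k)} {L : S.Modules}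

lemma isAddMonHom_of_add {G H : Over S} [AddGrpObj G] [AddGrpObj H] (f : G ⟶ H)
    (h : ∀ (T : Over S) (a b : T ⟶ G), (a + b) ≫ f = a ≫ f + b ≫ f) : IsAddMonHom f where
  zero_hom := by
    have zero_comp := h _ (0 : 𝟙_ (Over S) ⟶ G) 0
    rw [add_zero, left_eq_add, Hom.zero_def, Hom.zero_def] at zero_comp
    simpa only [CartesianMonoidalCategory.toUnit_unique
      (CartesianMonoidalCategory.toUnit (𝟙_ (Over S))) (𝟙 _), Category.id_comp] using zero_comp
  add_hom := by
    have add_comp := h _ (CartesianMonoidalCategory.fst G G) (CartesianMonoidalCategory.snd G G)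
    rw [Hom.add_def, Hom.add_def] at add_comp
    simp only [CartesianMonoidalCategory.lift_fst_snd, Category.id_comp] at add_comp
    rw [add_comp]
    congr 1

lemma add_comp_of_isAddMonHom {G H T : Over S} [AddGrpObj G] [AddGrpObj H] (f : G ⟶ H)
    (_ : IsAddMonHom f) (a b : T ⟶ G) : (a + b) ≫ f = a ≫ f + b ≫ f :=
  (IsAddMonHom.addMonoidHom f T).map_add a b

lemma zero_comp_of_isAddMonHom {G H T : Over S} [AddGrpObj G] [AddGrpObj H] (f : G ⟶ H)
    (_ : IsAddMonHom f) : (0 : T ⟶ G) ≫ f = 0 :=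
  (IsAddMonHom.addMonoidHom f T).map_zero

lemma sub_comp_of_isAddMonHom {G H T : Over S} [AddGrpObj G] [AddGrpObj H] (f : G ⟶ H)
    (_ : IsAddMonHom f) (a b : T ⟶ G) : (a - b) ≫ f = a ≫ f - b ≫ f :=
  (IsAddMonHom.addMonoidHom f T).map_sub a b

namespace LineBundle

/-- The section of `f^* L` that corresponds to a `T`-valued point of `𝔾_{a,L}`. -/
def sectionOf (V : LineBundle s L) {T : Over S} (f : T ⟶ V.X) : Sections s L T := V.rep.homEquiv f

/-- The `T`-valued point of `𝔾_{a,L}` that corresponds to a section of `f^* L`. -/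
def pointOf (V : LineBundle s L) {T : Over S} (x : Sections s L T) : T ⟶ V.X :=
  V.rep.homEquiv.symm x

@[simp] lemma sectionOf_pointOf (V : LineBundle s L) {T : Over S} (x : Sections s L T) :
    V.sectionOf (V.pointOf x) = x := V.rep.homEquiv.apply_symm_apply x

lemma sectionOf_injective (V : LineBundle s L) {T : Over S} {f g : T ⟶ V.X}
    (h : V.sectionOf f = V.sectionOf g) : f = g :=
  V.rep.homEquiv.injective h

lemma sectionOf_comp (V : LineBundle s L) {T T' : Over S} (h : T' ⟶ T) (f : T ⟶ V.X) :
    V.sectionOf (h ≫ f) = pullSection h (V.sectionOf f) :=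
  V.rep.homEquiv_comp h f

lemma comp_pointOf (V : LineBundle s L) {T T' : Over S} (h : T' ⟶ T) (x : Sections s L T) :
    h ≫ V.pointOf x = V.pointOf (pullSection h x) := by
  apply V.sectionOf_injective
  rw [sectionOf_comp, sectionOf_pointOf, sectionOf_pointOf]

lemma sectionOf_add (V : LineBundle s L) {T : Over S} (f g : T ⟶ V.X) :
    V.sectionOf (f + g) = V.sectionOf f + V.sectionOf g := by
  rw [Hom.add_def, sectionOf_comp]
  have sectionOf_addition : V.sectionOf (AddMonObj.add (X := V.X)) =
      V.sectionOf (CartesianMonoidalCategory.fst V.X V.X) +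
        V.sectionOf (CartesianMonoidalCategory.snd V.X V.X) :=
    V.rep.homEquiv.apply_symm_apply _
  rw [sectionOf_addition, map_add, ← sectionOf_comp, ← sectionOf_comp,
    CartesianMonoidalCategory.lift_fst, CartesianMonoidalCategory.lift_snd]

lemma sectionOf_zero (V : LineBundle s L) {T : Over S} : V.sectionOf (0 : T ⟶ V.X) = 0 := by
  simpa only [add_zero, left_eq_add] using V.sectionOf_add (0 : T ⟶ V.X) 0

lemma sectionOf_smul (V : LineBundle s L) {T : Over S} (c : k) (f : T ⟶ V.X) :
    V.sectionOf (f ≫ V.smul c) = c • V.sectionOf f := by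
  have sectionOf_action : V.sectionOf (V.smul c) = c • V.sectionOf (𝟙 V.X) :=
    V.rep.homEquiv.apply_symm_apply _
  rw [sectionOf_comp, sectionOf_action, pullSection_scalar_smul, ← sectionOf_comp, Category.comp_id]

lemma isAddMonHom_smul (V : LineBundle s L) (c : k) : IsAddMonHom (V.smul c) :=
  isAddMonHom_of_add _ fun T a b => V.sectionOf_injective <| by
    rw [sectionOf_smul, sectionOf_add, sectionOf_add, sectionOf_smul, sectionOf_smul, smul_add]

end LineBundle

end Points

section AffineLine

variable {k : Type u} [Field k] {s : S ⟶ Spec (.of k)} {L : S.Modules}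

/-- The affine line over `Spec A`, as an `S`-scheme. -/
abbrev affineLine {A : CommRingCat.{u}} (j : Spec A ⟶ S) : Over S :=
  Over.mk (Spec.map (CommRingCat.ofHom (Polynomial.C : A →+* Polynomial A)) ≫ j)

/-- The projection from the affine line over `Spec A` to `Spec A`. -/
abbrev affineLineProj {A : CommRingCat.{u}} (j : Spec A ⟶ S) : affineLine j ⟶ Over.mk j :=
  specMapOver j (CommRingCat.ofHom (Polynomial.C : A →+* Polynomial A))

/-- The coordinate of the affine line. -/
def affineLineCoord {A : CommRingCat.{u}} (j : Spec A ⟶ S) : Γ((affineLine j).left, ⊤) :=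
  pointRingHom (𝟙 (affineLine j)) (Polynomial.X : Polynomial A)

lemma pointRingHom_affineLine {A : CommRingCat.{u}} {j : Spec A ⟶ S} {T : Over S}
    (h : T ⟶ affineLine j) (p : Polynomial A) :
    pointRingHom h p =
      p.eval₂ (pointRingHom (h ≫ affineLineProj j)) (pullFunction h (affineLineCoord j)) := by
  have ringHom_eq : pointRingHom h = Polynomial.eval₂RingHom (pointRingHom (h ≫ affineLineProj j))
      (pullFunction h (affineLineCoord j)) := by
    apply Polynomial.ringHom_ext
    · intro a
      rw [Polynomial.coe_eval₂RingHom, Polynomial.eval₂_C, pointRingHom_comp_specMapOver]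
      rfl
    · rw [Polynomial.coe_eval₂RingHom, Polynomial.eval₂_X, affineLineCoord,
        ← pointRingHom_comp_apply, Category.comp_id]
  exact congr($ringHom_eq p)

lemma affineLine_ext {A : CommRingCat.{u}} {j : Spec A ⟶ S} {T : Over S} {h h' : T ⟶ affineLine j}
    (proj_eq : h ≫ affineLineProj j = h' ≫ affineLineProj j)
    (coord_eq : pullFunction h (affineLineCoord j) = pullFunction h' (affineLineCoord j)) :
    h = h' := by
  refine pointRingHom_injective (RingHom.ext fun (p : Polynomial A) => ?_)
  exact (pointRingHom_affineLine h p).trans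
    (by rw [proj_eq, coord_eq, ← pointRingHom_affineLine])

lemma exists_affineLine_hom {A : CommRingCat.{u}} {j : Spec A ⟶ S} {T : Over S} (t : T ⟶ Over.mk j)
    (a : Γ(T.left, ⊤)) :
    ∃ h : T ⟶ affineLine j, h ≫ affineLineProj j = t ∧ pullFunction h (affineLineCoord j) = a := by
  obtain ⟨h, h_proj, h_ringHom⟩ := exists_specMapOver_lift
    (CommRingCat.ofHom (Polynomial.C : A →+* Polynomial A)) t
    (Polynomial.eval₂RingHom (pointRingHom t) a) (fun b => Polynomial.eval₂_C (pointRingHom t) a)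
  refine ⟨h, h_proj, ?_⟩
  rw [affineLineCoord, ← pointRingHom_comp_apply, Category.comp_id, h_ringHom]
  exact Polynomial.eval₂_X _ _

/-- The tautological section of `L` over the affine line defined by a generator of `L`. -/
def tautologicalSection {A : CommRingCat.{u}} {j : Spec A ⟶ S} (g : Sections s L (Over.mk j)) :
    Sections s L (affineLine j) :=
  affineLineCoord j • pullSection (affineLineProj j) g

lemma pullSection_tautologicalSection {A : CommRingCat.{u}} {j : Spec A ⟶ S}
    (g : Sections s L (Over.mk j)) {T : Over S} (h : T ⟶ affineLine j) :
    pullSection h (tautologicalSection g) =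
      pullFunction h (affineLineCoord j) • pullSection (h ≫ affineLineProj j) g := by
  rw [tautologicalSection, pullSection_smul, pullSection_comp]

lemma affineLine_hom_ext {A : CommRingCat.{u}} {j : Spec A ⟶ S} {g : Sections s L (Over.mk j)}
    (hg : IsGenerator g) {T : Over S} {h h' : T ⟶ affineLine j}
    (proj_eq : h ≫ affineLineProj j = h' ≫ affineLineProj j)
    (section_eq : pullSection h (tautologicalSection g) = pullSection h' (tautologicalSection g)) :
    h = h' := by
  rw [pullSection_tautologicalSection, pullSection_tautologicalSection, proj_eq] at section_eq
  exact affineLine_ext proj_eq ((hg _ _).1 section_eq)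

lemma exists_affineLine_lift {A : CommRingCat.{u}} {j : Spec A ⟶ S} {g : Sections s L (Over.mk j)}
    (hg : IsGenerator g) {T : Over S} (t : T ⟶ Over.mk j) (x : Sections s L T) :
    ∃ h : T ⟶ affineLine j,
      h ≫ affineLineProj j = t ∧ pullSection h (tautologicalSection g) = x := by
  obtain ⟨a, rfl⟩ := (hg T t).2 x
  obtain ⟨h, h_proj, h_coord⟩ := exists_affineLine_hom t a
  exact ⟨h, h_proj, by rw [pullSection_tautologicalSection, h_proj, h_coord]⟩

end AffineLine

/-! ### Representability of the sections -/

section Representability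

variable {k : Type u} [Field k] {s : S ⟶ Spec (.of k)} {L : S.Modules}

/-- Pairs of a morphism `f : T ⟶ S` and a section of `f^* L`. -/
structure TotalSections (s : S ⟶ Spec (.of k)) (L : S.Modules) (T : Scheme.{u}) : Type u where
  fst : T ⟶ S
  snd : Sections s L (Over.mk fst)

namespace TotalSections

/-- A section over an `S`-scheme, together with the structure morphism of that scheme. -/
def of {T : Over S} (x : Sections s L T) : TotalSections s L T.left := ⟨T.hom, x⟩

lemma of_injective {T : Over S} : Function.Injective (of : Sections s L T → _) :=
  fun _ _ h => eq_of_heq (mk.inj h).2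

/-- Pullback of pairs. -/
def comap {T T' : Scheme.{u}} (g : T' ⟶ T) (a : TotalSections s L T) : TotalSections s L T' :=
  ⟨g ≫ a.fst, pullSection (Over.homMk g : Over.mk (g ≫ a.fst) ⟶ Over.mk a.fst) a.snd⟩

lemma comap_of {T T' : Over S} (g : T' ⟶ T) (x : Sections s L T) :
    (of x).comap g.left = of (pullSection g x) := by
  have comap_eq (f' : T'.left ⟶ S) (w : g.left ≫ T.hom = f') :
      (of x).comap g.left = ⟨f', pullSection (Over.homMk g.left w : Over.mk f' ⟶ T) x⟩ := by
    subst w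
    rfl
  exact comap_eq T'.hom (Over.w g)

lemma comap_of_eq_of_iff {T T' : Over S} (g : T'.left ⟶ T.left) (x : Sections s L T)
    (x' : Sections s L T') :
    (of x).comap g = of x' ↔ ∃ φ : T' ⟶ T, φ.left = g ∧ pullSection φ x = x' := by
  constructor
  · intro h
    let φ : T' ⟶ T := Over.homMk g congr($(h).fst)
    exact ⟨φ, rfl, of_injective ((comap_of φ x).symm.trans h)⟩
  · rintro ⟨φ, rfl, rfl⟩
    exact comap_of φ x

lemma comap_id {T : Scheme.{u}} (a : TotalSections s L T) : a.comap (𝟙 T) = a :=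
  (comap_of (𝟙 (Over.mk a.fst)) a.snd).trans (congrArg of (pullSection_id a.snd))

lemma comap_comap {T T' T'' : Scheme.{u}} (g : T' ⟶ T) (h : T'' ⟶ T') (a : TotalSections s L T) :
    (a.comap g).comap h = a.comap (h ≫ g) := by
  let g' : Over.mk (g ≫ a.fst) ⟶ Over.mk a.fst := Over.homMk g
  let h' : Over.mk (h ≫ g ≫ a.fst) ⟶ Over.mk (g ≫ a.fst) := Over.homMk h
  exact (congrArg of (pullSection_comp g' h' a.snd)).symm.trans (comap_of (h' ≫ g') a.snd).symm

end TotalSections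

open TotalSections

/-- The functor of pairs of a morphism `f : T ⟶ S` and a section of `f^* L`. -/
def totalSectionsFunctor (s : S ⟶ Spec (.of k)) (L : S.Modules) : Scheme.{u}ᵒᵖ ⥤ Type u where
  obj T := TotalSections s L T.unop
  map g := ↾(comap g.unop)
  map_id T := by
    ext a
    exact a.comap_id
  map_comp g h := by
    ext a
    exact (a.comap_comap g.unop h.unop).symm

lemma totalSections_ext {Y : Scheme.{u}} (𝓤 : Y.OpenCover) {a b : TotalSections s L Y}
    (h : ∀ i, a.comap (𝓤.f i) = b.comap (𝓤.f i)) : a = b := by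
  obtain ⟨f, x⟩ := a
  obtain ⟨f', y⟩ := b
  obtain rfl : f = f' := 𝓤.hom_ext _ _ fun i => congr($(h i).fst)
  let j (i : 𝓤.I₀) : Over.mk (𝓤.f i ≫ f) ⟶ Over.mk f := Over.homMk (𝓤.f i)
  have (i : 𝓤.I₀) : IsOpenImmersion (j i).left := inferInstanceAs (IsOpenImmersion (𝓤.f i))
  obtain rfl : x = y :=
    sections_ext j (fun y => ⟨𝓤.idx y, 𝓤.covers y⟩) fun i => of_injective <|
      (comap_of (j i) x).symm.trans ((h i).trans (comap_of (j i) y))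
  rfl

lemma exists_totalSections_glue {Y : Scheme.{u}} (𝓤 : Y.OpenCover)
    (a : ∀ i, TotalSections s L (𝓤.X i))
    (h : ∀ i j (Z : Scheme.{u}) (p : Z ⟶ 𝓤.X i) (q : Z ⟶ 𝓤.X j), p ≫ 𝓤.f i = q ≫ 𝓤.f j →
      (a i).comap p = (a j).comap q) :
    ∃ b : TotalSections s L Y, ∀ i, b.comap (𝓤.f i) = a i := by
  let f : Y ⟶ S := 𝓤.glueMorphisms (fun i => (a i).fst) fun i j =>
    congr($(h i j _ _ _ pullback.condition).fst)
  have f_restrict (i : 𝓤.I₀) : 𝓤.f i ≫ f = (a i).fst := 𝓤.ι_glueMorphisms _ _ i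
  let j (i : 𝓤.I₀) : Over.mk (a i).fst ⟶ Over.mk f := Over.homMk (𝓤.f i) (f_restrict i)
  have (i : 𝓤.I₀) : IsOpenImmersion (j i).left := inferInstanceAs (IsOpenImmersion (𝓤.f i))
  have compatible (i i' : 𝓤.I₀) (T : Over S) (p : T ⟶ Over.mk (a i).fst)
      (q : T ⟶ Over.mk (a i').fst) (w : p ≫ j i = q ≫ j i') :
      pullSection p (a i).snd = pullSection q (a i').snd :=
    of_injective <| (comap_of p _).symm.trans <|
      (h i i' T.left p.left q.left congr($(w).left)).trans (comap_of q _)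
  obtain ⟨x, hx⟩ := exists_sections_glue j (fun y => ⟨𝓤.idx y, 𝓤.covers y⟩)
    (fun i => (a i).snd) compatible
  exact ⟨of x, fun i => (comap_of (j i) x).trans (congrArg of (hx i))⟩

lemma isSheaf_totalSectionsFunctor :
    Presieve.IsSheaf Scheme.zariskiTopology (totalSectionsFunctor s L) := by
  rw [Scheme.zariskiTopology, Scheme.grothendieckTopology,
    Precoverage.isSheaf_toGrothendieck_iff_of_isStableUnderBaseChange]
  rintro Y R hR x compatible
  obtain ⟨(𝓤 : Scheme.OpenCover Y), rfl⟩ := Scheme.exists_cover_of_mem_pretopology hR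
  let a (i : 𝓤.I₀) : TotalSections s L (𝓤.X i) := x (𝓤.f i) (.mk i)
  obtain ⟨b, hb⟩ := exists_totalSections_glue 𝓤 a fun _ _ _ _ _ w => compatible _ _ _ _ w
  refine ⟨b, ?_, fun b' hb' => ?_⟩
  · rintro _ _ ⟨i⟩
    exact hb i
  · exact totalSections_ext 𝓤 fun i => (hb' _ (.mk i)).trans (hb i).symm

/-- The morphism from the affine line to the functor of pairs defined by the tautological
section. -/
def tautologicalMap {A : CommRingCat.{u}} {j : Spec A ⟶ S} (g : Sections s L (Over.mk j)) :
    yoneda.obj (affineLine j).left ⟶ totalSectionsFunctor s L :=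
  yonedaEquiv.symm (of (tautologicalSection g))

lemma totalSections_map_app {T Z : Scheme.{u}} (a : yoneda.obj T ⟶ totalSectionsFunctor s L)
    (q : Z ⟶ T) :
    a.app (.op Z) q = comap q (yonedaEquiv a : TotalSections s L T) :=
  (congrArg (fun p => a.app (.op Z) p) (Category.comp_id q).symm).trans
    (ConcreteCategory.congr_hom (a.naturality q.op) (𝟙 T))

lemma exists_lift_of_comap_tautologicalSection_eq {A : CommRingCat.{u}} {j : Spec A ⟶ S}
    {g : Sections s L (Over.mk j)} (hg : IsGenerator g) {T P : Over S} {x : Sections s L T}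
    {π : P ⟶ T} {h : P ⟶ affineLine j}
    (hP : IsPullback π.left (h ≫ affineLineProj j).left T.hom j)
    (hx : pullSection h (tautologicalSection g) = pullSection π x) {Z : Scheme.{u}}
    {p : Z ⟶ (affineLine j).left} {q : Z ⟶ T.left}
    (hpq : (of (tautologicalSection g)).comap p = (of x).comap q) :
    ∃ r : Z ⟶ P.left, r ≫ h.left = p ∧ r ≫ π.left = q := by
  let q' : Over.mk (q ≫ T.hom) ⟶ T := Over.homMk q
  obtain ⟨p', rfl, hp'⟩ :=
    (comap_of_eq_of_iff (T' := Over.mk (q ≫ T.hom)) p _ _).mp (hpq.trans (comap_of q' x))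
  let r : Z ⟶ P.left := hP.lift q (p' ≫ affineLineProj j).left (Over.w (p' ≫ _)).symm
  have r_comp_π : r ≫ π.left = q := hP.lift_fst _ _ _
  let r' : Over.mk (q ≫ T.hom) ⟶ P := Over.homMk r (by
    rw [← Over.w π, reassoc_of% r_comp_π]
    rfl)
  have r'_comp_π : r' ≫ π = q' := by
    ext : 1
    exact r_comp_π
  have r'_comp_h : r' ≫ h = p' := by
    refine affineLine_hom_ext hg ?_ ?_
    · ext : 1
      exact (Category.assoc _ _ _).trans (hP.lift_snd _ _ _)
    · rw [pullSection_comp, hx, ← pullSection_comp, r'_comp_π, hp']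
  exact ⟨r, congr($(r'_comp_h).left), r_comp_π⟩

-- The fibre product of `T` and the affine line over the functor of pairs is the open subscheme of
-- `T` on which `T ⟶ S` factors through `Spec A`: there the section is a unique multiple of `g`.
lemma isOpenImmersion_presheaf_tautologicalMap {A : CommRingCat.{u}} (j : Spec A ⟶ S)
    [IsOpenImmersion j] {g : Sections s L (Over.mk j)} (hg : IsGenerator g) :
    IsOpenImmersion.presheaf (tautologicalMap g) := by
  refine MorphismProperty.relative.of_exists fun T a => ?_
  let b : TotalSections s L T := yonedaEquiv a
  let π : Over.mk (pullback.fst b.fst j ≫ b.fst) ⟶ Over.mk b.fst :=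
    Over.homMk (pullback.fst b.fst j)
  let t : Over.mk (pullback.fst b.fst j ≫ b.fst) ⟶ Over.mk j :=
    Over.homMk (pullback.snd b.fst j) pullback.condition.symm
  obtain ⟨h, h_proj, h_section⟩ := exists_affineLine_lift hg t (pullSection π b.snd)
  have isPullback : IsPullback π.left (h ≫ affineLineProj j).left b.fst j :=
    h_proj ▸ IsPullback.of_hasPullback b.fst j
  have comap_eq : (of (tautologicalSection g)).comap h.left = b.comap π.left :=
    (comap_of h _).trans ((congrArg of h_section).trans (comap_of π b.snd).symm)
  refine ⟨_, yoneda.map h.left, π.left, ?_, inferInstanceAs (IsOpenImmersion (pullback.fst _ _))⟩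
  refine IsPullback.of_forall_isPullback_app fun Z =>
    (Types.isPullback_iff _ _ _ _).mpr ⟨?_, ?_, ?_⟩
  · ext r
    have comap_comp_eq := congrArg (comap r) comap_eq
    rw [comap_comap, comap_comap] at comap_comp_eq
    exact comap_comp_eq.trans (totalSections_map_app _ _).symm
  · rintro r r' ⟨-, h⟩
    exact (cancel_mono (pullback.fst b.fst j)).mp h
  · intro p q hpq
    exact exists_lift_of_comap_tautologicalSection_eq hg isPullback h_section
      (hpq.trans (totalSections_map_app _ _))

/-- A scheme that represents the functor of pairs is a line bundle. -/
def LineBundle.ofTotal {X : Scheme.{u}} (R : (totalSectionsFunctor s L).RepresentableBy X) :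
    LineBundle s L :=
  let τ : TotalSections s L X := R.homEquiv (𝟙 X)
  have homEquiv_eq {Z : Scheme.{u}} (f : Z ⟶ X) : R.homEquiv f = τ.comap f := R.homEquiv_eq f
  { X := Over.mk τ.fst
    rep :=
      { homEquiv := fun {T} => Equiv.ofBijective
          (fun φ : T ⟶ Over.mk τ.fst => (pullSection φ τ.snd : Sections s L T)) (by
          constructor
          · intro φ φ' h
            ext : 1
            apply R.homEquiv.injective
            rw [homEquiv_eq, homEquiv_eq]
            exact (comap_of φ τ.snd).trans ((congrArg of h).trans (comap_of φ' τ.snd).symm)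
          · intro x
            obtain ⟨φ, hφ⟩ := R.homEquiv.surjective (of x)
            obtain ⟨φ', -, hφ'⟩ :=
              (comap_of_eq_of_iff (T := Over.mk τ.fst) φ τ.snd x).mp ((homEquiv_eq φ).symm.trans hφ)
            exact ⟨φ', hφ'⟩)
        homEquiv_comp := fun f g => pullSection_comp g f τ.snd } }

lemma isLocallySurjective_sigmaDesc_tautologicalMap {ι : Type u} {A : ι → CommRingCat.{u}}
    (j : ∀ i, Spec (A i) ⟶ S) [∀ i, IsOpenImmersion (j i)] (hj : ∀ x : S, ∃ i, x ∈ (j i).opensRange)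
    {g : ∀ i, Sections s L (Over.mk (j i))} (hg : ∀ i, IsGenerator (g i)) :
    Presheaf.IsLocallySurjective Scheme.zariskiTopology
      (Sigma.desc fun i => tautologicalMap (g i)) := by
  refine ⟨fun {T} (a : TotalSections s L T) => ?_⟩
  rw [Scheme.mem_grothendieckTopology_iff]
  have isOpenCover : TopologicalSpace.IsOpenCover fun i => a.fst ⁻¹ᵁ (j i).opensRange := by
    rw [TopologicalSpace.IsOpenCover, eq_top_iff]
    intro y _
    exact TopologicalSpace.Opens.mem_iSup.mpr (hj (a.fst y))
  refine ⟨T.openCoverOfIsOpenCover _ isOpenCover, ?_⟩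
  rintro _ _ ⟨i : ι⟩
  let U : T.Opens := a.fst ⁻¹ᵁ (j i).opensRange
  have range_subset : Set.range (U.ι ≫ a.fst) ⊆ Set.range (j i) := by
    rintro _ ⟨z, rfl⟩
    exact z.2
  have : IsOpenImmersion (Over.mk (j i)).hom := inferInstanceAs (IsOpenImmersion (j i))
  obtain ⟨t⟩ : Nonempty (Over.mk (U.ι ≫ a.fst) ⟶ Over.mk (j i)) :=
    nonempty_over_hom_of_range_subset range_subset
  let incl : Over.mk (U.ι ≫ a.fst) ⟶ Over.mk a.fst := Over.homMk U.ι
  obtain ⟨h, -, h_section⟩ := exists_affineLine_lift (hg i) t (pullSection incl a.snd)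
  refine ⟨(Sigma.ι (fun i => yoneda.obj (affineLine (j i)).left) i).app (.op U.toScheme) h.left, ?_⟩
  have desc_app := congr($(congr(NatTrans.app
    $(Sigma.ι_desc (fun i => tautologicalMap (g i)) i) (.op U.toScheme))) h.left)
  exact desc_app.trans ((comap_of h _).trans ((congrArg of h_section).trans (comap_of incl _).symm))

lemma nonempty_lineBundle (hL : IsInvertible L) : Nonempty (LineBundle s L) := by
  choose U hU mem_U g hg using hL.exists_affine_isGeneratorOn
  let generator (x : S) : Sections s L (Over.mk (hU x).fromSpec) :=
    sectionOfOpen s (Over.mk (hU x).fromSpec) (U x) (by simp) (g x)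
  have isGenerator (x : S) : IsGenerator (generator x) := (hg x).isGenerator_sectionOfOpen _ _
  let F : Sheaf Scheme.zariskiTopology.{u} (Type u) := ⟨totalSectionsFunctor s L,
    (isSheaf_iff_isSheaf_of_type _ _).mpr isSheaf_totalSectionsFunctor⟩
  let chart (x : S) : yoneda.obj (affineLine (hU x).fromSpec).left ⟶ F.1 :=
    tautologicalMap (generator x)
  have isOpenImmersion_chart (x : S) : IsOpenImmersion.presheaf (chart x) :=
    isOpenImmersion_presheaf_tautologicalMap (hU x).fromSpec (isGenerator x)
  have : Presheaf.IsLocallySurjective Scheme.zariskiTopology (Sigma.desc chart) :=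
    isLocallySurjective_sigmaDesc_tautologicalMap _
      (fun x => ⟨x, by simpa using mem_U x⟩) isGenerator
  exact ⟨LineBundle.ofTotal (Scheme.LocalRepresentability.representableBy isOpenImmersion_chart)⟩

end Representability
/-! ### Monic polynomials and monogenic algebras -/

section Monogenic

open Polynomial

lemma aeval_apply_mem_of_monic {R M : Type*} [CommRing R] [AddCommGroup M] [Module R M]
    {f : Module.End R M} {v : M} {Q : R[X]} (hQ : Q.Monic) (hf : aeval f Q = 0)
    (N : Submodule R M) (hN : ∀ i < Q.natDegree, (f ^ i) v ∈ N) (p : R[X]) : aeval f p v ∈ N := by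
  cases subsingleton_or_nontrivial R
  · rw [Subsingleton.elim p 0, map_zero, LinearMap.zero_apply]
    exact N.zero_mem
  rw [← aeval_modByMonic_eq_self_of_root hf, aeval_eq_sum_range' (n := Q.natDegree + 1)
    ((natDegree_modByMonic_le p hQ).trans_lt (Nat.lt_succ_self _)), LinearMap.sum_apply]
  refine sum_mem fun i _ => ?_
  rcases lt_or_ge i Q.natDegree with hi | hi
  · exact N.smul_mem _ (hN i hi)
  · have coeff_eq_zero : (p %ₘ Q).coeff i = 0 := coeff_eq_zero_of_degree_lt
      ((degree_modByMonic_lt p hQ).trans_le (degree_le_of_natDegree_le hi))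
    simp [coeff_eq_zero]

section Localization

variable {A B : Type*} [CommRing A] [CommRing B] [Algebra A B]

lemma localizedModule_map_mulLeft_pow_mk (N : Submonoid A) (x b : B) (t : N) (n : ℕ) :
    ((LocalizedModule.map N (LinearMap.mulLeft A x) :
      Module.End (Localization N) (LocalizedModule N B)) ^ n) (LocalizedModule.mk b t) =
      LocalizedModule.mk (x ^ n * b) t := by
  induction n with
  | zero => simp
  | succ n ih =>
    rw [pow_succ', Module.End.mul_apply, ih]
    refine (LocalizedModule.map_mk _ _ _ _).trans ?_
    simp [pow_succ', mul_assoc]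

lemma aeval_localizedModule_map_mulLeft_mk (N : Submonoid A) (x b : B) (t : N) (p : A[X]) :
    aeval (LocalizedModule.map N (LinearMap.mulLeft A x) :
      Module.End (Localization N) (LocalizedModule N B)) p (LocalizedModule.mk b t) =
      LocalizedModule.mk (aeval x p * b) t := by
  induction p using Polynomial.induction_on' with
  | add p q hp hq =>
    rw [map_add, LinearMap.add_apply, hp, hq, map_add, add_mul, LocalizedModule.mk_add_mk,
      ← smul_add, LocalizedModule.mk_cancel_common_left]
  | monomial n a =>
    rw [aeval_monomial, aeval_monomial, ← Algebra.smul_def, ← Algebra.smul_def,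
      LinearMap.smul_apply, localizedModule_map_mulLeft_pow_mk, smul_mul_assoc,
      LocalizedModule.smul'_mk]

end Localization

attribute [local instance] Module.free_of_flat_of_isLocalRing

-- After localizing at a maximal ideal, Cayley–Hamilton makes `x` a root of a monic polynomial of
-- degree `r`, so that division with remainder leaves only the powers below `r`.
lemma linearCombination_pow_surjective {A B : Type*} [CommRing A] [CommRing B] [Algebra A B]
    [Module.Finite A B] [Module.Flat A B] {x : B}
    (hx : Function.Surjective (aeval x : A[X] →ₐ[A] B)) {r : ℕ}
    (hr : ∀ p, Module.rankAtStalk (R := A) B p = r) :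
    Function.Surjective (Fintype.linearCombination A fun i : Fin r => x ^ (i : ℕ)) := by
  refine surjective_of_localized_maximal _ fun m hm => ?_
  let powers := LocalizedModule.map m.primeCompl
    (Fintype.linearCombination A fun i : Fin r => x ^ (i : ℕ))
  let mulX : Module.End (Localization m.primeCompl) (LocalizedModule m.primeCompl B) :=
    LocalizedModule.map m.primeCompl (LinearMap.mulLeft A x)
  have natDegree_charpoly : mulX.charpoly.natDegree = r :=
    mulX.charpoly_natDegree.trans (hr ⟨m, inferInstance⟩)
  have pow_mem_range (t : m.primeCompl) (i : ℕ) (hi : i < mulX.charpoly.natDegree) :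
      (mulX ^ i) (LocalizedModule.mk 1 t) ∈ LinearMap.range powers := by
    rw [natDegree_charpoly] at hi
    refine ⟨LocalizedModule.mk (Pi.single ⟨i, hi⟩ 1) t, ?_⟩
    rw [LocalizedModule.map_mk, Fintype.linearCombination_apply_single, one_smul,
      localizedModule_map_mulLeft_pow_mk, mul_one]
  intro y
  induction y using LocalizedModule.induction_on with
  | h b t =>
    obtain ⟨p, rfl⟩ := hx b
    have aeval_mem_range := aeval_apply_mem_of_monic mulX.charpoly_monic
      mulX.aeval_self_charpoly _ (pow_mem_range t) (p.map (algebraMap A _))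
    rwa [aeval_map_algebraMap, aeval_localizedModule_map_mulLeft_mk, mul_one] at aeval_mem_range

lemma exists_monic_natDegree_eq_of_linearCombination_pow {A B : Type*} [CommRing A] [Nontrivial A]
    [CommRing B] [Algebra A B] {x : B} {r : ℕ}
    (hx : x ^ r ∈ LinearMap.range (Fintype.linearCombination A fun i : Fin r => x ^ (i : ℕ))) :
    ∃ P : A[X], P.Monic ∧ P.natDegree = r ∧ aeval x P = 0 := by
  obtain ⟨c, hc⟩ := hx
  let q : A[X] := ∑ i : Fin r, C (c i) * X ^ (i : ℕ)
  have degree_q_lt : q.degree < r := by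
    refine (degree_lt_iff_coeff_zero _ _).mpr fun n hn => ?_
    simp only [q, finsetSum_coeff, coeff_C_mul, coeff_X_pow]
    exact Finset.sum_eq_zero fun i _ => by rw [if_neg (by omega), mul_zero]
  refine ⟨X ^ r - q, monic_X_pow_sub (by simpa using degree_q_lt),
    natDegree_eq_of_degree_eq_some ?_, ?_⟩
  · rw [degree_sub_eq_left_of_degree_lt] <;> simp [degree_q_lt]
  · rw [map_sub, aeval_X_pow, ← hc]
    simp [q, Fintype.linearCombination_apply, Algebra.smul_def]

lemma exists_monic_aeval_eq_zero_iff {A B : Type u} [CommRing A] [CommRing B] [Algebra A B]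
    [Module.Finite A B] [Module.Flat A B] (x : B)
    (hx : Function.Surjective (aeval x : A[X] →ₐ[A] B)) (r : ℕ)
    (hr : ∀ p, Module.rankAtStalk (R := A) B p = r) :
    ∃ P : A[X], P.Monic ∧ (Nontrivial A → P.natDegree = r) ∧ ∀ p, aeval x p = 0 ↔ P ∣ p := by
  cases subsingleton_or_nontrivial A
  · exact ⟨1, monic_one, fun h => (not_nontrivial A h).elim, fun p => by
      simp [Subsingleton.elim p 0]⟩
  obtain ⟨P, monic, natDegree_eq, aeval_eq_zero⟩ :=
    exists_monic_natDegree_eq_of_linearCombination_pow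
      (linearCombination_pow_surjective hx hr (x ^ r))
  have := monic.free_adjoinRoot
  have := monic.finite_adjoinRoot
  let φ : AdjoinRoot P →ₐ[A] B := AdjoinRoot.liftAlgHom _ (Algebra.ofId A B) x aeval_eq_zero
  have φ_mk (p : A[X]) : φ (AdjoinRoot.mk _ p) = aeval x p := rfl
  have φ_bijective : Function.Bijective φ.toLinearMap :=
    Module.bijective_of_surjective_of_rankAtStalk_eq
      (fun b => by
        obtain ⟨p, rfl⟩ := hx b
        exact ⟨AdjoinRoot.mk _ p, φ_mk p⟩)
      (fun m _ => by
        rw [hr, Module.rankAtStalk_eq_finrank_of_free]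
        exact (finrank_quotient_span_eq_natDegree' monic).trans natDegree_eq)
  refine ⟨P, monic, fun _ => natDegree_eq, fun p => ?_⟩
  rw [← φ_mk, ← AdjoinRoot.mk_eq_zero, ← map_eq_zero_iff φ φ_bijective.1]

lemma eq_zero_of_monic_dvd {A : Type*} [CommRing A] {P Q : A[X]} (hP : P.Monic) (h : P ∣ Q)
    (hd : ∀ n, P.natDegree ≤ n → Q.coeff n = 0) : Q = 0 := by
  nontriviality A
  by_contra h0
  refine hP.not_dvd_of_degree_lt h0 ?_ h
  rw [degree_eq_natDegree hP.ne_zero]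
  exact (degree_lt_iff_coeff_zero _ _).mpr hd

lemma map_hasseDeriv {A B : Type*} [CommRing A] [CommRing B] (φ : A →+* B) (P : A[X]) (i : ℕ) :
    (hasseDeriv i P).map φ = hasseDeriv i (P.map φ) := by
  ext n
  simp [hasseDeriv_coeff]

-- In the universal case the translate of `P` by its own root is monic of the same degree and
-- divisible by `P`, hence equal to `P`.
lemma taylor_root_eq_self {A : Type u} [CommRing A] {P : A[X]} (hP : P.Monic)
    (h : ∀ (R : Type u) [CommRing R] (φ : A →+* R) (a b : R), P.eval₂ φ a = 0 →
      P.eval₂ φ b = 0 → P.eval₂ φ (a + b) = 0) :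
    taylor (AdjoinRoot.root P) (P.map (AdjoinRoot.of P)) = P.map (AdjoinRoot.of P) := by
  set Q := P.map (AdjoinRoot.of P) with Q_def
  have monic_Q : Q.Monic := hP.map _
  have monic_taylor : (taylor (AdjoinRoot.root P) Q).Monic := by
    rw [Monic, leadingCoeff, natDegree_taylor, coeff_taylor_natDegree]
    exact monic_Q
  have dvd_taylor : Q ∣ taylor (AdjoinRoot.root P) Q := by
    rw [← AdjoinRoot.mk_eq_zero, ← AdjoinRoot.aeval_eq, aeval_def, taylor_apply, eval₂_comp,
      eval₂_add, eval₂_X, eval₂_C, Q_def, eval₂_map]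
    refine h _ _ _ _ ?_ ?_
    · rw [← eval₂_map]
      exact AdjoinRoot.eval₂_root Q
    · rw [← hom_eval₂, AdjoinRoot.eval₂_root, map_zero]
  exact eq_of_monic_of_dvd_of_natDegree_le monic_Q monic_taylor dvd_taylor
    (natDegree_taylor _ _).le

lemma hasseDeriv_eq_C_coeff {A : Type u} [CommRing A] {P : A[X]} (hP : P.Monic)
    (h0 : P.coeff 0 = 0)
    (h : ∀ (R : Type u) [CommRing R] (φ : A →+* R) (a b : R), P.eval₂ φ a = 0 →
      P.eval₂ φ b = 0 → P.eval₂ φ (a + b) = 0) {i : ℕ} (hi : i ≠ 0) :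
    hasseDeriv i P = C (P.coeff i) := by
  nontriviality A
  have coeff_taylor := congr(coeff $(taylor_root_eq_self hP h) i)
  rw [taylor_coeff, ← map_hasseDeriv, coeff_map] at coeff_taylor
  have dvd_sub_C : P ∣ hasseDeriv i P - C (P.coeff i) := by
    rw [← AdjoinRoot.mk_eq_zero, map_sub, sub_eq_zero, ← AdjoinRoot.aeval_eq, aeval_def,
      ← Polynomial.eval_map, AdjoinRoot.mk_C, AdjoinRoot.algebraMap_eq, coeff_taylor]
  have natDegree_ne_zero : P.natDegree ≠ 0 := fun natDegree_eq_zero => by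
    rw [← natDegree_eq_zero] at h0
    exact hP.ne_zero (leadingCoeff_eq_zero.mp h0)
  refine sub_eq_zero.mp (eq_zero_of_monic_dvd hP dvd_sub_C fun n hn => ?_)
  rw [coeff_sub, hasseDeriv_coeff, coeff_eq_zero_of_natDegree_lt (by omega), mul_zero,
    coeff_C_of_ne_zero (by omega), sub_zero]

lemma eval₂_add_of_monic {A : Type u} [CommRing A] {P : A[X]} (hP : P.Monic)
    (h0 : P.coeff 0 = 0)
    (h : ∀ (R : Type u) [CommRing R] (φ : A →+* R) (a b : R), P.eval₂ φ a = 0 →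
      P.eval₂ φ b = 0 → P.eval₂ φ (a + b) = 0)
    {R : Type*} [CommRing R] (φ : A →+* R) (a b : R) :
    P.eval₂ φ (a + b) = P.eval₂ φ a + P.eval₂ φ b := by
  have taylor_eq : taylor a (P.map φ) = P.map φ + C ((P.map φ).eval a) := by
    ext i
    rw [taylor_coeff, coeff_add, coeff_C]
    split_ifs with hi
    · subst hi
      simp [h0]
    · rw [← map_hasseDeriv, hasseDeriv_eq_C_coeff hP h0 h hi]
      simp
  have eval_taylor := congr(eval b $taylor_eq)
  rw [taylor_eval, eval_add, eval_C, Polynomial.eval_map, Polynomial.eval_map,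
    Polynomial.eval_map] at eval_taylor
  rw [add_comm a b, eval_taylor, add_comm]

lemma eval₂_mul_of_monic {A : Type u} [CommRing A] {P P' : A[X]} (hP : P.Monic)
    (hP' : P'.Monic) (hd : P.natDegree = P'.natDegree) (u : A)
    (h : ∀ (R : Type u) [CommRing R] (φ : A →+* R) (a : R), P'.eval₂ φ a = 0 →
      P.eval₂ φ (φ u * a) = 0)
    {R : Type*} [CommRing R] (φ : A →+* R) (a : R) :
    P.eval₂ φ (φ u * a) = φ u ^ P.natDegree * P'.eval₂ φ a := by
  have dvd_comp : P' ∣ P.comp (C u * X) := by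
    rw [← AdjoinRoot.mk_eq_zero, ← AdjoinRoot.aeval_eq, aeval_def, eval₂_comp, eval₂_mul, eval₂_X,
      eval₂_C]
    exact h _ _ _ (AdjoinRoot.eval₂_root P')
  have comp_eq : P.comp (C u * X) = C (u ^ P.natDegree) * P' := by
    refine sub_eq_zero.mp (eq_zero_of_monic_dvd hP'
      (dvd_sub dvd_comp (dvd_mul_left _ _)) fun n hn => ?_)
    rw [coeff_sub, comp_C_mul_X_coeff, coeff_C_mul]
    rcases hn.eq_or_lt with rfl | hn
    · rw [hP'.coeff_natDegree, ← hd, hP.coeff_natDegree, one_mul, mul_one, sub_self]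
    · rw [coeff_eq_zero_of_natDegree_lt hn, coeff_eq_zero_of_natDegree_lt (by omega), zero_mul,
        mul_zero, sub_zero]
  have eval₂_comp_eq := congr(eval₂ φ a $comp_eq)
  rwa [eval₂_comp, eval₂_mul, eval₂_mul, eval₂_X, eval₂_C, eval₂_C, map_pow] at eval₂_comp_eq

end Monogenic

/-! ### The equation of a finite flat subgroup -/

section Equation

open Polynomial

variable {k : Type u} [Field k] {s : S ⟶ Spec (.of k)} {L M : S.Modules}

/-- `P = 0` is the equation of `G` in `𝔾_{a,L}` over `Spec A`, in the coordinate given by the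
section `g`. -/
def IsEquation (V : LineBundle s L) {G : Over S} (i : G ⟶ V.X) {A : CommRingCat.{u}}
    {j : Spec A ⟶ S} (g : Sections s L (Over.mk j)) (P : A[X]) : Prop :=
  ∀ (T : Over S) (t : T ⟶ Over.mk j) (a : Γ(T.left, ⊤)),
    (∃ y : T ⟶ G, y ≫ i = V.pointOf (a • pullSection t g)) ↔ P.eval₂ (pointRingHom t) a = 0

/-- In the coordinate given by the section `g`, the element `x` of `B` is the coordinate of the
`B`-valued point `y` of the subgroup `G` of `𝔾_{a,L}`. -/
def IsCoordinate {V : LineBundle s L} {G : Over S} (i : G ⟶ V.X) {A B : CommRingCat.{u}}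
    {j : Spec A ⟶ S} (g : Sections s L (Over.mk j)) {φ : A ⟶ B}
    (y : Over.mk (Spec.map φ ≫ j) ⟶ G) (x : B) : Prop :=
  y ≫ i = V.pointOf
    (pointRingHom (𝟙 (Over.mk (Spec.map φ ≫ j))) x • pullSection (specMapOver j φ) g)

lemma exists_affine_pullback {G : Over S} [IsFinite G.hom] [Flat G.hom] {A : CommRingCat.{u}}
    (j : Spec A ⟶ S) :
    ∃ (B : CommRingCat.{u}) (φ : A ⟶ B) (y : Over.mk (Spec.map φ ≫ j) ⟶ G),
      IsPullback y.left (Spec.map φ) G.hom j ∧ φ.hom.Finite ∧ φ.hom.Flat := by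
  have : IsAffine (pullback G.hom j) := isAffine_of_isAffineHom (pullback.snd G.hom j)
  obtain ⟨φ, hφ⟩ := Spec.map_surjective ((pullback G.hom j).isoSpec.inv ≫ pullback.snd G.hom j)
  have isPullback : IsPullback ((pullback G.hom j).isoSpec.inv ≫ pullback.fst G.hom j)
      (Spec.map φ) G.hom j :=
    (IsPullback.of_hasPullback G.hom j).of_iso' (pullback G.hom j).isoSpec.symm
      (Iso.refl _) (Iso.refl _) (Iso.refl _) (by simp) (by simp [hφ]) (by simp) (by simp)
  refine ⟨_, φ, Over.homMk _ isPullback.w, isPullback, ?_, ?_⟩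
  · rw [← IsFinite.SpecMap_iff]
    exact MorphismProperty.of_isPullback isPullback inferInstance
  · rw [← Flat.SpecMap_iff]
    exact MorphismProperty.of_isPullback isPullback inferInstance

section Coordinate

variable {V : LineBundle s L} {G : Over S} {i : G ⟶ V.X} {A B : CommRingCat.{u}}
  {j : Spec A ⟶ S} {g : Sections s L (Over.mk j)} {φ : A ⟶ B}
  {y : Over.mk (Spec.map φ ≫ j) ⟶ G} {x : B}

lemma over_hom_ext_of_isPullback (isPullback : IsPullback y.left (Spec.map φ) G.hom j)
    {T : Over S} {h h' : T ⟶ Over.mk (Spec.map φ ≫ j)}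
    (base_eq : h ≫ specMapOver j φ = h' ≫ specMapOver j φ) (comp_eq : h ≫ y = h' ≫ y) :
    h = h' := by
  ext : 1
  exact isPullback.hom_ext congr(($comp_eq).left) congr(($base_eq).left)

lemma exists_over_lift_of_isPullback (isPullback : IsPullback y.left (Spec.map φ) G.hom j)
    {T : Over S} (t : T ⟶ Over.mk j) (z : T ⟶ G) :
    ∃ h : T ⟶ Over.mk (Spec.map φ ≫ j), h ≫ specMapOver j φ = t ∧ h ≫ y = z := by
  have square : z.left ≫ G.hom = t.left ≫ j := (Over.w z).trans (Over.w t).symm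
  refine ⟨Over.homMk (isPullback.lift z.left t.left square) ?_, ?_, ?_⟩
  · refine (Category.assoc _ _ _).symm.trans ?_
    rw [isPullback.lift_snd]
    exact Over.w t
  · ext : 1
    exact isPullback.lift_snd _ _ _
  · ext : 1
    exact isPullback.lift_fst _ _ _

lemma exists_isCoordinate (hg : IsGenerator g) (i : G ⟶ V.X)
    (y : Over.mk (Spec.map φ ≫ j) ⟶ G) :
    ∃ x : B, IsCoordinate i g y x := by
  obtain ⟨a, ha⟩ := (hg _ (specMapOver j φ)).2 (V.sectionOf (y ≫ i))
  obtain ⟨x, rfl⟩ := (pointRingHom_id_bijective (Spec.map φ ≫ j)).2 a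
  exact ⟨x, V.sectionOf_injective (by rw [V.sectionOf_pointOf, ← ha])⟩

lemma IsCoordinate.comp_eq
    (hx : IsCoordinate i g y x) {T : Over S} (h : T ⟶ Over.mk (Spec.map φ ≫ j)) :
    h ≫ y ≫ i = V.pointOf (pointRingHom h x • pullSection (h ≫ specMapOver j φ) g) := by
  rw [IsCoordinate] at hx
  rw [hx, V.comp_pointOf, pullSection_smul, ← pullSection_comp, ← pointRingHom_comp_apply,
    Category.comp_id]

lemma IsCoordinate.ringHom_eq [Mono i] (hx : IsCoordinate i g y x)
    (isPullback : IsPullback y.left (Spec.map φ) G.hom j)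
    {T : Over S} (t : T ⟶ Over.mk j) {ψ ψ' : B →+* Γ(T.left, ⊤)}
    (hψ : ∀ a, ψ (φ.hom a) = pointRingHom t a) (hψ' : ∀ a, ψ' (φ.hom a) = pointRingHom t a)
    (apply_eq : ψ x = ψ' x) : ψ = ψ' := by
  obtain ⟨h, h_base, rfl⟩ := exists_specMapOver_lift φ t ψ hψ
  obtain ⟨h', h'_base, rfl⟩ := exists_specMapOver_lift φ t ψ' hψ'
  refine congrArg pointRingHom
    (over_hom_ext_of_isPullback isPullback (h_base.trans h'_base.symm) ?_)
  rw [← cancel_mono i, Category.assoc, Category.assoc, hx.comp_eq, hx.comp_eq,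
    h_base, h'_base, apply_eq]

-- Since `G` is a subfunctor of the affine line, `A[X] ⟶ B` is an epimorphism of rings; a finite
-- epimorphism of rings is surjective.
lemma IsCoordinate.eval₂RingHom_surjective [Mono i] (hx : IsCoordinate i g y x)
    (isPullback : IsPullback y.left (Spec.map φ) G.hom j) (hφ : φ.hom.Finite) :
    Function.Surjective (eval₂RingHom φ.hom x) := by
  let f : CommRingCat.of A[X] ⟶ B := CommRingCat.ofHom (eval₂RingHom φ.hom x)
  have f_C (a : A) : f.hom (C a) = φ.hom a := eval₂_C φ.hom x
  have f_X : f.hom (Polynomial.X (R := A)) = x := eval₂_X φ.hom x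
  have : Epi f := by
    refine ⟨fun {D} v w comp_eq => ?_⟩
    have apply_base (a : A) : w.hom (φ.hom a) = v.hom (φ.hom a) := by
      rw [← f_C]
      exact congr($(comp_eq.symm) (C a))
    have apply_coordinate : v.hom x = w.hom x := by
      rw [← f_X]
      exact congr($comp_eq (Polynomial.X (R := A)))
    let toSections := pointRingHom (𝟙 (Over.mk (Spec.map (φ ≫ v) ≫ j)))
    have toSections_comp_eq := hx.ringHom_eq isPullback
      (specMapOver j (φ ≫ v)) (ψ := toSections.comp v.hom) (ψ' := toSections.comp w.hom)
      (fun a => (pointRingHom_specMapOver j (φ ≫ v) a).symm)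
      (fun a => (congrArg toSections (apply_base a)).trans
        (pointRingHom_specMapOver j (φ ≫ v) a).symm)
      (congrArg toSections apply_coordinate)
    ext b
    exact (pointRingHom_id_bijective _).1 congr($toSections_comp_eq b)
  have f_comp_C : f.hom.comp (C : A →+* A[X]) = φ.hom := RingHom.ext f_C
  exact RingHom.surjective_of_epi_of_finite f
    (RingHom.Finite.of_comp_finite (f := (C : A →+* A[X])) (f_comp_C ▸ hφ))

lemma IsCoordinate.isEquation (hx : IsCoordinate i g y x) (hg : IsGenerator g)
    (isPullback : IsPullback y.left (Spec.map φ) G.hom j)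
    (hsurj : Function.Surjective (eval₂RingHom φ.hom x)) {P : A[X]}
    (hP : ∀ p : A[X], p.eval₂ φ.hom x = 0 ↔ P ∣ p) : IsEquation V i g P := by
  refine fun T t a => ⟨?_, fun ha => ?_⟩
  · rintro ⟨z, hz⟩
    obtain ⟨h, rfl, rfl⟩ := exists_over_lift_of_isPullback isPullback t z
    rw [Category.assoc, hx.comp_eq] at hz
    have coordinate_eq : pointRingHom h x = a := (hg T _).1 (V.rep.homEquiv.symm.injective hz)
    have pointRingHom_comp : pointRingHom (h ≫ specMapOver j φ) = (pointRingHom h).comp φ.hom :=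
      RingHom.ext (pointRingHom_comp_specMapOver h)
    rw [pointRingHom_comp, ← coordinate_eq, ← hom_eval₂, (hP P).mpr dvd_rfl, map_zero]
  · let ψ := (eval₂RingHom φ.hom x).liftOfSurjective hsurj
      ⟨eval₂RingHom (pointRingHom t) a, fun p hp => by
        obtain ⟨q, rfl⟩ := (hP p).mp hp
        rw [RingHom.mem_ker, map_mul, coe_eval₂RingHom, ha, zero_mul]⟩
    have ψ_eval₂ (p : A[X]) : ψ (p.eval₂ φ.hom x) = p.eval₂ (pointRingHom t) a :=
      (eval₂RingHom φ.hom x).liftOfRightInverse_comp_apply _ _ _ p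
    have ψ_base (b : A) : ψ (φ.hom b) = pointRingHom t b := by
      simpa only [eval₂_C] using ψ_eval₂ (C b)
    have ψ_coordinate : ψ x = a := by
      simpa only [eval₂_X] using ψ_eval₂ Polynomial.X
    obtain ⟨h, rfl, h_ringHom⟩ := exists_specMapOver_lift φ t ψ ψ_base
    exact ⟨h ≫ y, by rw [Category.assoc, hx.comp_eq, h_ringHom, ψ_coordinate]⟩

end Coordinate

lemma LineBundle.IsFiniteFlatFqSubgroup.exists_isEquation {V : LineBundle s L} {G : Over S}
    [AddGrpObj G] {i : G ⟶ V.X} (hi : V.IsFiniteFlatFqSubgroup i) {A : CommRingCat.{u}}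
    {j : Spec A ⟶ S} {g : Sections s L (Over.mk j)} (hg : IsGenerator g) (r : ℕ)
    (hr : ∀ x, G.hom.finrank (j x) = r) :
    ∃ P : A[X], P.Monic ∧ (Nontrivial A → P.natDegree = r) ∧ IsEquation V i g P := by
  have := hi.finite
  have := hi.flat
  have := hi.mono
  obtain ⟨B, φ, y, isPullback, finite, flat⟩ := exists_affine_pullback (G := G) j
  obtain ⟨x, hx⟩ := exists_isCoordinate hg i y
  have surjective := hx.eval₂RingHom_surjective isPullback finite
  algebraize [φ.hom]
  obtain ⟨P, monic, natDegree_eq, aeval_eq_zero_iff⟩ :=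
    exists_monic_aeval_eq_zero_iff (A := A) (B := B) x surjective r fun p => by
      rw [← Scheme.Hom.finrank_SpecMap_algebraMap, ← hr p]
      exact Scheme.Hom.finrank_of_isPullback _ _ _ _ isPullback p
  exact ⟨P, monic, natDegree_eq,
    hx.isEquation hg isPullback surjective aeval_eq_zero_iff⟩

end Equation

section EquationProperties

open Polynomial
open scoped AddMonObj

variable {k : Type u} [Field k] {s : S ⟶ Spec (.of k)} {L M : S.Modules}

lemma LineBundle.pointOf_add (V : LineBundle s L) {T : Over S} (x y : Sections s L T) :
    V.pointOf (x + y) = V.pointOf x + V.pointOf y :=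
  V.sectionOf_injective <| by
    rw [V.sectionOf_add, V.sectionOf_pointOf, V.sectionOf_pointOf, V.sectionOf_pointOf]

lemma LineBundle.pointOf_zero (V : LineBundle s L) {T : Over S} :
    V.pointOf (0 : Sections s L T) = 0 :=
  V.sectionOf_injective <| by rw [V.sectionOf_zero, V.sectionOf_pointOf]

lemma LineBundle.pointOf_smul (V : LineBundle s L) {T : Over S} (c : k) (x : Sections s L T) :
    V.pointOf (c • x) = V.pointOf x ≫ V.smul c :=
  V.sectionOf_injective <| by rw [V.sectionOf_smul, V.sectionOf_pointOf, V.sectionOf_pointOf]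

lemma exists_pointRingHom_eq {A C : CommRingCat.{u}} {j : Spec A ⟶ S} {j' : Spec C ⟶ S}
    (t : Over.mk j' ⟶ Over.mk j) :
    ∃ α : A →+* C, ∀ a, pointRingHom t a = pointRingHom (𝟙 (Over.mk j')) (α a) := by
  let e := RingEquiv.ofBijective _ (pointRingHom_id_bijective j')
  exact ⟨e.symm.toRingHom.comp (pointRingHom t), fun a => (e.apply_symm_apply _).symm⟩

lemma pointRingHom_comp_eq {A C : CommRingCat.{u}} {j : Spec A ⟶ S} {j' : Spec C ⟶ S}
    {t : Over.mk j' ⟶ Over.mk j} {α : A →+* C}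
    (hα : ∀ a, pointRingHom t a = pointRingHom (𝟙 (Over.mk j')) (α a)) {T : Over S}
    (h : T ⟶ Over.mk j') :
    pointRingHom (h ≫ t) = (pointRingHom h).comp α := by
  ext a
  rw [pointRingHom_comp_apply, hα, ← pointRingHom_comp_apply, Category.comp_id]
  rfl

namespace IsEquation

variable {V : LineBundle s L} {G : Over S} {i : G ⟶ V.X} {A : CommRingCat.{u}} {j : Spec A ⟶ S}
  {g : Sections s L (Over.mk j)} {P : A[X]}

lemma baseChange (hP : IsEquation V i g P) {C : CommRingCat.{u}} {j' : Spec C ⟶ S}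
    (t : Over.mk j' ⟶ Over.mk j) {α : A →+* C}
    (hα : ∀ a, pointRingHom t a = pointRingHom (𝟙 (Over.mk j')) (α a)) :
    IsEquation V i (pullSection t g) (P.map α) := fun T t' a => by
  rw [← pullSection_comp, hP, eval₂_map, pointRingHom_comp_eq hα]

lemma eval₂_eq_zero_iff (hP : IsEquation V i g P) {R : Type u} [CommRing R] (φ : A →+* R) (a : R) :
    P.eval₂ φ a = 0 ↔
      ∃ y : Over.mk (Spec.map (CommRingCat.ofHom φ) ≫ j) ⟶ G, y ≫ i =
        V.pointOf (pointRingHom (A := .of R) (𝟙 (Over.mk (Spec.map (CommRingCat.ofHom φ) ≫ j))) a •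
          pullSection (specMapOver j (CommRingCat.ofHom φ)) g) := by
  rw [hP]
  have pointRingHom_eq_comp : pointRingHom (specMapOver j (CommRingCat.ofHom φ)) =
      (pointRingHom (A := .of R) (𝟙 (Over.mk (Spec.map (CommRingCat.ofHom φ) ≫ j)))).comp φ :=
    RingHom.ext (pointRingHom_specMapOver j (CommRingCat.ofHom φ))
  rw [pointRingHom_eq_comp, ← hom_eval₂]
  exact (map_eq_zero_iff _ (pointRingHom_id_bijective (A := .of R) _).1).symm

section Group

variable [AddGrpObj G]

lemma coeff_zero (hP : IsEquation V i g P) (hi : IsAddMonHom i) : P.coeff 0 = 0 := by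
  have eval₂_zero := (hP _ (𝟙 _) 0).mp ⟨0, by
    rw [zero_smul, V.pointOf_zero, zero_comp_of_isAddMonHom i hi]⟩
  rw [eval₂_at_zero] at eval₂_zero
  exact (map_eq_zero_iff _ (pointRingHom_id_bijective j).1).mp eval₂_zero

lemma eval₂_add (hP : IsEquation V i g P) (hm : P.Monic) (hi : IsAddMonHom i)
    {R : Type*} [CommRing R] (φ : A →+* R) (a b : R) :
    P.eval₂ φ (a + b) = P.eval₂ φ a + P.eval₂ φ b := by
  refine eval₂_add_of_monic hm (hP.coeff_zero hi) (fun R _ φ a b ha hb => ?_) φ a b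
  rw [hP.eval₂_eq_zero_iff] at ha hb ⊢
  obtain ⟨y, hy⟩ := ha
  obtain ⟨z, hz⟩ := hb
  exact ⟨y + z, by rw [add_comp_of_isAddMonHom i hi, hy, hz, map_add, add_smul, V.pointOf_add]⟩

end Group

lemma eval₂_mul (hP : IsEquation V i g P) (hm : P.Monic) {g' : Sections s L (Over.mk j)}
    {P' : A[X]} (hP' : IsEquation V i g' P') (hm' : P'.Monic)
    (hd : P.natDegree = P'.natDegree) (u : A)
    (hu : g' = pointRingHom (𝟙 (Over.mk j)) u • g) {R : Type*} [CommRing R] (φ : A →+* R) (a : R) :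
    P.eval₂ φ (φ u * a) = φ u ^ P.natDegree * P'.eval₂ φ a := by
  refine eval₂_mul_of_monic hm hm' hd u (fun R _ φ a ha => ?_) φ a
  rw [hP'.eval₂_eq_zero_iff] at ha
  rw [hP.eval₂_eq_zero_iff]
  obtain ⟨y, hy⟩ := ha
  refine ⟨y, hy.trans ?_⟩
  rw [hu, pullSection_smul, ← pointRingHom_comp_apply, Category.comp_id, smul_smul,
    pointRingHom_specMapOver, map_mul, mul_comm]
  rfl

lemma eval₂_scalar (hP : IsEquation V i g P) (hm : P.Monic) [Finite k]
    (hs : ∀ c : k, ∃ a : G ⟶ G, a ≫ i = i ≫ V.smul c)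
    (hd : Nontrivial A → ∃ n, P.natDegree = Nat.card k ^ n) (c : k) {T : Over S}
    (t : T ⟶ Over.mk j) (a : Γ(T.left, ⊤)) :
    P.eval₂ (pointRingHom t) (scalars s T c * a) = scalars s T c * P.eval₂ (pointRingHom t) a := by
  obtain ⟨b, hb⟩ := (pointRingHom_id_bijective j).2 (scalars s (Over.mk j) c)
  have pointRingHom_scalar {T : Over S} (t : T ⟶ Over.mk j) :
      pointRingHom t b = scalars s T c := by
    rw [← Category.comp_id t, pointRingHom_comp_apply, hb, pullFunction_scalars]
  have eval₂_scalar_mul := eval₂_mul_of_monic hm hm rfl b (fun R _ φ a ha => by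
    rw [hP.eval₂_eq_zero_iff] at ha ⊢
    obtain ⟨y, hy⟩ := ha
    obtain ⟨z, hz⟩ := hs c
    refine ⟨y ≫ z, ?_⟩
    rw [Category.assoc, hz, reassoc_of% hy, ← V.pointOf_smul, scalars_smul, smul_smul, map_mul]
    congr 3
    rw [← pointRingHom_scalar (specMapOver j (CommRingCat.ofHom φ)), pointRingHom_specMapOver]
    rfl) (pointRingHom t) a
  rw [pointRingHom_scalar] at eval₂_scalar_mul
  rw [eval₂_scalar_mul]
  congr 1
  cases subsingleton_or_nontrivial A
  · have := (pointRingHom t).codomain_trivial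
    exact Subsingleton.elim _ _
  · obtain ⟨n, hn⟩ := hd inferInstance
    have := Fintype.ofFinite k
    rw [hn, ← map_pow, Nat.card_eq_fintype_card, FiniteField.pow_card_pow]

end IsEquation

end EquationProperties

/-! ### Gluing the equations to a morphism of line bundles -/

section Charts

open Polynomial
open scoped AddMonObj

variable {k : Type u} [Field k] {s : S ⟶ Spec (.of k)} {L M : S.Modules}

lemma exists_cover {ι : Type u} {A : ι → CommRingCat.{u}} (j : ∀ a, Spec (A a) ⟶ S)
    [∀ a, IsOpenImmersion (j a)] (hj : ∀ x : S, ∃ a, ∃ y, j a y = x) (T : Over S) :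
    ∃ (T' : ι → Over S) (e : ∀ a, T' a ⟶ T) (_ : ∀ a, T' a ⟶ Over.mk (j a)),
      (∀ a, IsOpenImmersion (e a).left) ∧ ∀ x : T.left, ∃ a, ∃ y, (e a).left y = x := by
  refine ⟨fun a => Over.mk (pullback.fst T.hom (j a) ≫ T.hom),
    fun a => Over.homMk (pullback.fst T.hom (j a)),
    fun a => Over.homMk (pullback.snd T.hom (j a)) pullback.condition.symm,
    fun a => (inferInstance : IsOpenImmersion (pullback.fst T.hom (j a))), fun x => ?_⟩
  obtain ⟨a, y, hy⟩ := hj (T.hom x)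
  obtain ⟨z, hz, -⟩ := Scheme.Pullback.exists_preimage_pullback x y hy.symm
  exact ⟨a, z, hz⟩

lemma sections_ext_of_cover {ι : Type u} {A : ι → CommRingCat.{u}} (j : ∀ a, Spec (A a) ⟶ S)
    [∀ a, IsOpenImmersion (j a)] (hj : ∀ x : S, ∃ a, ∃ y, j a y = x) {T : Over S}
    {x y : Sections s L T}
    (h : ∀ (a : ι) (T' : Over S) (e : T' ⟶ T) (_ : T' ⟶ Over.mk (j a)),
      pullSection e x = pullSection e y) :
    x = y := by
  obtain ⟨T', e, t, he, hT'⟩ := exists_cover j hj T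
  exact sections_ext e hT' fun a => h a _ (e a) (t a)

lemma sections_ext_of_affine {T : Over S} {x y : Sections s L T}
    (h : ∀ (C : CommRingCat.{u}) (j : Spec C ⟶ S) (e : Over.mk j ⟶ T),
      pullSection e x = pullSection e y) :
    x = y := by
  let 𝒰 := T.left.affineOpenCover
  let e (i : 𝒰.I₀) : Over.mk (𝒰.f i ≫ T.hom) ⟶ T := Over.homMk (𝒰.f i)
  have (i : 𝒰.I₀) : IsOpenImmersion (e i).left := inferInstanceAs (IsOpenImmersion (𝒰.f i))
  exact sections_ext e (fun x => ⟨𝒰.idx x, 𝒰.covers x⟩) fun i => h _ _ (e i)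

/-- Affine charts of `S` with generators of `L` and `M`, such that the transition units of `M` are
the `ρ`-th powers of those of `L`. -/
structure PowerCharts (s : S ⟶ Spec (.of k)) (L M : S.Modules) (ρ : S → ℕ) where
  ι : Type u
  A : ι → CommRingCat.{u}
  j : ∀ a, Spec (A a) ⟶ S
  isOpenImmersion : ∀ a, IsOpenImmersion (j a)
  covers : ∀ x : S, ∃ a, ∃ y, j a y = x
  r : ι → ℕ
  ρ_eq : ∀ a x, ρ (j a x) = r a
  g : ∀ a, Sections s L (Over.mk (j a))
  isGenerator_g : ∀ a, IsGenerator (g a)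
  h : ∀ a, Sections s M (Over.mk (j a))
  isGenerator_h : ∀ a, IsGenerator (h a)
  transition : ∀ (a b : ι) (T : Over S) (t : T ⟶ Over.mk (j a)) (t' : T ⟶ Over.mk (j b))
    (u : Γ(T.left, ⊤)), pullSection t' (g b) = u • pullSection t (g a) →
      pullSection t' (h b) = u ^ r a • pullSection t (h a)

namespace PowerCharts

attribute [instance] PowerCharts.isOpenImmersion

variable {V : LineBundle s L} {G : Over S} {i : G ⟶ V.X} {ρ : S → ℕ} (D : PowerCharts s L M ρ)

lemma r_eq_r {a b : D.ι} {T : Over S} [Nonempty T.left] (t : T ⟶ Over.mk (D.j a))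
    (t' : T ⟶ Over.mk (D.j b)) : D.r a = D.r b := by
  obtain ⟨p⟩ := ‹Nonempty T.left›
  have base_eq : t.left ≫ D.j a = t'.left ≫ D.j b := (Over.w t).trans (Over.w t').symm
  rw [← D.ρ_eq a (t.left p), ← D.ρ_eq b (t'.left p)]
  congr 1
  exact congr($base_eq p)

lemma eval₂_smul_eq_of_affine {P : ∀ a, (D.A a)[X]} (hP : ∀ a, (P a).Monic)
    (hd : ∀ a, Nontrivial (D.A a) → (P a).natDegree = D.r a)
    (he : ∀ a, IsEquation V i (D.g a) (P a)) (a b : D.ι) {C : CommRingCat.{u}} [Nontrivial C]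
    {j : Spec C ⟶ S} (t : Over.mk j ⟶ Over.mk (D.j a)) (t' : Over.mk j ⟶ Over.mk (D.j b))
    (x x' : Γ((Over.mk j).left, ⊤))
    (hx : x • pullSection t (D.g a) = x' • pullSection t' (D.g b)) :
    (P a).eval₂ (pointRingHom t) x • pullSection t (D.h a) =
      (P b).eval₂ (pointRingHom t') x' • pullSection t' (D.h b) := by
  obtain ⟨α, hα⟩ := exists_pointRingHom_eq t
  obtain ⟨β, hβ⟩ := exists_pointRingHom_eq t'
  have := α.domain_nontrivial
  have := β.domain_nontrivial
  have : Nonempty (Over.mk j).left := inferInstanceAs (Nonempty (Spec C))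
  obtain ⟨u', hu'⟩ := (D.isGenerator_g a _ t).2 (pullSection t' (D.g b))
  obtain ⟨u, rfl⟩ := (pointRingHom_id_bijective j).2 u'
  obtain rfl : x = pointRingHom (𝟙 (Over.mk j)) u * x' := by
    rw [← hu', smul_smul, mul_comm] at hx
    exact (D.isGenerator_g a _ t).1 hx
  have natDegree_eq : ((P a).map α).natDegree = ((P b).map β).natDegree := by
    rw [(hP a).natDegree_map, (hP b).natDegree_map, hd a ‹_›, hd b ‹_›, D.r_eq_r t t']
  have eval₂_transition := ((he a).baseChange t hα).eval₂_mul ((hP a).map α)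
    ((he b).baseChange t' hβ) ((hP b).map β) natDegree_eq u hu'.symm
    (pointRingHom (𝟙 (Over.mk j))) x'
  have comp_α : (pointRingHom (𝟙 (Over.mk j))).comp α = pointRingHom t :=
    (RingHom.ext hα).symm
  have comp_β : (pointRingHom (𝟙 (Over.mk j))).comp β = pointRingHom t' :=
    (RingHom.ext hβ).symm
  rw [eval₂_map, eval₂_map, (hP a).natDegree_map, hd a ‹_›, comp_α, comp_β] at eval₂_transition
  rw [eval₂_transition, D.transition a b _ t t' _ hu'.symm, smul_smul, mul_comm]

lemma eval₂_smul_eq {P : ∀ a, (D.A a)[X]} (hP : ∀ a, (P a).Monic)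
    (hd : ∀ a, Nontrivial (D.A a) → (P a).natDegree = D.r a)
    (he : ∀ a, IsEquation V i (D.g a) (P a)) (a b : D.ι) {T : Over S}
    (t : T ⟶ Over.mk (D.j a)) (t' : T ⟶ Over.mk (D.j b)) (x x' : Γ(T.left, ⊤))
    (hx : x • pullSection t (D.g a) = x' • pullSection t' (D.g b)) :
    (P a).eval₂ (pointRingHom t) x • pullSection t (D.h a) =
      (P b).eval₂ (pointRingHom t') x' • pullSection t' (D.h b) := by
  refine sections_ext_of_affine fun C j e => ?_
  replace hx := congrArg (pullSection e) hx
  rw [pullSection_smul, pullSection_smul, ← pullSection_comp, ← pullSection_comp] at hx ⊢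
  rw [hom_eval₂, hom_eval₂, ← pointRingHom_comp, ← pointRingHom_comp]
  cases subsingleton_or_nontrivial C
  · have : Subsingleton Γ((Over.mk j).left, ⊤) :=
      (pointRingHom (𝟙 (Over.mk j))).codomain_trivial
    have := Module.subsingleton Γ((Over.mk j).left, ⊤) (Sections s M (Over.mk j))
    exact Subsingleton.elim _ _
  · exact D.eval₂_smul_eq_of_affine hP hd he a b _ _ _ _ hx

end PowerCharts

end Charts

section Construction

open Polynomial
open scoped AddMonObj

variable {k : Type u} [Field k] {s : S ⟶ Spec (.of k)} {L M : S.Modules}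

/-- The chart of `𝔾_{a,L}` given by a generator of `L` over `Spec A`. -/
def LineBundle.chart (V : LineBundle s L) {A : CommRingCat.{u}} {j : Spec A ⟶ S}
    (g : Sections s L (Over.mk j)) : affineLine j ⟶ V.X := V.pointOf (tautologicalSection g)

lemma LineBundle.sectionOf_comp_chart (V : LineBundle s L) {A : CommRingCat.{u}} {j : Spec A ⟶ S}
    (g : Sections s L (Over.mk j)) {T : Over S} (h : T ⟶ affineLine j) :
    V.sectionOf (h ≫ V.chart g) = pullSection h (tautologicalSection g) := by
  rw [LineBundle.chart, V.comp_pointOf, V.sectionOf_pointOf]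

lemma LineBundle.isPullback_chart (V : LineBundle s L) {A : CommRingCat.{u}} {j : Spec A ⟶ S}
    {g : Sections s L (Over.mk j)} (hg : IsGenerator g) :
    IsPullback (V.chart g).left (affineLineProj j).left V.X.hom j := by
  have exists_lift (c : PullbackCone V.X.hom j) :
      ∃ l : Over.mk (c.snd ≫ j) ⟶ affineLine j, l ≫ affineLineProj j = Over.homMk c.snd ∧
        l ≫ V.chart g = Over.homMk c.fst c.condition := by
    obtain ⟨l, l_proj, l_section⟩ := exists_affineLine_lift hg (T := Over.mk (c.snd ≫ j))
      (Over.homMk c.snd) (V.sectionOf (Over.homMk c.fst c.condition))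
    exact ⟨l, l_proj, V.sectionOf_injective ((V.sectionOf_comp_chart g l).trans l_section)⟩
  choose lift lift_proj lift_chart using exists_lift
  refine ⟨⟨(Over.w (V.chart g)).trans (Over.w (affineLineProj j)).symm⟩, ⟨PullbackCone.IsLimit.mk _
    (fun c => (lift c).left) (fun c => congr(($(lift_chart c)).left))
    (fun c => congr(($(lift_proj c)).left)) fun c m m_chart m_proj => ?_⟩⟩
  have m_over : m ≫ (affineLine j).hom = c.snd ≫ j := by
    rw [← m_proj, Category.assoc]
    rfl
  refine congr(($(affineLine_hom_ext hg (h := (Over.homMk m m_over : Over.mk (c.snd ≫ j) ⟶ _))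
    (Eq.trans ?_ (lift_proj c).symm) ?_)).left)
  · ext : 1
    exact m_proj
  · rw [← V.sectionOf_comp_chart, ← V.sectionOf_comp_chart, lift_chart]
    congr 1
    ext : 1
    exact m_chart

lemma LineBundle.comp_chart (V : LineBundle s L) {A : CommRingCat.{u}} {j : Spec A ⟶ S}
    (g : Sections s L (Over.mk j)) {T : Over S} (h : T ⟶ affineLine j) :
    h ≫ V.chart g =
      V.pointOf (pullFunction h (affineLineCoord j) • pullSection (h ≫ affineLineProj j) g) := by
  rw [LineBundle.chart, V.comp_pointOf, pullSection_tautologicalSection]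

lemma LineBundle.isOpenImmersion_chart (V : LineBundle s L) {A : CommRingCat.{u}} {j : Spec A ⟶ S}
    [IsOpenImmersion j] {g : Sections s L (Over.mk j)} (hg : IsGenerator g) :
    IsOpenImmersion (V.chart g).left :=
  MorphismProperty.of_isPullback (V.isPullback_chart hg).flip inferInstance

lemma LineBundle.exists_chart (V : LineBundle s L) {ι : Type u} {A : ι → CommRingCat.{u}}
    {j : ∀ a, Spec (A a) ⟶ S} (hj : ∀ x : S, ∃ a, ∃ y, j a y = x)
    {g : ∀ a, Sections s L (Over.mk (j a))} (hg : ∀ a, IsGenerator (g a)) (x : V.X.left) :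
    ∃ a, ∃ y, (V.chart (g a)).left y = x := by
  obtain ⟨a, y, hy⟩ := hj (V.X.hom x)
  obtain ⟨z, hz, -⟩ := Scheme.exists_preimage_of_isPullback (V.isPullback_chart (hg a)) x y hy.symm
  exact ⟨a, z, hz⟩

lemma exists_factorization_of_openCover {X Y Z : Scheme.{u}} (𝒰 : X.OpenCover) (i : Y ⟶ Z)
    [Mono i] (f : X ⟶ Z) (h : ∀ a, ∃ y, y ≫ i = 𝒰.f a ≫ f) : ∃ z, z ≫ i = f := by
  choose y hy using h
  refine ⟨𝒰.glueMorphisms y fun a b => ?_, 𝒰.hom_ext _ _ fun a => ?_⟩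
  · rw [← cancel_mono i, Category.assoc, Category.assoc, hy, hy, pullback.condition_assoc]
  · rw [𝒰.ι_glueMorphisms_assoc, hy]

namespace PowerCharts

variable {V : LineBundle s L} {W : LineBundle s M} {G : Over S} {i : G ⟶ V.X} {ρ : S → ℕ}
  (D : PowerCharts s L M ρ)

/-- `ξ` is given in the charts by the polynomials `P`. -/
def IsGivenBy (V : LineBundle s L) (W : LineBundle s M) (P : ∀ a, (D.A a)[X]) (ξ : V.X ⟶ W.X) :
    Prop :=
  ∀ (a : D.ι) (T : Over S) (t : T ⟶ Over.mk (D.j a)) (x : Γ(T.left, ⊤)),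
    V.pointOf (x • pullSection t (D.g a)) ≫ ξ =
      W.pointOf ((P a).eval₂ (pointRingHom t) x • pullSection t (D.h a))

lemma exists_isGivenBy (W : LineBundle s M) {P : ∀ a, (D.A a)[X]} (hP : ∀ a, (P a).Monic)
    (hd : ∀ a, Nontrivial (D.A a) → (P a).natDegree = D.r a)
    (he : ∀ a, IsEquation V i (D.g a) (P a)) :
    ∃ ξ, D.IsGivenBy V W P ξ := by
  have (a : D.ι) := V.isOpenImmersion_chart (D.isGenerator_g a)
  obtain ⟨m, hm⟩ := exists_sections_glue (s := s) (L := M) (fun a => V.chart (D.g a))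
    (V.exists_chart D.covers D.isGenerator_g)
    (fun a => (P a).eval₂ (pointRingHom (affineLineProj (D.j a))) (affineLineCoord (D.j a)) •
      pullSection (affineLineProj (D.j a)) (D.h a)) (by
    intro a b T t t' h
    simp only [pullSection_smul, hom_eval₂, ← pointRingHom_comp, ← pullSection_comp]
    rw [V.comp_chart, V.comp_chart] at h
    exact D.eval₂_smul_eq hP hd he a b _ _ _ _ (V.rep.homEquiv.symm.injective h))
  refine ⟨W.pointOf m, fun a T t x => ?_⟩
  obtain ⟨h, rfl, rfl⟩ := exists_affineLine_hom t x
  rw [← V.comp_chart, Category.assoc, W.comp_pointOf, hm, W.comp_pointOf]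
  simp only [pullSection_smul, hom_eval₂, ← pointRingHom_comp, ← pullSection_comp]

variable {D} {P : ∀ a, (D.A a)[X]} {ξ : V.X ⟶ W.X}

lemma exists_smul_eq (D : PowerCharts s L M ρ) {T : Over S} {a : D.ι} (t : T ⟶ Over.mk (D.j a))
    (f : T ⟶ V.X) :
    ∃ x : Γ(T.left, ⊤), f = V.pointOf (x • pullSection t (D.g a)) := by
  obtain ⟨x, hx⟩ := (D.isGenerator_g a _ t).2 (V.sectionOf f)
  exact ⟨x, V.sectionOf_injective (by rw [V.sectionOf_pointOf, ← hx])⟩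

lemma hom_ext_of_cover (D : PowerCharts s L M ρ) {T : Over S} {f g : T ⟶ W.X}
    (h : ∀ (a : D.ι) (T' : Over S) (e : T' ⟶ T) (_ : T' ⟶ Over.mk (D.j a)), e ≫ f = e ≫ g) :
    f = g :=
  W.sectionOf_injective (sections_ext_of_cover D.j D.covers fun a T' e t => by
    rw [← W.sectionOf_comp, ← W.sectionOf_comp, h a T' e t])

lemma IsGivenBy.isAddMonHom [AddGrpObj G] (hξ : D.IsGivenBy V W P ξ) (hP : ∀ a, (P a).Monic)
    (he : ∀ a, IsEquation V i (D.g a) (P a)) (hi : IsAddMonHom i) : IsAddMonHom ξ := by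
  refine isAddMonHom_of_add _ fun T f g => hom_ext_of_cover D fun a T' e t => ?_
  rw [← Category.assoc, AddMonObj.comp_add, AddMonObj.comp_add, ← Category.assoc, ← Category.assoc]
  obtain ⟨x, hx⟩ := exists_smul_eq D t (e ≫ f)
  obtain ⟨y, hy⟩ := exists_smul_eq D t (e ≫ g)
  rw [hx, hy, ← V.pointOf_add, ← add_smul, hξ, hξ, hξ, (he a).eval₂_add (hP a) hi, add_smul,
    W.pointOf_add]

lemma IsGivenBy.smul_comp [Finite k] (hξ : D.IsGivenBy V W P ξ) (hP : ∀ a, (P a).Monic)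
    (he : ∀ a, IsEquation V i (D.g a) (P a)) (hs : ∀ c : k, ∃ a : G ⟶ G, a ≫ i = i ≫ V.smul c)
    (hd : ∀ a, Nontrivial (D.A a) → ∃ n, (P a).natDegree = Nat.card k ^ n) (c : k) :
    V.smul c ≫ ξ = ξ ≫ W.smul c := by
  refine hom_ext_of_cover D fun a T e t => ?_
  obtain ⟨x, rfl⟩ := exists_smul_eq D t e
  rw [← Category.assoc, ← Category.assoc, hξ, ← V.pointOf_smul, ← W.pointOf_smul, scalars_smul,
    scalars_smul, smul_smul, smul_smul, hξ, (he a).eval₂_scalar (hP a) hs (hd a)]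

lemma IsGivenBy.comp_eq_zero_iff_of_chart (hξ : D.IsGivenBy V W P ξ)
    (he : ∀ a, IsEquation V i (D.g a) (P a)) {T : Over S} {a : D.ι} (t : T ⟶ Over.mk (D.j a))
    (f : T ⟶ V.X) : f ≫ ξ = 0 ↔ ∃ y : T ⟶ G, y ≫ i = f := by
  obtain ⟨x, rfl⟩ := exists_smul_eq D t f
  rw [hξ, he a, ← W.pointOf_zero, ← (D.isGenerator_h a T t).1.eq_iff (b := 0), zero_smul]
  exact W.rep.homEquiv.symm.injective.eq_iff

lemma IsGivenBy.comp_eq_zero_iff [Mono i] (hξ : D.IsGivenBy V W P ξ)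
    (he : ∀ a, IsEquation V i (D.g a) (P a)) {T : Over S} (f : T ⟶ V.X) :
    f ≫ ξ = 0 ↔ ∃ y : T ⟶ G, y ≫ i = f := by
  constructor
  · intro f_comp_ξ
    obtain ⟨T', e, t, isOpenImmersion, covers⟩ := exists_cover D.j D.covers T
    have exists_factorization (a : D.ι) : ∃ y : T' a ⟶ G, y ≫ i = e a ≫ f :=
      (hξ.comp_eq_zero_iff_of_chart he (t a) _).mp (by
        rw [Category.assoc, f_comp_ξ, AddMonObj.comp_zero])
    choose y y_comp_i using exists_factorization
    obtain ⟨z, z_comp_i⟩ := exists_factorization_of_openCover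
      (Scheme.Cover.mkOfCovers D.ι (fun a => (T' a).left) (fun a => (e a).left) covers
        isOpenImmersion)
      i.left f.left fun a => ⟨(y a).left, congr(($(y_comp_i a)).left)⟩
    refine ⟨Over.homMk z ?_, ?_⟩
    · rw [← Over.w i, reassoc_of% z_comp_i, Over.w f]
    · ext : 1
      exact z_comp_i
  · rintro ⟨y, rfl⟩
    refine hom_ext_of_cover D fun a T' e t => ?_
    rw [AddMonObj.comp_zero, ← Category.assoc]
    exact (hξ.comp_eq_zero_iff_of_chart he t _).mpr ⟨e ≫ y, Category.assoc _ _ _⟩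

end PowerCharts

end Construction

/-! ### Finite flat morphisms and exactness -/

section FiniteFlat

open Polynomial

-- `A[X]` is generated over the subring of polynomials in `P` by `X`, a root of `P(T) - P`.
lemma exists_adjoinRoot_equiv {A : Type u} [CommRing A] (P : A[X]) :
    ∃ e : AdjoinRoot (P.map (C : A →+* A[X]) - C (Polynomial.X : A[X])) ≃+* A[X],
      ∀ p, e (AdjoinRoot.of _ p) = p.eval₂ C P := by
  have eval₂_X_eq_zero : eval₂ (eval₂RingHom C P) Polynomial.X
      (P.map (C : A →+* A[X]) - C (Polynomial.X : A[X])) = 0 := by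
    have comp_C : (eval₂RingHom C P).comp C = (C : A →+* A[X]) := by
      ext a : 1
      simp
    rw [eval₂_sub, eval₂_map, eval₂_C, coe_eval₂RingHom, eval₂_X, sub_eq_zero, comp_C, eval₂_C_X]
  generalize hQ : P.map (C : A →+* A[X]) - C (Polynomial.X : A[X]) = Q at eval₂_X_eq_zero
  refine ⟨RingEquiv.ofRingHom (AdjoinRoot.lift (eval₂RingHom C P) Polynomial.X eval₂_X_eq_zero)
    (eval₂RingHom ((AdjoinRoot.of Q).comp C) (AdjoinRoot.root Q)) ?_ ?_,
    fun p => AdjoinRoot.lift_of eval₂_X_eq_zero⟩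
  · refine Polynomial.ringHom_ext (fun a => ?_) ?_ <;> simp
  · refine AdjoinRoot.ringHom_ext (Polynomial.ringHom_ext (fun a => ?_) ?_) ?_
    · simp
    · have eval₂_root := AdjoinRoot.eval₂_root Q
      rw [← hQ, eval₂_sub, eval₂_map, eval₂_C, sub_eq_zero, hQ] at eval₂_root
      simp [eval₂_root]
    · simp

lemma finite_flat_finrank_of_monic {A : Type u} [CommRing A] [Nontrivial A] {P : A[X]}
    (hP : P.Monic) (hd : P.natDegree ≠ 0) :
    IsFinite (Spec.map (CommRingCat.ofHom (eval₂RingHom C P))) ∧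
      Flat (Spec.map (CommRingCat.ofHom (eval₂RingHom C P))) ∧
      ∀ x, (Spec.map (CommRingCat.ofHom (eval₂RingHom C P))).finrank x = P.natDegree := by
  obtain ⟨e, he⟩ := exists_adjoinRoot_equiv P
  have natDegree_eq :
      (P.map (C : A →+* A[X]) - C (Polynomial.X : A[X])).natDegree = P.natDegree := by
    rw [natDegree_sub_C, hP.natDegree_map]
  have monic : (P.map (C : A →+* A[X]) - C (Polynomial.X : A[X])).Monic := by
    refine (hP.map C).sub_of_left ?_
    rw [degree_eq_natDegree (hP.map C).ne_zero, hP.natDegree_map]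
    exact degree_C_le.trans_lt (by exact_mod_cast hd.bot_lt)
  generalize P.map (C : A →+* A[X]) - C (Polynomial.X : A[X]) = Q at *
  have := monic.free_adjoinRoot
  have := monic.finite_adjoinRoot
  have map_eq : Spec.map (CommRingCat.ofHom (eval₂RingHom C P)) =
      Spec.map e.toCommRingCatIso.hom ≫
        Spec.map (CommRingCat.ofHom (algebraMap A[X] (AdjoinRoot Q))) := by
    rw [← Spec.map_comp]
    congr 1
    exact CommRingCat.hom_ext (RingHom.ext fun p => (he p).symm)
  have : IsFinite (Spec.map (CommRingCat.ofHom (algebraMap A[X] (AdjoinRoot Q)))) :=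
    (IsFinite.SpecMap_iff _).mpr (RingHom.finite_algebraMap.mpr inferInstance)
  have : Flat (Spec.map (CommRingCat.ofHom (algebraMap A[X] (AdjoinRoot Q)))) :=
    Flat.SpecMap_iff.mpr (RingHom.flat_algebraMap_iff.mpr inferInstance)
  rw [map_eq]
  refine ⟨inferInstance, inferInstance, fun x => ?_⟩
  rw [Scheme.Hom.finrank_comp_left_of_isIso]
  refine (Scheme.Hom.finrank_SpecMap_algebraMap A[X] (AdjoinRoot Q) x).trans ?_
  rw [Module.rankAtStalk_eq_finrank_of_free, ← natDegree_eq]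
  exact finrank_quotient_span_eq_natDegree' monic

end FiniteFlat

section Exactness

open scoped AddMonObj

lemma exists_epi_lift {X Y T : Over S} (p : X ⟶ Y) [Flat p.left] [Surjective p.left]
    [QuasiCompact p.left] (a : T ⟶ Y) :
    ∃ (T' : Over S) (e : T' ⟶ T) (b : T' ⟶ X), Epi e ∧ b ≫ p = e ≫ a := by
  have : Epi (pullback.fst a.left p.left) := Flat.epi_of_flat_of_surjective _
  refine ⟨Over.mk (pullback.fst a.left p.left ≫ T.hom), Over.homMk (pullback.fst a.left p.left),
    Over.homMk (pullback.snd a.left p.left) ?_, ?_, ?_⟩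
  · rw [← Over.w p, ← pullback.condition_assoc, Over.w a]
    rfl
  · exact @Over.epi_of_epi_left _ _ _ _ _ _ this
  · ext : 1
    exact pullback.condition.symm

lemma exists_comp_eq_of_flat {X Y T : Over S} (p : X ⟶ Y) [Flat p.left] [Surjective p.left]
    [QuasiCompact p.left] (f : X ⟶ T)
    (hf : ∀ (Q : Over S) (a b : Q ⟶ X), a ≫ p = b ≫ p → a ≫ f = b ≫ f) :
    ∃ d : Y ⟶ T, p ≫ d = f := by
  have : Epi p.left := Flat.epi_of_flat_of_surjective _
  let d : Y.left ⟶ T.left := EffectiveEpi.desc p.left f.left fun {Q} a b hab => by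
    have w : b ≫ X.hom = a ≫ X.hom := by
      rw [← Over.w p, reassoc_of% hab]
    exact congr(($(hf (Over.mk (a ≫ X.hom)) (Over.homMk a) (Over.homMk b w) (by
      ext : 1
      exact hab))).left)
  have p_comp_d : p.left ≫ d = f.left := EffectiveEpi.fac _ _ _
  refine ⟨Over.homMk d ?_, ?_⟩
  · rw [← cancel_epi p.left, reassoc_of% p_comp_d, Over.w f, Over.w p]
  · ext : 1
    exact p_comp_d

lemma isAddMonHom_of_comp_left {X Y Z : Over S} [AddGrpObj X] [AddGrpObj Y] [AddGrpObj Z]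
    {p : X ⟶ Y} [Flat p.left] [Surjective p.left] [QuasiCompact p.left] {d : Y ⟶ Z}
    (hp : IsAddMonHom p) (hd : IsAddMonHom (p ≫ d)) : IsAddMonHom d := by
  refine isAddMonHom_of_add _ fun Q a b => ?_
  obtain ⟨Q₁, e₁, a₁, _, ha₁⟩ := exists_epi_lift p a
  obtain ⟨Q₂, e₂, b₂, _, hb₂⟩ := exists_epi_lift p (e₁ ≫ b)
  have ha₂ : e₂ ≫ e₁ ≫ a = (e₂ ≫ a₁) ≫ p := by rw [Category.assoc, ha₁]
  rw [← cancel_epi e₁, ← cancel_epi e₂]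
  simp only [← Category.assoc, AddMonObj.comp_add]
  rw [Category.assoc e₂ e₁ a, Category.assoc e₂ e₁ b, ha₂, ← hb₂,
    ← add_comp_of_isAddMonHom p hp, Category.assoc _ p, Category.assoc _ p, Category.assoc _ p,
    add_comp_of_isAddMonHom _ hd]

lemma isShortExact_of_flat {X Y Z : Over S} [AddGrpObj X] [AddGrpObj Y] [AddGrpObj Z]
    {i : X ⟶ Y} {p : Y ⟶ Z} [Mono i] (hi : IsAddMonHom i) (hp : IsAddMonHom p)
    [Flat p.left] [Surjective p.left] [QuasiCompact p.left]
    (hker : ∀ (T : Over S) (f : T ⟶ Y), f ≫ p = 0 ↔ ∃ y : T ⟶ X, y ≫ i = f) :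
    IsShortExact i p := by
  have : Epi p.left := Flat.epi_of_flat_of_surjective _
  have : Epi p := Over.epi_of_epi_left p
  have i_comp_p : i ≫ p = 0 := (hker _ i).mpr ⟨𝟙 _, Category.id_comp _⟩
  refine ⟨fun T _ a b _ _ h => (cancel_mono i).mp h, fun T _ f hf => ⟨fun h => ?_, ?_⟩,
    fun T _ a b _ _ h => (cancel_epi p).mp h, fun T _ f hf => ⟨fun h => ?_, ?_⟩⟩
  · obtain ⟨y, rfl⟩ := (hker T f).mp h
    refine ⟨y, isAddMonHom_of_add _ fun T' a b => ?_, rfl⟩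
    rw [← cancel_mono i, add_comp_of_isAddMonHom i hi, Category.assoc, Category.assoc,
      Category.assoc, add_comp_of_isAddMonHom _ hf]
  · rintro ⟨a, _, rfl⟩
    exact (hker T _).mpr ⟨a, rfl⟩
  · have comp_eq_of_comp_eq (Q : Over S) (a b : Q ⟶ Y) (hab : a ≫ p = b ≫ p) :
        a ≫ f = b ≫ f := by
      obtain ⟨y, hy⟩ := (hker Q (a - b)).mp (by rw [sub_comp_of_isAddMonHom p hp, hab, sub_self])
      rw [← sub_eq_zero, ← sub_comp_of_isAddMonHom f hf, ← hy, Category.assoc, h,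
        AddMonObj.comp_zero]
    obtain ⟨d, rfl⟩ := exists_comp_eq_of_flat p f comp_eq_of_comp_eq
    exact ⟨d, isAddMonHom_of_comp_left hp hf, rfl⟩
  · rintro ⟨a, ha, rfl⟩
    rw [reassoc_of% i_comp_p, zero_comp_of_isAddMonHom a ha]

end Exactness

section Quotient

open Polynomial
open scoped AddMonObj

variable {k : Type u} [Field k] {s : S ⟶ Spec (.of k)} {L M : S.Modules}

lemma pointRingHom_homMk {A C : CommRingCat.{u}} {j : Spec A ⟶ S} {j' : Spec C ⟶ S} (φ : A ⟶ C)
    (w : Spec.map φ ≫ j = j') (a : A) :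
    pointRingHom (Over.homMk (Spec.map φ) w : Over.mk j' ⟶ Over.mk j) a =
      pointRingHom (𝟙 (Over.mk j')) (φ.hom a) := by
  subst w
  exact pointRingHom_specMapOver j φ a

/-- The endomorphism `X ↦ P` of the affine line over `Spec A`. -/
def affineLineMap {A : CommRingCat.{u}} (j : Spec A ⟶ S) (P : A[X]) : affineLine j ⟶ affineLine j :=
  Over.homMk (Spec.map (CommRingCat.ofHom (eval₂RingHom C P))) (by
    refine (Category.assoc _ _ _).symm.trans (congrArg (· ≫ j) ?_)
    refine (Spec.map_comp _ _).symm.trans (congrArg Spec.map ?_)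
    exact CommRingCat.hom_ext (RingHom.ext fun a => eval₂_C C P))

lemma affineLineMap_proj {A : CommRingCat.{u}} (j : Spec A ⟶ S) (P : A[X]) :
    affineLineMap j P ≫ affineLineProj j = affineLineProj j := by
  ext : 1
  refine (Spec.map_comp _ _).symm.trans (congrArg Spec.map ?_)
  exact CommRingCat.hom_ext (RingHom.ext fun a => eval₂_C C P)

lemma pullFunction_affineLineMap {A : CommRingCat.{u}} (j : Spec A ⟶ S) (P : A[X]) :
    pullFunction (affineLineMap j P) (affineLineCoord j) =
      P.eval₂ (pointRingHom (affineLineProj j)) (affineLineCoord j) := by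
  have pointRingHom_eq := pointRingHom_affineLine (𝟙 (affineLine j)) P
  rw [Category.id_comp, pullFunction_id] at pointRingHom_eq
  rw [← pointRingHom_eq, affineLineCoord, ← pointRingHom_comp_apply, Category.comp_id]
  refine (pointRingHom_homMk _ _ _).trans (congrArg _ ?_)
  exact eval₂_X C P

lemma affineLineMap_finite_flat {A : CommRingCat.{u}} (j : Spec A ⟶ S) {P : A[X]} (hP : P.Monic)
    {r : ℕ} (hd : Nontrivial A → P.natDegree = r) (hr : Nontrivial A → r ≠ 0) :
    IsFinite (affineLineMap j P).left ∧ Flat (affineLineMap j P).left ∧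
      ∀ x, (affineLineMap j P).left.finrank x = r := by
  cases subsingleton_or_nontrivial A
  · have bijective : Function.Bijective (eval₂RingHom C P) :=
      ⟨fun _ _ _ => Subsingleton.elim _ _, fun b => ⟨b, Subsingleton.elim _ _⟩⟩
    have : IsEmpty (PrimeSpectrum A[X]) := PrimeSpectrum.isEmpty_iff_subsingleton.mpr inferInstance
    exact ⟨(IsFinite.SpecMap_iff _).mpr (.of_surjective _ bijective.2),
      Flat.SpecMap_iff.mpr (.of_bijective bijective),
      fun x => isEmptyElim (α := PrimeSpectrum A[X]) x⟩
  · obtain rfl := hd inferInstance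
    exact finite_flat_finrank_of_monic hP (hr inferInstance)

lemma isZariskiLocalAtTarget_isFinite : IsZariskiLocalAtTarget (@IsFinite.{u}) :=
  (HasAffineProperty.iff.mp ((HasAffineProperty.affineAnd_iff _ RingHom.finite_respectsIso
    RingHom.finite_localizationPreserves.away RingHom.finite_ofLocalizationSpan).mpr
      fun f => isFinite_iff f)).1

namespace PowerCharts

variable {V : LineBundle s L} {W : LineBundle s M} {G : Over S} {i : G ⟶ V.X} {ρ : S → ℕ}
  {D : PowerCharts s L M ρ} {P : ∀ a, (D.A a)[X]} {ξ : V.X ⟶ W.X}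

lemma IsGivenBy.isPullback (hξ : D.IsGivenBy V W P ξ) (a : D.ι) :
    IsPullback (V.chart (D.g a)).left (affineLineMap (D.j a) (P a)).left ξ.left
      (W.chart (D.h a)).left := by
  have isPullback_V := (V.isPullback_chart (D.isGenerator_g a)).flip
  have isPullback_W := (W.isPullback_chart (D.isGenerator_h a)).flip
  have chart_comp_ξ := W.comp_chart (D.h a) (affineLineMap (D.j a) (P a))
  rw [pullFunction_affineLineMap, affineLineMap_proj, ← hξ] at chart_comp_ξ
  rw [← affineLineMap_proj (D.j a) (P a), ← Over.w ξ] at isPullback_V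
  exact (IsPullback.of_right isPullback_V congr(($chart_comp_ξ).left) isPullback_W).flip

lemma IsGivenBy.of_affineLineMap (hξ : D.IsGivenBy V W P ξ) (Q : MorphismProperty Scheme.{u})
    (hloc : IsZariskiLocalAtTarget Q) (hQ : ∀ a, Q (affineLineMap (D.j a) (P a)).left) :
    Q ξ.left := by
  have (a : D.ι) := W.isOpenImmersion_chart (D.isGenerator_h a)
  let 𝒰 : W.X.left.OpenCover := Scheme.Cover.mkOfCovers D.ι (fun a => (affineLine (D.j a)).left)
    (fun a => (W.chart (D.h a)).left) (W.exists_chart D.covers D.isGenerator_h) this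
  refine IsZariskiLocalAtTarget.of_openCover 𝒰 fun a => ?_
  have hQa := hQ a
  rw [← (hξ.isPullback a).isoPullback_hom_snd] at hQa
  exact (MorphismProperty.cancel_left_of_respectsIso Q (hξ.isPullback a).isoPullback.hom _).mp hQa

lemma IsGivenBy.finite_flat (hξ : D.IsGivenBy V W P ξ) (hP : ∀ a, (P a).Monic)
    (hd : ∀ a, Nontrivial (D.A a) → (P a).natDegree = D.r a)
    (hr : ∀ a, Nontrivial (D.A a) → D.r a ≠ 0) :
    IsFinite ξ.left ∧ Flat ξ.left ∧ ∀ y, ξ.left.finrank y = ρ (W.X.hom y) := by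
  choose isFinite flat finrank_eq using
    fun a => affineLineMap_finite_flat (D.j a) (hP a) (hd a) (hr a)
  have : IsFinite ξ.left := hξ.of_affineLineMap @IsFinite isZariskiLocalAtTarget_isFinite isFinite
  have : Flat ξ.left := hξ.of_affineLineMap @Flat
    (HasRingHomProperty.instIsZariskiLocalAtTarget @Flat) flat
  refine ⟨‹_›, ‹_›, fun y => ?_⟩
  obtain ⟨a, z, rfl⟩ := W.exists_chart D.covers D.isGenerator_h y
  rw [← Scheme.Hom.finrank_of_isPullback _ _ _ _ (hξ.isPullback a), finrank_eq a z,
    ← D.ρ_eq a ((affineLineProj (D.j a)).left z)]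
  congr 1
  have chart_comp_hom := (W.isPullback_chart (D.isGenerator_h a)).w
  exact congr($chart_comp_hom z).symm

lemma exists_quotient [Finite k] [AddGrpObj G] (hi : V.IsFiniteFlatFqSubgroup i)
    (hG : ∀ x : S, ∃ n : ℕ, G.hom.finrank x = Nat.card k ^ n)
    (D : PowerCharts s L M G.hom.finrank) (W : LineBundle s M) :
    ∃ ξ : V.X ⟶ W.X, V.IsFqHom W ξ ∧ IsShortExact i ξ ∧ IsFinite ξ.left ∧ Flat ξ.left ∧
      ∀ y, ξ.left.finrank y = G.hom.finrank (W.X.hom y) := by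
  have := hi.mono
  choose P hP hd he using
    fun a => hi.exists_isEquation (D.isGenerator_g a) (D.r a) (D.ρ_eq a)
  obtain ⟨ξ, hξ⟩ := D.exists_isGivenBy W hP hd he
  have finrank_ne_zero (y : S) : G.hom.finrank y ≠ 0 := by
    obtain ⟨n, hn⟩ := hG y
    rw [hn]
    exact pow_ne_zero _ Nat.card_pos.ne'
  have r_eq_pow (a : D.ι) (_ : Nontrivial (D.A a)) : ∃ n, D.r a = Nat.card k ^ n := by
    obtain ⟨x⟩ : Nonempty (Spec (D.A a)) := inferInstance
    exact D.ρ_eq a x ▸ hG _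
  have r_ne_zero (a : D.ι) (_ : Nontrivial (D.A a)) : D.r a ≠ 0 := by
    obtain ⟨x⟩ : Nonempty (Spec (D.A a)) := inferInstance
    exact D.ρ_eq a x ▸ finrank_ne_zero _
  have isAddMonHom := hξ.isAddMonHom hP he hi.isHom
  obtain ⟨isFinite, flat, finrank_eq⟩ := hξ.finite_flat hP hd r_ne_zero
  have : Surjective ξ.left := ξ.left.one_le_finrank_iff_surjective.mp fun y => by
    rw [finrank_eq]
    exact Nat.one_le_iff_ne_zero.mpr (finrank_ne_zero _)
  exact ⟨ξ, ⟨isAddMonHom, hξ.smul_comp hP he hi.stable fun a ha => hd a ha ▸ r_eq_pow a ha⟩,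
    isShortExact_of_flat hi.isHom isAddMonHom fun T f => hξ.comp_eq_zero_iff he f,
    isFinite, flat, finrank_eq⟩

end PowerCharts

end Quotient

/-! ### Uniqueness of the quotient -/

section Uniqueness

open scoped AddMonObj

variable {k : Type u} [Field k] {s : S ⟶ Spec (.of k)} {L M M' : S.Modules}
  {V : LineBundle s L} {W : LineBundle s M} {W' : LineBundle s M'} {G : Over S} [AddGrpObj G]
  {i : G ⟶ V.X} {ξ : V.X ⟶ W.X} {ξ' : V.X ⟶ W'.X}

lemma isAddMonHom_id (G : Over S) [AddGrpObj G] : IsAddMonHom (𝟙 G) :=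
  isAddMonHom_of_add _ fun T a b => by simp

lemma isAddMonHom_comp {G H K : Over S} [AddGrpObj G] [AddGrpObj H] [AddGrpObj K] {f : G ⟶ H}
    {g : H ⟶ K} (hf : IsAddMonHom f) (hg : IsAddMonHom g) : IsAddMonHom (f ≫ g) :=
  isAddMonHom_of_add _ fun T a b => by
    rw [← Category.assoc, ← Category.assoc, ← Category.assoc, add_comp_of_isAddMonHom f hf,
      add_comp_of_isAddMonHom g hg]

lemma exists_isFqHom_comp_eq (hi : IsAddMonHom i) (hξ : V.IsFqHom W ξ) (he : IsShortExact i ξ)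
    (hξ' : V.IsFqHom W' ξ') (he' : IsShortExact i ξ') :
    ∃ a : W.X ⟶ W'.X, W.IsFqHom W' a ∧ ξ ≫ a = ξ' := by
  have i_comp_ξ' : i ≫ ξ' = 0 :=
    (he'.left_exact G i hi).mpr ⟨𝟙 G, isAddMonHom_id G, Category.id_comp i⟩
  obtain ⟨a, ha, hξa⟩ := (he.right_exact W'.X ξ' hξ'.isHom).mp i_comp_ξ'
  refine ⟨a, ⟨ha, fun c => ?_⟩, hξa⟩
  refine he.right_inj W'.X _ _ (isAddMonHom_comp (W.isAddMonHom_smul c) ha)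
    (isAddMonHom_comp ha (W'.isAddMonHom_smul c)) ?_
  rw [← Category.assoc, ← hξ.smul_comp, Category.assoc, reassoc_of% hξa, hξa, hξ'.smul_comp]

lemma existsUnique_iso (hi : IsAddMonHom i) (hξ : V.IsFqHom W ξ) (he : IsShortExact i ξ)
    (hξ' : V.IsFqHom W' ξ') (he' : IsShortExact i ξ') :
    ∃! θ : W.X ≅ W'.X, W.IsFqHom W' θ.hom ∧ ξ ≫ θ.hom = ξ' := by
  obtain ⟨a, ha, hξa⟩ := exists_isFqHom_comp_eq hi hξ he hξ' he'
  obtain ⟨b, hb, hξb⟩ := exists_isFqHom_comp_eq hi hξ' he' hξ he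
  refine ⟨⟨a, b, ?_, ?_⟩, ⟨ha, hξa⟩, fun θ hθ => Iso.ext ?_⟩
  · refine he.right_inj _ _ _ (isAddMonHom_comp ha.isHom hb.isHom) (isAddMonHom_id _) ?_
    rw [reassoc_of% hξa, hξb, Category.comp_id]
  · refine he'.right_inj _ _ _ (isAddMonHom_comp hb.isHom ha.isHom) (isAddMonHom_id _) ?_
    rw [reassoc_of% hξb, hξa, Category.comp_id]
  · exact he.right_inj _ _ _ hθ.1.isHom ha.isHom (hθ.2.trans hξa.symm)

lemma finite_flat_of_iso (θ : W.X ≅ W'.X) (hθ : ξ ≫ θ.hom = ξ') [IsFinite ξ'.left]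
    [Flat ξ'.left] :
    IsFinite ξ.left ∧ Flat ξ.left ∧ ∀ y, ξ.left.finrank y = ξ'.left.finrank (θ.hom.left y) := by
  have : IsIso θ.hom.left := inferInstanceAs (IsIso ((Over.forget S).map θ.hom))
  have isPullback : IsPullback (𝟙 V.X.left) ξ.left ξ'.left θ.hom.left :=
    IsPullback.of_horiz_isIso ⟨by rw [Category.id_comp, ← hθ]; rfl⟩
  exact ⟨MorphismProperty.of_isPullback isPullback ‹IsFinite _›,
    MorphismProperty.of_isPullback isPullback ‹Flat _›,
    fun y => Scheme.Hom.finrank_of_isPullback _ _ _ _ isPullback y⟩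

end Uniqueness

/-! ### The linear part of an isomorphism of line bundles -/

section ModuleHoms

variable {X : Scheme.{u}}

lemma exists_modules_hom (M N : X.Modules) (f : ∀ U : X.Opens, Γ(M, U) → Γ(N, U))
    (hadd : ∀ U x y, f U (x + y) = f U x + f U y)
    (hsmul : ∀ U (a : Γ(X, U)) x, f U (a • x) = a • f U x)
    (hres : ∀ (U V : X.Opens) (h : V ≤ U) x,
      f V (restrictSection M h x) = restrictSection N h (f U x)) :
    ∃ φ : M ⟶ N, ∀ U x, φ.app U x = f U x := by
  refine ⟨⟨⟨fun U => ModuleCat.ofHom ⟨⟨f U.unop, hadd _⟩, hsmul _⟩, fun {U V} g => ?_⟩⟩,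
    fun U x => rfl⟩
  ext x
  exact hres _ _ (leOfHom g.unop) x

end ModuleHoms

section LinearPart

open Polynomial
open scoped AddMonObj

variable {k : Type u} [Field k] {s : S ⟶ Spec (.of k)} {M M' : S.Modules}

/-- The linear part of `θ` maps the section `m` of `M` to the section `m'` of `M'`. The linear part
is read off on multiples by functions `e` with `e * e = 0`, which annihilate all other homogeneous
parts of `θ` except the constant one. -/
def LinearPartRel {W : LineBundle s M} {W' : LineBundle s M'} (θ : W.X ⟶ W'.X) (U : S.Opens)
    (m : Γ(M, U)) (m' : Γ(M', U)) : Prop :=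
  ∀ (T : Over S) (h : ⊤ ≤ T.hom ⁻¹ᵁ U) (e : Γ(T.left, ⊤)), e * e = 0 →
    W.pointOf (e • sectionOfOpen s T U h m) ≫ θ = W'.pointOf (e • sectionOfOpen s T U h m')

lemma eval₂_of_mul_self_eq_zero {A B : Type*} [CommRing A] [CommRing B] (φ : A →+* B) {e : B}
    (P : A[X]) (he : e * e = 0) :
    P.eval₂ φ e = φ (P.coeff 0) + φ (P.coeff 1) * e := by
  conv_lhs => rw [← P.divX_mul_X_add, ← P.divX.divX_mul_X_add]
  simp only [eval₂_add, eval₂_mul, eval₂_X, eval₂_C, coeff_divX, zero_add, add_mul, mul_assoc, he,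
    mul_zero]
  rw [add_comm]

lemma sections_eq_of_forall_smul_eq {A : CommRingCat.{u}} {j : Spec A ⟶ S}
    {g x y : Sections s M (Over.mk j)} (hg : IsGenerator g)
    (h : ∀ (T : Over S) (t : T ⟶ Over.mk j) (e : Γ(T.left, ⊤)), e * e = 0 →
      e • pullSection t x = e • pullSection t y) : x = y := by
  obtain ⟨a', rfl⟩ := hg.bijective.2 x
  obtain ⟨b', rfl⟩ := hg.bijective.2 y
  obtain ⟨a, rfl⟩ := (pointRingHom_id_bijective j).2 a'
  obtain ⟨b, rfl⟩ := (pointRingHom_id_bijective j).2 b'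
  let B : CommRingCat.{u} := .of (DualNumber A)
  let φ : A ⟶ B := CommRingCat.ofHom (TrivSqZeroExt.inlHom A A)
  let ε : B := (DualNumber.eps : DualNumber A)
  have smul_eq := h _ (specMapOver j φ) (pointRingHom (𝟙 (Over.mk (Spec.map φ ≫ j))) ε) (by
    rw [← map_mul]
    exact (congrArg _ DualNumber.eps_mul_eps).trans (map_zero _))
  rw [pullSection_smul, pullSection_smul, smul_smul, smul_smul, ← pointRingHom_comp_apply,
    ← pointRingHom_comp_apply, Category.comp_id, pointRingHom_specMapOver,
    pointRingHom_specMapOver] at smul_eq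
  have mul_eq := (hg _ _).1 smul_eq
  rw [← map_mul, ← map_mul] at mul_eq
  have eps_mul_eq : ε * φ a = ε * φ b := (pointRingHom_id_bijective _).1 mul_eq
  have snd_eps_mul (c : A) : TrivSqZeroExt.snd (ε * φ c : DualNumber A) = c := by
    change TrivSqZeroExt.snd ((TrivSqZeroExt.inr 1 : DualNumber A) * TrivSqZeroExt.inl c) = c
    rw [TrivSqZeroExt.inr_mul_inl, TrivSqZeroExt.snd_inr, MulOpposite.smul_eq_mul_unop,
      MulOpposite.unop_op, one_mul]
  have a_eq_b : a = b := by rw [← snd_eps_mul a, eps_mul_eq, snd_eps_mul b]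
  rw [a_eq_b]

lemma nonempty_over_hom_fromSpec {U : S.Opens} (hU : IsAffineOpen U) {T : Over S}
    (hT : ⊤ ≤ T.hom ⁻¹ᵁ U) : Nonempty (T ⟶ Over.mk hU.fromSpec) := by
  have : IsOpenImmersion (Over.mk hU.fromSpec).hom := hU.isOpenImmersion_fromSpec
  refine nonempty_over_hom_of_range_subset ?_
  rintro _ ⟨x, rfl⟩
  exact hU.opensRange_fromSpec.ge (hT (show x ∈ ⊤ from trivial))

lemma sectionOfOpen_fromSpec_bijective (s : S ⟶ Spec (.of k)) (M : S.Modules) {U : S.Opens}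
    (hU : IsAffineOpen U) :
    Function.Bijective (sectionOfOpen (L := M) s (Over.mk hU.fromSpec) U (by simp)) := by
  have : IsOpenImmersion (Over.mk hU.fromSpec).hom := hU.isOpenImmersion_fromSpec
  exact sectionOfOpen_bijective U _ hU.opensRange_fromSpec.ge

lemma eq_of_forall_smul_eq (hM : IsInvertible M) {U : S.Opens} {m n : Γ(M, U)}
    (h : ∀ (T : Over S) (hT : ⊤ ≤ T.hom ⁻¹ᵁ U) (e : Γ(T.left, ⊤)), e * e = 0 →
      e • sectionOfOpen s T U hT m = e • sectionOfOpen s T U hT n) : m = n := by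
  choose V hVU hV mem_V g hg using fun x : U => hM.exists_affine_isGeneratorOn_le x.2
  refine section_ext M U V hVU (fun x hx => ⟨⟨x, hx⟩, mem_V _⟩) fun x => ?_
  apply (sectionOfOpen_fromSpec_bijective s M (hV x)).1
  refine sections_eq_of_forall_smul_eq ((hg x).isGenerator_sectionOfOpen _ (by simp))
    fun T t e he => ?_
  have hTV : ⊤ ≤ T.hom ⁻¹ᵁ V x := by
    intro y _
    rw [← Over.w t]
    exact (hV x).opensRange_fromSpec.le ⟨t.left y, rfl⟩
  rw [pullSection_sectionOfOpen t (V x) _ hTV, pullSection_sectionOfOpen t (V x) _ hTV,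
    sectionOfOpen_restrictSection, sectionOfOpen_restrictSection]
  exact h T _ e he

lemma exists_polynomial_comp_eq {W : LineBundle s M} {W' : LineBundle s M'} (θ : W.X ⟶ W'.X)
    {A : CommRingCat.{u}} {j : Spec A ⟶ S} (g : Sections s M (Over.mk j))
    {g' : Sections s M' (Over.mk j)} (hg' : IsGenerator g') :
    ∃ Q : A[X], ∀ {T : Over S} (t : T ⟶ Over.mk j) (b : Γ(T.left, ⊤)),
      W.pointOf (b • pullSection t g) ≫ θ =
        W'.pointOf (Q.eval₂ (pointRingHom t) b • pullSection t g') := by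
  obtain ⟨Q', hQ⟩ := (hg' _ (affineLineProj j)).2 (W'.sectionOf (W.chart g ≫ θ))
  obtain ⟨Q, rfl⟩ := (pointRingHom_id_bijective _).2 Q'
  refine ⟨Q, fun {T} t b => ?_⟩
  obtain ⟨h, rfl, rfl⟩ := exists_affineLine_hom t b
  rw [← W.comp_chart]
  apply W'.sectionOf_injective
  rw [Category.assoc, W'.sectionOf_comp, ← hQ, pullSection_smul, ← pointRingHom_comp_apply,
    Category.comp_id, W'.sectionOf_pointOf, pullSection_comp]
  exact congrArg (· • _) (pointRingHom_affineLine h Q)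

lemma coeff_zero_eq_zero_of_comp_eq {W : LineBundle s M} {W' : LineBundle s M'} {θ : W.X ⟶ W'.X}
    (hθ : IsAddMonHom θ) {A : CommRingCat.{u}} {j : Spec A ⟶ S} {g : Sections s M (Over.mk j)}
    {g' : Sections s M' (Over.mk j)} (hg' : IsGenerator g') {Q : A[X]}
    (hQ : ∀ b : Γ((Over.mk j).left, ⊤), W.pointOf (b • pullSection (𝟙 _) g) ≫ θ =
      W'.pointOf (Q.eval₂ (pointRingHom (𝟙 _)) b • pullSection (𝟙 _) g')) :
    Q.coeff 0 = 0 := by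
  have pointOf_eq := hQ 0
  rw [zero_smul, W.pointOf_zero, zero_comp_of_isAddMonHom θ hθ, ← W'.pointOf_zero,
    eval₂_at_zero] at pointOf_eq
  have smul_eq := (W'.rep.homEquiv.symm.injective pointOf_eq).symm.trans
    (zero_smul Γ((Over.mk j).left, ⊤) (pullSection (𝟙 (Over.mk j)) g')).symm
  exact (map_eq_zero_iff _ (pointRingHom_id_bijective j).1).mp ((hg' _ _).1 smul_eq)

namespace LinearPartRel

variable {W : LineBundle s M} {W' : LineBundle s M'} {θ : W.X ⟶ W'.X} {U : S.Opens}
  {m n : Γ(M, U)} {m' n' : Γ(M', U)}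

lemma mono {U' : S.Opens} (hU : U' ≤ U) (h : LinearPartRel θ U m m') :
    LinearPartRel θ U' (restrictSection M hU m) (restrictSection M' hU m') := by
  intro T hT e he
  rw [sectionOfOpen_restrictSection, sectionOfOpen_restrictSection]
  exact h T _ e he

lemma add (hθ : IsAddMonHom θ) (h : LinearPartRel θ U m m') (h' : LinearPartRel θ U n n') :
    LinearPartRel θ U (m + n) (m' + n') := by
  intro T hT e he
  rw [sectionOfOpen_add, sectionOfOpen_add, smul_add, smul_add, W.pointOf_add, W'.pointOf_add,
    add_comp_of_isAddMonHom θ hθ, h T hT e he, h' T hT e he]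

lemma smul (h : LinearPartRel θ U m m') (a : Γ(S, U)) :
    LinearPartRel θ U (a • m) (a • m') := by
  intro T hT e he
  rw [sectionOfOpen_smul, sectionOfOpen_smul, smul_smul, smul_smul]
  refine h T hT _ ?_
  rw [mul_mul_mul_comm, he, zero_mul]

lemma symm {θ : W.X ≅ W'.X} (h : LinearPartRel θ.hom U m m') : LinearPartRel θ.inv U m' m := by
  intro T hT e he
  rw [← h T hT e he, Category.assoc, θ.hom_inv_id, Category.comp_id]

lemma unique (hM' : IsInvertible M') (h : LinearPartRel θ U m m') (h' : LinearPartRel θ U m n') :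
    m' = n' :=
  eq_of_forall_smul_eq (s := s) hM' fun T hT e he =>
    W'.rep.homEquiv.symm.injective ((h T hT e he).symm.trans (h' T hT e he))

lemma of_cover {ι : Type*} (U' : ι → S.Opens) (hU : ∀ i, U' i ≤ U) (hcov : ∀ x ∈ U, ∃ i, x ∈ U' i)
    (h : ∀ i, LinearPartRel θ (U' i) (restrictSection M (hU i) m)
      (restrictSection M' (hU i) m')) :
    LinearPartRel θ U m m' := by
  intro T hT e he
  let T' (i : ι) : Over S := Over.mk ((T.hom ⁻¹ᵁ U' i).ι ≫ T.hom)
  let p (i : ι) : T' i ⟶ T := Over.homMk (T.hom ⁻¹ᵁ U' i).ι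
  have (i : ι) : IsOpenImmersion (p i).left :=
    inferInstanceAs (IsOpenImmersion (T.hom ⁻¹ᵁ U' i).ι)
  have hT'U' (i : ι) : ⊤ ≤ (T' i).hom ⁻¹ᵁ U' i := fun x _ => x.2
  have hT'U (i : ι) : ⊤ ≤ (T' i).hom ⁻¹ᵁ U := (hT'U' i).trans fun x hx => hU i hx
  refine W'.sectionOf_injective (sections_ext p (fun x => ?_) fun i => ?_)
  · obtain ⟨i, hi⟩ := hcov (T.hom x) (hT trivial)
    exact ⟨i, ⟨x, hi⟩, rfl⟩
  · have pointOf_comp := h i (T' i) (hT'U' i) (pullFunction (p i) e) (by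
      rw [← map_mul, he, map_zero])
    rw [sectionOfOpen_restrictSection, sectionOfOpen_restrictSection] at pointOf_comp
    rw [← W'.sectionOf_comp, ← W'.sectionOf_comp, ← Category.assoc, W.comp_pointOf,
      W'.comp_pointOf, pullSection_smul, pullSection_smul,
      pullSection_sectionOfOpen (p i) U hT (hT'U i), pullSection_sectionOfOpen (p i) U hT (hT'U i),
      pointOf_comp]

lemma exists_of_isGeneratorOn (hθ : IsAddMonHom θ) (hU : IsAffineOpen U) {g : Γ(M, U)}
    (hg : IsGeneratorOn M U g) {g' : Γ(M', U)} (hg' : IsGeneratorOn M' U g') (m : Γ(M, U)) :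
    ∃ m', LinearPartRel θ U m m' := by
  have hfromSpec : ⊤ ≤ (Over.mk hU.fromSpec).hom ⁻¹ᵁ U := by simp
  have isGenerator_g := hg.isGenerator_sectionOfOpen (s := s) _ hfromSpec
  have isGenerator_g' := hg'.isGenerator_sectionOfOpen (s := s) _ hfromSpec
  generalize sectionOfOpen s (Over.mk hU.fromSpec) U _ g = g₀ at isGenerator_g
  generalize sectionOfOpen s (Over.mk hU.fromSpec) U _ g' = g₀' at isGenerator_g'
  obtain ⟨Q, hQ⟩ := exists_polynomial_comp_eq θ g₀ isGenerator_g'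
  have coeff_zero := coeff_zero_eq_zero_of_comp_eq hθ isGenerator_g' (hQ (𝟙 _))
  obtain ⟨a', ha⟩ := isGenerator_g.bijective.2 (sectionOfOpen s _ U hfromSpec m)
  obtain ⟨a, rfl⟩ := (pointRingHom_id_bijective hU.fromSpec).2 a'
  obtain ⟨m', hm'⟩ := (sectionOfOpen_fromSpec_bijective s M' hU).2
    (pointRingHom (𝟙 (Over.mk hU.fromSpec)) (Q.coeff 1 * a) • g₀')
  refine ⟨m', fun T hT e he => ?_⟩
  obtain ⟨t⟩ := nonempty_over_hom_fromSpec hU hT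
  have mul_self_eq_zero : (e * pointRingHom t a) * (e * pointRingHom t a) = 0 := by
    rw [mul_mul_mul_comm, he, zero_mul]
  rw [← pullSection_sectionOfOpen t U hfromSpec hT m,
    ← pullSection_sectionOfOpen t U hfromSpec hT m', ← ha, hm',
    pullSection_smul, pullSection_smul, ← pointRingHom_comp_apply, ← pointRingHom_comp_apply,
    Category.comp_id, smul_smul, smul_smul, hQ,
    eval₂_of_mul_self_eq_zero (A := Γ(S, U)) (pointRingHom t) Q mul_self_eq_zero, coeff_zero,
    map_zero, zero_add, map_mul, mul_left_comm]

lemma exists_rel (hθ : IsAddMonHom θ) (hM : IsInvertible M) (hM' : IsInvertible M')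
    (m : Γ(M, U)) : ∃ m', LinearPartRel θ U m m' := by
  have exists_local (x : U) : ∃ (V : S.Opens) (hV : V ≤ U) (_ : x.1 ∈ V) (m' : Γ(M', V)),
      LinearPartRel θ V (restrictSection M hV m) m' := by
    obtain ⟨V, hVU, -, hxV, g, hg⟩ := hM.exists_affine_isGeneratorOn_le x.2
    obtain ⟨V', hV'V, isAffineOpen, hxV', g', hg'⟩ := hM'.exists_affine_isGeneratorOn_le hxV
    exact ⟨V', hV'V.trans hVU, hxV',
      exists_of_isGeneratorOn hθ isAffineOpen (hg.mono hV'V) hg' _⟩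
  choose V hV mem_V m' hm' using exists_local
  obtain ⟨t, ht⟩ := exists_section_glue M' U V hV (fun x hx => ⟨⟨x, hx⟩, mem_V _⟩) m'
    fun i j Z hi hj => by
      have rel_i := (hm' i).mono hi
      have rel_j := (hm' j).mono hj
      rw [restrictSection_restrictSection] at rel_i rel_j
      exact rel_i.unique hM' rel_j
  refine ⟨t, of_cover V hV (fun x hx => ⟨⟨x, hx⟩, mem_V _⟩) fun i => ?_⟩
  rw [ht]
  exact hm' i

end LinearPartRel

lemma exists_linearPart_hom (hM : IsInvertible M) (hM' : IsInvertible M') {W : LineBundle s M}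
    {W' : LineBundle s M'} {θ : W.X ⟶ W'.X} (hθ : IsAddMonHom θ) :
    ∃ φ : M ⟶ M', ∀ U m, LinearPartRel θ U m (φ.app U m) := by
  choose f hf using fun (U : S.Opens) (m : Γ(M, U)) => LinearPartRel.exists_rel hθ hM hM' m
  obtain ⟨φ, hφ⟩ := exists_modules_hom M M' f
    (fun U x y => (hf U _).unique hM' ((hf U x).add hθ (hf U y)))
    (fun U a x => (hf U _).unique hM' ((hf U x).smul a))
    (fun U V h x => (hf V _).unique hM' ((hf U x).mono h))
  refine ⟨φ, fun U m => ?_⟩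
  rw [hφ]
  exact hf U m

lemma nonempty_iso_of_lineBundle_iso (hM : IsInvertible M) (hM' : IsInvertible M')
    {W : LineBundle s M} {W' : LineBundle s M'} (θ : W.X ≅ W'.X) (hθ : IsAddMonHom θ.hom) :
    Nonempty (M ≅ M') := by
  have isAddMonHom_inv : IsAddMonHom θ.inv := isAddMonHom_of_add _ fun T a b => by
    rw [← cancel_mono θ.hom, add_comp_of_isAddMonHom _ hθ]
    simp
  obtain ⟨φ, hφ⟩ := exists_linearPart_hom hM hM' hθ
  obtain ⟨ψ, hψ⟩ := exists_linearPart_hom hM' hM isAddMonHom_inv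
  refine ⟨⟨φ, ψ, ?_, ?_⟩⟩
  · ext U m
    exact (hψ U _).unique hM (hφ U m).symm
  · ext U m
    exact (hφ U _).unique hM' (LinearPartRel.symm (θ := θ.symm) (hψ U m))

end LinearPart

/-! ### Tensor powers of sheaves of modules -/

section TensorPower

open scoped TensorProduct

/-- Presheaves of modules over the structure sheaf of `S`. -/
abbrev PresheafModules (S : Scheme.{u}) : Type (u + 1) :=
  PresheafOfModules.{u} (S.presheaf ⋙ forget₂ CommRingCat RingCat)

/-- Sections of a presheaf of modules. -/
abbrev presheafSections (P : PresheafModules S) (U : S.Opens) : Type u := P.obj (.op U)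

/-- Restriction of sections of a presheaf of modules. -/
def presheafRestrict (P : PresheafModules S) {U V : S.Opens} (h : V ≤ U) :
    presheafSections P U →+ presheafSections P V :=
  (P.presheaf.map (homOfLE h).op).hom

lemma presheafRestrict_smul (P : PresheafModules S) {U V : S.Opens} (h : V ≤ U) (a : Γ(S, U))
    (x : presheafSections P U) :
    presheafRestrict P h (a • x) = restrictFunction S h a • presheafRestrict P h x :=
  P.map_smul (homOfLE h).op a x

lemma presheafRestrict_presheafRestrict (P : PresheafModules S) {U V W : S.Opens} (h : V ≤ U)
    (h' : W ≤ V) (x : presheafSections P U) :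
    presheafRestrict P h' (presheafRestrict P h x) = presheafRestrict P (h'.trans h) x :=
  congr($(P.presheaf.map_comp (homOfLE h).op (homOfLE h').op) x).symm

/-- The unit section of the zeroth tensor power. -/
def presheafUnit (U : S.Opens) : presheafSections (𝟙_ (PresheafModules S)) U := (1 : Γ(S, U))

lemma presheafRestrict_presheafUnit {U V : S.Opens} (h : V ≤ U) :
    presheafRestrict (𝟙_ (PresheafModules S)) h (presheafUnit U) = presheafUnit V :=
  (restrictFunction S h).map_one

lemma smul_presheafUnit_bijective (U : S.Opens) :
    Function.Bijective fun a : Γ(S, U) => a • presheafUnit U := by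
  have smul_eq_id : (fun a : Γ(S, U) => a • presheafUnit U) = id := funext fun a => mul_one a
  exact smul_eq_id ▸ Function.bijective_id

/-- The tensor product of sections. -/
def presheafTmul {P Q : PresheafModules S} {U : S.Opens} (x : presheafSections P U)
    (y : presheafSections Q U) : presheafSections (P ⊗ Q) U :=
  (x ⊗ₜ[Γ(S, U)] y : presheafSections P U ⊗[Γ(S, U)] presheafSections Q U)

lemma presheafRestrict_presheafTmul {P Q : PresheafModules S} {U V : S.Opens} (h : V ≤ U)
    (x : presheafSections P U) (y : presheafSections Q U) :
    presheafRestrict (P ⊗ Q) h (presheafTmul x y) =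
      presheafTmul (presheafRestrict P h x) (presheafRestrict Q h y) := rfl

lemma presheafTmul_smul {P Q : PresheafModules S} {U : S.Opens} (a b : Γ(S, U))
    (x : presheafSections P U) (y : presheafSections Q U) :
    presheafTmul (a • x) (b • y) = (a * b) • presheafTmul x y :=
  TensorProduct.smul_tmul_smul a b x y

lemma smul_tmul_bijective {R M N : Type*} [CommRing R] [AddCommGroup M] [AddCommGroup N]
    [Module R M] [Module R N] {m : M} {n : N} (hm : Function.Bijective fun a : R => a • m)
    (hn : Function.Bijective fun a : R => a • n) :
    Function.Bijective fun a : R => a • (m ⊗ₜ[R] n) := by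
  let e := (TensorProduct.lid R R).symm.trans (TensorProduct.congr
    (LinearEquiv.ofBijective (LinearMap.toSpanSingleton R M m) hm)
    (LinearEquiv.ofBijective (LinearMap.toSpanSingleton R N n) hn))
  convert e.bijective using 1
  funext a
  have e_apply : e a = ((1 : R) • m) ⊗ₜ[R] (a • n) := rfl
  rw [e_apply, one_smul, TensorProduct.tmul_smul]

lemma smul_presheafTmul_bijective {P Q : PresheafModules S} {U : S.Opens}
    {x : presheafSections P U} {y : presheafSections Q U}
    (hx : Function.Bijective fun a : Γ(S, U) => a • x)
    (hy : Function.Bijective fun a : Γ(S, U) => a • y) :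
    Function.Bijective fun a : Γ(S, U) => a • presheafTmul x y :=
  smul_tmul_bijective hx hy

/-- The tensor power of a section. -/
def presheafPow {P : PresheafModules S} {U : S.Opens} (x : presheafSections P U) :
    ∀ n, presheafSections (presheafTensorPow P n) U
  | 0 => presheafUnit U
  | n + 1 => presheafTmul (presheafPow x n) x

lemma presheafRestrict_presheafPow {P : PresheafModules S} {U V : S.Opens} (h : V ≤ U)
    (x : presheafSections P U) (n : ℕ) :
    presheafRestrict (presheafTensorPow P n) h (presheafPow x n) =
      presheafPow (presheafRestrict P h x) n := by
  induction n with
  | zero => exact presheafRestrict_presheafUnit h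
  | succ n ih =>
    exact (presheafRestrict_presheafTmul h (presheafPow x n) x).trans
      (congrArg (presheafTmul · _) ih)

lemma presheafPow_smul {P : PresheafModules S} {U : S.Opens} (a : Γ(S, U))
    (x : presheafSections P U) (n : ℕ) :
    presheafPow (a • x) n = a ^ n • presheafPow x n := by
  induction n with
  | zero => exact (by rw [pow_zero, one_smul]; rfl)
  | succ n ih =>
    rw [pow_succ]
    exact (congrArg (presheafTmul · _) ih).trans (presheafTmul_smul _ _ _ _)

lemma smul_presheafPow_bijective {P : PresheafModules S} {U : S.Opens} {x : presheafSections P U}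
    (hx : Function.Bijective fun a : Γ(S, U) => a • x) (n : ℕ) :
    Function.Bijective fun a : Γ(S, U) => a • presheafPow x n := by
  induction n with
  | zero => exact smul_presheafUnit_bijective U
  | succ n ih => exact smul_presheafTmul_bijective ih hx

lemma smul_presheafRestrict_presheafPow_bijective {P : PresheafModules S} {U V : S.Opens}
    (h : V ≤ U) {x : presheafSections P U}
    (hx : Function.Bijective fun a : Γ(S, V) => a • presheafRestrict P h x) (n : ℕ) :
    Function.Bijective fun a : Γ(S, V) =>
      a • presheafRestrict (presheafTensorPow P n) h (presheafPow x n) := by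
  rw [presheafRestrict_presheafPow]
  exact smul_presheafPow_bijective hx n

/-- The sheaf of modules associated with a presheaf of modules. -/
abbrev associatedSheaf (P : PresheafModules S) : S.Modules :=
  (PresheafOfModules.sheafification (𝟙 S.ringCatSheaf.obj)).obj P

/-- The canonical map to the associated sheaf. -/
def toAssociatedSheaf (P : PresheafModules S) (U : S.Opens) :
    presheafSections P U →+ Γ(associatedSheaf P, U) :=
  ((CategoryTheory.toSheafify (Opens.grothendieckTopology S) P.presheaf).app (.op U)).hom

lemma toAssociatedSheaf_smul (P : PresheafModules S) (U : S.Opens) (a : Γ(S, U))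
    (x : presheafSections P U) :
    toAssociatedSheaf P U (a • x) = a • toAssociatedSheaf P U x :=
  ((PresheafOfModules.sheafificationHomEquiv (𝟙 S.ringCatSheaf.obj) (P := P)
    (𝟙 (associatedSheaf P))).app (.op U)).hom.map_smul a x

lemma restrictSection_toAssociatedSheaf (P : PresheafModules S) {U V : S.Opens} (h : V ≤ U)
    (x : presheafSections P U) :
    restrictSection (associatedSheaf P) h (toAssociatedSheaf P U x) =
      toAssociatedSheaf P V (presheafRestrict P h x) :=
  congr($((CategoryTheory.toSheafify (Opens.grothendieckTopology S) P.presheaf).naturality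
    (homOfLE h).op) x).symm

lemma exists_presheafRestrict_eq (P : PresheafModules S) {U : S.Opens} {x y : presheafSections P U}
    (h : toAssociatedSheaf P U x = toAssociatedSheaf P U y) (p : S) (hp : p ∈ U) :
    ∃ (V : S.Opens) (hV : V ≤ U), p ∈ V ∧ presheafRestrict P hV x = presheafRestrict P hV y := by
  obtain ⟨V, f, hf, hpV⟩ := Presheaf.equalizerSieve_mem (Opens.grothendieckTopology S)
    (CategoryTheory.toSheafify (Opens.grothendieckTopology S) P.presheaf) x y h p hp
  exact ⟨V, leOfHom f, hpV, hf⟩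

lemma exists_toAssociatedSheaf_eq (P : PresheafModules S) {U : S.Opens}
    (x : Γ(associatedSheaf P, U)) (p : S) (hp : p ∈ U) :
    ∃ (V : S.Opens) (hV : V ≤ U) (y : presheafSections P V), p ∈ V ∧
      toAssociatedSheaf P V y = restrictSection (associatedSheaf P) hV x := by
  obtain ⟨V, f, ⟨y, hy⟩, hpV⟩ := Presheaf.imageSieve_mem (Opens.grothendieckTopology S)
    (CategoryTheory.toSheafify (Opens.grothendieckTopology S) P.presheaf) x p hp
  exact ⟨V, leOfHom f, y, hpV, hy⟩

lemma smul_restrictSection_toAssociatedSheaf_injective (P : PresheafModules S) {U V : S.Opens}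
    {g : presheafSections P U} (h : V ≤ U)
    (hg : ∀ (W : S.Opens) (hW : W ≤ V),
      Function.Injective fun a : Γ(S, W) => a • presheafRestrict P (hW.trans h) g) :
    Function.Injective fun a : Γ(S, V) =>
      a • restrictSection (associatedSheaf P) h (toAssociatedSheaf P U g) := by
  intro a b smul_eq_smul
  simp only [restrictSection_toAssociatedSheaf, ← toAssociatedSheaf_smul] at smul_eq_smul
  choose W hW hp smul_eq_smul_on using fun p : V => exists_presheafRestrict_eq P smul_eq_smul p p.2
  simp only [presheafRestrict_smul, presheafRestrict_presheafRestrict] at smul_eq_smul_on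
  exact function_ext V W hW (fun p hpV => ⟨⟨p, hpV⟩, hp _⟩) fun p =>
    hg _ (hW p) (smul_eq_smul_on p)

lemma isGeneratorOn_toAssociatedSheaf (P : PresheafModules S) {U : S.Opens}
    {g : presheafSections P U}
    (hg : ∀ (V : S.Opens) (h : V ≤ U),
      Function.Bijective fun a : Γ(S, V) => a • presheafRestrict P h g) :
    IsGeneratorOn (associatedSheaf P) U (toAssociatedSheaf P U g) := by
  have injective {V : S.Opens} (h : V ≤ U) :=
    smul_restrictSection_toAssociatedSheaf_injective P h fun W hW => (hg W (hW.trans h)).1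
  intro V h
  refine ⟨injective h, fun x => ?_⟩
  choose W hW y hp toAssociatedSheaf_y using fun p : V => exists_toAssociatedSheaf_eq P x p p.2
  choose a ha using fun p : V => (hg (W p) ((hW p).trans h)).2 (y p)
  have smul_eq_restrict (p : V) :
      a p • restrictSection (associatedSheaf P) ((hW p).trans h) (toAssociatedSheaf P U g) =
        restrictSection (associatedSheaf P) (hW p) x := by
    rw [← toAssociatedSheaf_y, ← ha, toAssociatedSheaf_smul, restrictSection_toAssociatedSheaf]
  have compatible (p q : V) (Z : S.Opens) (hp : Z ≤ W p) (hq : Z ≤ W q) :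
      restrictFunction S hp (a p) = restrictFunction S hq (a q) := by
    have smul_eq_p := congrArg (restrictSection (associatedSheaf P) hp) (smul_eq_restrict p)
    have smul_eq_q := congrArg (restrictSection (associatedSheaf P) hq) (smul_eq_restrict q)
    rw [restrictSection_smul, restrictSection_restrictSection, restrictSection_restrictSection]
      at smul_eq_p smul_eq_q
    exact injective (hp.trans ((hW p).trans h)) (smul_eq_p.trans smul_eq_q.symm)
  have covers (p : S) (hpV : p ∈ V) : ∃ q, p ∈ W q := ⟨⟨p, hpV⟩, hp _⟩
  obtain ⟨c, hc⟩ := exists_function_glue V W hW covers a compatible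
  refine ⟨c, section_ext (associatedSheaf P) V W hW covers fun p => ?_⟩
  rw [restrictSection_smul, hc, restrictSection_restrictSection, smul_eq_restrict]

end TensorPower

/-! ### Power maps -/

section PowerMap

variable {k : Type u} [Field k] {s : S ⟶ Spec (.of k)} {L M : S.Modules} {ρ : S → ℕ}

/-- A map from the sections of `L` to those of `M` that is compatible with restriction, maps
generators to generators, and behaves like the `r`-th power over the open subsets on which `ρ` is
constantly equal to `r`. -/
structure PowerMap (L M : S.Modules) (ρ : S → ℕ) where
  toFun : ∀ U : S.Opens, Γ(L, U) → Γ(M, U)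
  restrictSection_toFun : ∀ (U V : S.Opens) (h : V ≤ U) (g : Γ(L, U)),
    restrictSection M h (toFun U g) = toFun V (restrictSection L h g)
  map_smul : ∀ (U : S.Opens) (r : ℕ), (∀ x ∈ U, ρ x = r) → ∀ (a : Γ(S, U)) (g : Γ(L, U)),
    toFun U (a • g) = a ^ r • toFun U g
  isGeneratorOn : ∀ (U : S.Opens) (r : ℕ), (∀ x ∈ U, ρ x = r) → ∀ g : Γ(L, U),
    IsGeneratorOn L U g → IsGeneratorOn M U (toFun U g)

lemma subsingleton_sections_bot (M : S.Modules) : Subsingleton Γ(M, ⊥) :=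
  ⟨fun _ _ => section_ext M ⊥ (fun i : Empty => i.elim) (fun i => i.elim) (fun _ hx => hx.elim)
    fun i => i.elim⟩

/-- The power map to the tensor power. -/
def tensorPowerMap (L : S.Modules) (n : ℕ) : PowerMap L (tensorPow L n) fun _ => n where
  toFun U g := toAssociatedSheaf _ U
    (presheafPow (P := (Scheme.Modules.toPresheafOfModules S).obj L) g n)
  restrictSection_toFun U V h g := (restrictSection_toAssociatedSheaf _ h _).trans
    (congrArg _ (presheafRestrict_presheafPow _ _ _))
  map_smul U r hr a g := by
    obtain rfl | hU := eq_or_ne U ⊥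
    · exact (subsingleton_sections_bot _).elim _ _
    · obtain ⟨x, hx⟩ := (TopologicalSpace.Opens.ne_bot_iff_nonempty U).mp hU
      obtain rfl := hr x hx
      exact (congrArg _ (presheafPow_smul _ _ _)).trans (toAssociatedSheaf_smul _ _ _ _)
  isGeneratorOn U r _ g hg := isGeneratorOn_toAssociatedSheaf _ fun V h =>
    smul_presheafRestrict_presheafPow_bijective
      (P := (Scheme.Modules.toPresheafOfModules S).obj L) h (hg V h) n

lemma exists_affine_isGeneratorOn_forall_eq (hL : IsInvertible L) (hρ : IsLocallyConstant ρ)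
    (x : S) :
    ∃ (U : S.Opens) (_ : IsAffineOpen U) (_ : x ∈ U) (g : Γ(L, U)) (_ : IsGeneratorOn L U g),
      ∀ y ∈ U, ρ y = ρ x := by
  obtain ⟨V, hV, hxV, hVρ⟩ := hρ.exists_open x
  obtain ⟨U, hUV, hU, hxU, g, hg⟩ := hL.exists_affine_isGeneratorOn_le (V := ⟨V, hV⟩) hxV
  exact ⟨U, hU, hxU, g, hg, fun y hy => hVρ y (hUV hy)⟩

namespace PowerMap

lemma isInvertible (π : PowerMap L M ρ) (hL : IsInvertible L) (hρ : IsLocallyConstant ρ) :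
    IsInvertible M := by
  refine isInvertible_of_isGeneratorOn fun x => ?_
  obtain ⟨U, -, hx, g, hg, hU⟩ := exists_affine_isGeneratorOn_forall_eq hL hρ x
  exact ⟨U, hx, _, π.isGeneratorOn U _ hU g hg⟩

lemma sectionOfOpen_toFun_eq_pow_smul (π : PowerMap L M ρ) {T : Over S} {U V : S.Opens}
    (hTU : ⊤ ≤ T.hom ⁻¹ᵁ U) (hTV : ⊤ ≤ T.hom ⁻¹ᵁ V) {r : ℕ} (hr : ∀ x ∈ U, ρ x = r)
    {g : Γ(L, U)} (hg : IsGeneratorOn L U g) {g' : Γ(L, V)} {u : Γ(T.left, ⊤)}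
    (hu : sectionOfOpen s T V hTV g' = u • sectionOfOpen s T U hTU g) :
    sectionOfOpen s T V hTV (π.toFun V g') =
      u ^ r • sectionOfOpen s T U hTU (π.toFun U g) := by
  have hTUV : ⊤ ≤ T.hom ⁻¹ᵁ (U ⊓ V) := le_inf hTU hTV
  obtain ⟨v, hv : v • restrictSection L inf_le_left g = restrictSection L inf_le_right g'⟩ :=
    (hg (U ⊓ V) inf_le_left).2 (restrictSection L inf_le_right g')
  have eq_u : restrictFunction T.left hTUV (T.hom.app _ v) = u := by
    have isGenerator_g := (hg.mono (V := U ⊓ V) inf_le_left).isGenerator_sectionOfOpen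
      (s := s) T hTUV
    refine isGenerator_g.bijective.1 ?_
    change _ • sectionOfOpen s T (U ⊓ V) hTUV _ = u • sectionOfOpen s T (U ⊓ V) hTUV _
    rw [← sectionOfOpen_smul, hv, sectionOfOpen_restrictSection, hu, sectionOfOpen_restrictSection]
  calc sectionOfOpen s T V hTV (π.toFun V g')
    _ = sectionOfOpen s T (U ⊓ V) hTUV (v ^ r • restrictSection M inf_le_left (π.toFun U g)) := by
      rw [← sectionOfOpen_restrictSection hTUV inf_le_right, π.restrictSection_toFun, ← hv,
        π.map_smul _ r fun x (hx : x ∈ U ⊓ V) => hr x hx.1, π.restrictSection_toFun]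
    _ = u ^ r • sectionOfOpen s T U hTU (π.toFun U g) := by
      rw [sectionOfOpen_smul, map_pow, map_pow, eq_u, sectionOfOpen_restrictSection]

lemma nonempty_powerCharts (π : PowerMap L M ρ) (hL : IsInvertible L)
    (hρ : IsLocallyConstant ρ) (s : S ⟶ Spec (.of k)) : Nonempty (PowerCharts s L M ρ) := by
  choose U hU hx g hg hr using exists_affine_isGeneratorOn_forall_eq hL hρ
  have hU_fromSpec (x : S) : ⊤ ≤ (Over.mk (hU x).fromSpec).hom ⁻¹ᵁ U x := by simp
  have top_le_preimage {x : S} {T : Over S} (t : T ⟶ Over.mk (hU x).fromSpec) :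
      ⊤ ≤ T.hom ⁻¹ᵁ U x := fun z _ => by
    rw [← Over.w t]
    exact hU_fromSpec x (show t.left z ∈ ⊤ from trivial)
  exact ⟨{
    ι := S
    A := fun x => Γ(S, U x)
    j := fun x => (hU x).fromSpec
    isOpenImmersion := fun x => (hU x).isOpenImmersion_fromSpec
    covers := fun x => ⟨x, (hU x).opensRange_fromSpec.ge (hx x)⟩
    r := ρ
    ρ_eq := fun x y => hr x _ (hU_fromSpec x trivial)
    g := fun x => sectionOfOpen s _ (U x) (hU_fromSpec x) (g x)
    isGenerator_g := fun x => (hg x).isGenerator_sectionOfOpen _ _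
    h := fun x => sectionOfOpen s _ (U x) (hU_fromSpec x) (π.toFun _ (g x))
    isGenerator_h := fun x =>
      (π.isGeneratorOn _ _ (hr x) _ (hg x)).isGenerator_sectionOfOpen _ _
    transition := fun x y T t t' u hu => by
      rw [pullSection_sectionOfOpen t' (U y) _ (top_le_preimage t'),
        pullSection_sectionOfOpen t (U x) _ (top_le_preimage t)] at hu ⊢
      exact π.sectionOfOpen_toFun_eq_pow_smul _ _ (hr x) (hg x) hu }⟩

end PowerMap

end PowerMap
/-! ### Tensor powers with locally constant exponent -/

section LocallyConstantPower

variable {L : S.Modules} {ρ : S → ℕ}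

lemma existsUnique_section_piObj {ι : Type u} (N : ι → S.Modules) (U : S.Opens)
    (x : ∀ n, Γ(N n, U)) :
    ∃! y : Γ(∏ᶜ N, U), ∀ n, (Pi.π N n).app U y = x n := by
  let evalU : TopCat.Presheaf Ab S ⥤ Ab := (evaluation _ _).obj (.op U)
  let sectionsU : S.Modules ⥤ Type u := Scheme.Modules.toPresheaf S ⋙ evalU ⋙ forget Ab
  have : PreservesLimits evalU :=
    inferInstanceAs (PreservesLimits ((evaluation (TopologicalSpace.Opens S)ᵒᵖ Ab).obj (.op U)))
  have : PreservesLimits sectionsU := comp_preservesLimits _ _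
  obtain ⟨y, hy, hy'⟩ := (Types.isLimit_iff
    (sectionsU.mapCone (limit.cone (Discrete.functor N)))).mp
    ⟨isLimitOfPreserves sectionsU (limit.isLimit _)⟩ (fun j => x j.as) (by
      rintro ⟨i⟩ ⟨j⟩ f
      obtain rfl := Discrete.eq_of_hom f
      obtain rfl : f = 𝟙 _ := Subsingleton.elim _ _
      exact congr($((Discrete.functor N ⋙ sectionsU).map_id ⟨i⟩) (x i)))
  exact ⟨y, fun n => hy ⟨n⟩, fun z hz => hy' z fun j => hz j.as⟩

/-- The pushforward to `S` of the restriction of `M` to `Z`. For open and closed `Z` this is the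
extension by zero. -/
def cutOff (M : S.Modules) (Z : S.Opens) : S.Modules :=
  (Scheme.Modules.pushforward Z.ι).obj (M.restrict Z.ι)

/-- The canonical map from `M` to its restriction to `Z`. -/
def toCutOff (M : S.Modules) (Z : S.Opens) : M ⟶ cutOff M Z :=
  (Scheme.Modules.restrictAdjunction Z.ι).unit.app M

lemma toCutOff_bijective (M : S.Modules) {U Z : S.Opens} (h : U ≤ Z) :
    Function.Bijective ((toCutOff M Z).app U) := by
  refine restrictSection_bijective M (U := U) (V := Z.ι ''ᵁ Z.ι ⁻¹ᵁ U) (Z.ι.image_preimage_le U) ?_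
  rw [Z.ι.image_preimage_eq_opensRange_inf]
  exact le_inf (by simpa using h) le_rfl

lemma subsingleton_cutOff (M : S.Modules) {U Z : S.Opens} (h : Disjoint U Z) :
    Subsingleton Γ(cutOff M Z, U) := by
  have image_preimage_eq_bot : Z.ι ''ᵁ Z.ι ⁻¹ᵁ U = ⊥ := by
    rw [Z.ι.image_preimage_eq_opensRange_inf, Scheme.Opens.opensRange_ι, h.symm.eq_bot]
  change Subsingleton Γ(M, Z.ι ''ᵁ Z.ι ⁻¹ᵁ U)
  exact image_preimage_eq_bot ▸ subsingleton_sections_bot M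

/-- The open subset where a locally constant function takes the value `n`. -/
def levelSet (hρ : IsLocallyConstant ρ) (n : ℕ) : S.Opens := ⟨ρ ⁻¹' {n}, hρ {n}⟩

/-- The sheaf whose restriction to the open subset where `ρ = n` is the `n`-th tensor power
of `L`. -/
def locallyConstantPow (L : S.Modules) (hρ : IsLocallyConstant ρ) : S.Modules :=
  ∏ᶜ fun n : ULift.{u} ℕ => cutOff (tensorPow L n.down) (levelSet hρ n.down)

/-- The projections of `locallyConstantPow`. -/
def locallyConstantPowProj (L : S.Modules) (hρ : IsLocallyConstant ρ) (n : ℕ) :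
    locallyConstantPow L hρ ⟶ cutOff (tensorPow L n) (levelSet hρ n) :=
  Pi.π (fun n : ULift.{u} ℕ => cutOff (tensorPow L n.down) (levelSet hρ n.down)) ⟨n⟩

lemma existsUnique_locallyConstantPow (L : S.Modules) (hρ : IsLocallyConstant ρ) (U : S.Opens)
    (x : ∀ n, Γ(cutOff (tensorPow L n) (levelSet hρ n), U)) :
    ∃! y : Γ(locallyConstantPow L hρ, U), ∀ n, (locallyConstantPowProj L hρ n).app U y = x n := by
  obtain ⟨y, hy, hy'⟩ := existsUnique_section_piObj
    (fun n : ULift.{u} ℕ => cutOff (tensorPow L n.down) (levelSet hρ n.down)) U fun n => x n.down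
  exact ⟨y, fun n => hy ⟨n⟩, fun z hz => hy' z fun n => hz n.down⟩

lemma locallyConstantPow_ext {hρ : IsLocallyConstant ρ} {U : S.Opens}
    {y z : Γ(locallyConstantPow L hρ, U)}
    (h : ∀ n, (locallyConstantPowProj L hρ n).app U y = (locallyConstantPowProj L hρ n).app U z) :
    y = z :=
  (existsUnique_locallyConstantPow L hρ U _).unique h fun _ => rfl

lemma locallyConstantPowProj_bijective (hρ : IsLocallyConstant ρ) {U : S.Opens} {r : ℕ}
    (hr : ∀ x ∈ U, ρ x = r) : Function.Bijective ((locallyConstantPowProj L hρ r).app U) := by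
  have subsingleton_factor (n : ℕ) (hn : n ≠ r) :
      Subsingleton Γ(cutOff (tensorPow L n) (levelSet hρ n), U) := by
    refine subsingleton_cutOff _ (disjoint_iff_inf_le.2 fun x hx => hn ?_)
    exact Eq.trans (Eq.symm hx.2) (hr x hx.1)
  refine ⟨fun y z h => locallyConstantPow_ext fun n => ?_, fun y => ?_⟩
  · obtain rfl | hn := eq_or_ne n r
    · exact h
    · exact (subsingleton_factor n hn).elim _ _
  · obtain ⟨z, hz, -⟩ := existsUnique_locallyConstantPow L hρ U (Function.update (fun _ => 0) r y)
    exact ⟨z, (hz r).trans (Function.update_self _ _ _)⟩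

/-- The section of `locallyConstantPow L hρ` given over the open subset where `ρ = n` by the `n`-th
tensor power of `g`. -/
def locallyConstantPowSection (hρ : IsLocallyConstant ρ) {U : S.Opens} (g : Γ(L, U)) :
    Γ(locallyConstantPow L hρ, U) :=
  (existsUnique_locallyConstantPow L hρ U fun n =>
    (toCutOff (tensorPow L n) (levelSet hρ n)).app U ((tensorPowerMap L n).toFun U g)).choose

lemma locallyConstantPowProj_locallyConstantPowSection (hρ : IsLocallyConstant ρ) {U : S.Opens}
    (g : Γ(L, U)) (n : ℕ) :
    (locallyConstantPowProj L hρ n).app U (locallyConstantPowSection hρ g) =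
      (toCutOff (tensorPow L n) (levelSet hρ n)).app U ((tensorPowerMap L n).toFun U g) :=
  (existsUnique_locallyConstantPow L hρ U _).choose_spec.1 n

/-- The power map for a locally constant exponent. -/
def locallyConstantPowerMap (L : S.Modules) (hρ : IsLocallyConstant ρ) :
    PowerMap L (locallyConstantPow L hρ) ρ where
  toFun _ g := locallyConstantPowSection hρ g
  restrictSection_toFun U V h g := locallyConstantPow_ext fun n => by
    simp only [app_restrictSection, locallyConstantPowProj_locallyConstantPowSection]
    rw [← app_restrictSection, (tensorPowerMap L n).restrictSection_toFun]
  map_smul U r hr a g := (locallyConstantPowProj_bijective hρ hr).1 <| by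
    simp only [Scheme.Modules.Hom.app_smul, locallyConstantPowProj_locallyConstantPowSection,
      (tensorPowerMap L r).map_smul U r fun _ _ => rfl]
  isGeneratorOn U r hr g hg V hV := by
    have hr_V (x) (hx : x ∈ V) : ρ x = r := hr x (hV hx)
    rw [← (locallyConstantPowProj_bijective hρ hr_V).of_comp_iff']
    convert (toCutOff_bijective (tensorPow L r) (Z := levelSet hρ r) hr_V).comp
      ((tensorPowerMap L r).isGeneratorOn U r (fun _ _ => rfl) g hg V hV) using 1
    funext a
    simp only [Function.comp_apply, Scheme.Modules.Hom.app_smul, app_restrictSection,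
      locallyConstantPowProj_locallyConstantPowSection]

end LocallyConstantPower

section Quotient

variable {k : Type u} [Field k] [Finite k] {s : S ⟶ Spec (.of k)} {L M M' : S.Modules}
  {V : LineBundle s L} {G : Over S} [AddGrpObj G] {i : G ⟶ V.X}

lemma PowerMap.exists_isShortExact (π : PowerMap L M G.hom.finrank) (hL : IsInvertible L)
    (hi : V.IsFiniteFlatFqSubgroup i) (hG : ∀ x : S, ∃ n : ℕ, G.hom.finrank x = Nat.card k ^ n)
    (hρ : IsLocallyConstant G.hom.finrank) :
    ∃ (W : LineBundle s M) (ξ : V.X ⟶ W.X), V.IsFqHom W ξ ∧ IsShortExact i ξ ∧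
      IsFinite ξ.left ∧ Flat ξ.left ∧ ∀ y, ξ.left.finrank y = G.hom.finrank (W.X.hom y) := by
  obtain ⟨D⟩ := π.nonempty_powerCharts hL hρ s
  obtain ⟨W⟩ := nonempty_lineBundle (s := s) (π.isInvertible hL hρ)
  exact ⟨W, PowerCharts.exists_quotient hi hG D W⟩

lemma PowerMap.nonempty_iso_and_finite_flat (π : PowerMap L M' G.hom.finrank)
    (hL : IsInvertible L) (hi : V.IsFiniteFlatFqSubgroup i)
    (hG : ∀ x : S, ∃ n : ℕ, G.hom.finrank x = Nat.card k ^ n)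
    (hρ : IsLocallyConstant G.hom.finrank) (hM : IsInvertible M) {W : LineBundle s M}
    {ξ : V.X ⟶ W.X} (hξ : V.IsFqHom W ξ) (he : IsShortExact i ξ) :
    Nonempty (M ≅ M') ∧ IsFinite ξ.left ∧ Flat ξ.left ∧
      ∀ y, ξ.left.finrank y = G.hom.finrank (W.X.hom y) := by
  obtain ⟨W', ξ', hξ', he', hfinite, hflat, finrank_ξ'⟩ := π.exists_isShortExact hL hi hG hρ
  obtain ⟨θ, ⟨hθ, hθξ⟩, -⟩ := existsUnique_iso hi.isHom hξ he hξ' he'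
  obtain ⟨isFinite_ξ, flat_ξ, finrank_ξ⟩ := finite_flat_of_iso θ hθξ
  refine ⟨nonempty_iso_of_lineBundle_iso hM (π.isInvertible hL hρ) θ hθ.isHom, isFinite_ξ, flat_ξ,
    fun y => ?_⟩
  rw [finrank_ξ, finrank_ξ', ← Scheme.Hom.comp_apply, Over.w]

end Quotient
end FqBundle

end

theorem mainTheorem10_general (k : Type u) [Field k] [Finite k] (S : Scheme.{u})
    (s : S ⟶ Spec (.of k)) (L : S.Modules) (hL : FqBundle.IsInvertible L) :
    Nonempty (FqBundle.LineBundle s L) ∧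
    ∀ (V : FqBundle.LineBundle s L) (G : Over S) [AddGrpObj G] (i : G ⟶ V.X)
      [LocallyOfFinitePresentation G.hom],
      V.IsFiniteFlatFqSubgroup i →
      (∀ x : S, ∃ n : ℕ, G.hom.finrank x = Nat.card k ^ n) →
      (∃ (M : S.Modules) (_ : FqBundle.IsInvertible M) (W : FqBundle.LineBundle s M)
        (ξ : V.X ⟶ W.X), V.IsFqHom W ξ ∧ FqBundle.IsShortExact i ξ) ∧
      (∀ (M M' : S.Modules), FqBundle.IsInvertible M → FqBundle.IsInvertible M' →
        ∀ (W : FqBundle.LineBundle s M) (W' : FqBundle.LineBundle s M')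
          (ξ : V.X ⟶ W.X) (ξ' : V.X ⟶ W'.X),
          V.IsFqHom W ξ → FqBundle.IsShortExact i ξ →
          V.IsFqHom W' ξ' → FqBundle.IsShortExact i ξ' →
          ∃! θ : W.X ≅ W'.X, W.IsFqHom W' θ.hom ∧ ξ ≫ θ.hom = ξ') ∧
      (ConnectedSpace S → ∃ r : ℕ, (∀ x : S, G.hom.finrank x = r) ∧
        ∀ (M : S.Modules), FqBundle.IsInvertible M →
          ∀ (W : FqBundle.LineBundle s M) (ξ : V.X ⟶ W.X),
            V.IsFqHom W ξ → FqBundle.IsShortExact i ξ →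
            Nonempty (M ≅ FqBundle.tensorPow L r) ∧
            IsFinite ξ.left ∧ Flat ξ.left ∧ ∀ y : W.X.left, ξ.left.finrank y = r) := by
  refine ⟨FqBundle.nonempty_lineBundle hL, fun V G _ i _ hi hG => ?_⟩
  have := hi.finite
  have := hi.flat
  have hρ := G.hom.isLocallyConstant_finrank
  refine ⟨?_, ?_, fun _ => ?_⟩
  · let π := FqBundle.locallyConstantPowerMap L hρ
    obtain ⟨W, ξ, hξ, he, -⟩ := π.exists_isShortExact hL hi hG hρ
    exact ⟨_, π.isInvertible hL hρ, W, ξ, hξ, he⟩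
  · intro M M' _ _ W W' ξ ξ' hξ he hξ' he'
    exact FqBundle.existsUnique_iso hi.isHom hξ he hξ' he'
  · obtain ⟨r, finrank_eq⟩ := hρ.exists_eq_const
    have π : FqBundle.PowerMap L (FqBundle.tensorPow L r) G.hom.finrank :=
      finrank_eq ▸ FqBundle.tensorPowerMap L r
    refine ⟨r, congrFun finrank_eq, fun M hM W ξ hξ he => ?_⟩
    obtain ⟨iso, finite, flat, finrank⟩ := π.nonempty_iso_and_finite_flat hL hi hG hρ hM hξ he
    exact ⟨iso, finite, flat, fun y => (finrank y).trans (congrFun finrank_eq _)⟩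

theorem mainTheorem10 (k : Type u) [Field k] [Finite k] (S : Scheme.{u}) [IsLocallyNoetherian S]
    (s : S ⟶ Spec (.of k)) (L : S.Modules) (hL : FqBundle.IsInvertible L) :
    Nonempty (FqBundle.LineBundle s L) ∧
    ∀ (V : FqBundle.LineBundle s L) (G : Over S) [AddGrpObj G] (i : G ⟶ V.X),
      V.IsFiniteFlatFqSubgroup i →
      (∀ x : S, ∃ n : ℕ, G.hom.finrank x = Nat.card k ^ n) →
      (∃ (M : S.Modules) (_ : FqBundle.IsInvertible M) (W : FqBundle.LineBundle s M)
        (ξ : V.X ⟶ W.X), V.IsFqHom W ξ ∧ FqBundle.IsShortExact i ξ) ∧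
      (∀ (M M' : S.Modules), FqBundle.IsInvertible M → FqBundle.IsInvertible M' →
        ∀ (W : FqBundle.LineBundle s M) (W' : FqBundle.LineBundle s M')
          (ξ : V.X ⟶ W.X) (ξ' : V.X ⟶ W'.X),
          V.IsFqHom W ξ → FqBundle.IsShortExact i ξ →
          V.IsFqHom W' ξ' → FqBundle.IsShortExact i ξ' →
          ∃! θ : W.X ≅ W'.X, W.IsFqHom W' θ.hom ∧ ξ ≫ θ.hom = ξ') ∧
      (ConnectedSpace S → ∃ r : ℕ, (∀ x : S, G.hom.finrank x = r) ∧
        ∀ (M : S.Modules), FqBundle.IsInvertible M →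
          ∀ (W : FqBundle.LineBundle s M) (ξ : V.X ⟶ W.X),
            V.IsFqHom W ξ → FqBundle.IsShortExact i ξ →
            Nonempty (M ≅ FqBundle.tensorPow L r) ∧
            IsFinite ξ.left ∧ Flat ξ.left ∧ ∀ y : W.X.left, ξ.left.finrank y = r) := by
  refine ⟨FqBundle.nonempty_lineBundle hL, fun V G _ i hi => ?_⟩
  have := hi.finite
  have := (LocallyOfFinitePresentation.iff_locallyOfFiniteType (f := G.hom)).2 inferInstance
  exact (mainTheorem10_general k S s L hL).2 V G i hi
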